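/- Let $k$ be a field of characteristic $p>0$, let $V$ denote a variable finite dimensional $k$-vector space, and let $i\ge 0$ be an integer. Conventions. A strict polynomial functor $F$ assigns to each $V$ a $k$-vector space $F(V)$, and to each $R$-linear map $R\otimes V\to R\otimes W$ ($R$ any commutative $k$-algebra) an $R$-linear map $R\otimes F(V)\to R\otimes F(W)$, compatibly with composition, identities and change of $R$; it is homogeneous of weight $d$ if $r\cdot\mathrm{id}$ acts on $R\otimes F(V)$ by $r^d$ for all $R$ and all $r\in R$. A graded $\mathcal P_k$-algebra is a bigraded algebra $A(V)=\bigoplus_{d,j\ge0}A^d_j(V)$, where $A^d_j$ is a homogeneous strict polynomial functor of weight $d$ and $j$ is called the degree, whose multiplication is a morphism of strict polynomial functors; isomorphisms of graded $\mathcal P_k$-algebras are algebra isomorphisms which preserve weights and degrees and are natural with respect to the strict polynomial structures. Tensor products of algebras carry the product $(a\otimes b)(a'\otimes b')=aa'\otimes bb'$, and an infinite tensor product is the colimit of the finite ones. The algebra $A$ is exponential if the maps $A(V)\otimes A(W)\to A(V\oplus W)$ induced by the multiplication are isomorphisms. For $r\ge 0$ let $V^{(r)}\subset S^{p^r}(V)$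 be the strict polynomial subfunctor generated by the $p^r$-th powers of elements of $V$. Let $\Gamma(V[i])$ be the divided power algebra of $V$, with $\Gamma^d(V)$ in weight $d$ and degree $di$, and let $\Gamma(V^{(r)}[j])$ be the divided power algebra of $V^{(r)}$, with $\Gamma^d(V^{(r)})$ in weight $dp^r$ and degree $dj$. Let $Q(V)=\bigoplus_n Q^n(V)$ be the truncated polynomial algebra, i.e. the quotient of $S(V)$ by the ideal generated by $V^{(1)}$; $Q(V[i])$ and $Q(V^{(r)}[j])$ are graded in the same way. A filtration of a graded $\mathcal P_k$-algebra $A$ is a decreasing sequence of strict polynomial subfunctors $A=F^0\supset F^1\supset\cdots$, each the direct sum of its intersections with the $A^d_j$, such that $\bigcap_n F^n=0$ and $F^mF^n\subset F^{m+n}$; then $\mathrm{gr}\,A=\bigoplus_n \mathrm{gr}^nA$ with $\mathrm{gr}^nA=F^n/F^{n+1}$ is a graded $\mathcal P_k$-algebra for the weights and degrees of $A$. The filtration is quasi-trivial if $\mathrm{gr}\,A$ is exponential, all $(\mathrm{gr}\,A)^d_j(V)$ are finite dimensional, and there is an isomorphism of $k$-algebras $A(k)\simeq \mathrm{gr}\,A(k)$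 preserving weights and degrees. Statement. (1) Let $\mathcal I(V)\subset\Gamma(V[i])$ be the ideal generated by $V=\Gamma^1(V)$. The powers $F^n=\mathcal I(V)^n$ form a filtration of $\Gamma(V[i])$. This filtration is quasi-trivial, and there is an isomorphism of graded $\mathcal P_k$-algebras $$\mathrm{gr}\,\Gamma(V[i])\simeq Q(V[i])\otimes\Gamma(V^{(1)}[pi])$$ which maps $\mathrm{gr}^n\,\Gamma(V[i])=\mathcal I(V)^n/\mathcal I(V)^{n+1}$ onto $Q^n(V)\otimes\Gamma(V^{(1)})$ for all $n\ge0$. (2) There are a quasi-trivial filtration of $\Gamma(V[i])$ and an isomorphism of graded $\mathcal P_k$-algebras $$\mathrm{gr}\,\Gamma(V[i])\simeq\bigotimes_{r\ge0}Q(V^{(r)}[ip^r]).$$ -/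

import Mathlib

open TensorProduct

universe u

/-!
# Graded strict polynomial algebras

Throughout `k` is a field and `V`, `W` are finite dimensional vector spaces over `k`.

A strict polynomial functor assigns to every finite dimensional `V` a vector space `F(V)`, and to
every commutative `k`-algebra `R` and every `R`-linear map `f : R ⊗ V → R ⊗ W` an `R`-linear map
`F(f) : R ⊗ F(V) → R ⊗ F(W)`, compatibly with identities, composition and change of the ring `R`.
(As `V` is finite dimensional, `R ↦ Hom_R(R ⊗ V, R ⊗ W)` is the functor of points of the affine
space `Hom(V, W)`, so that this datum is the same as a polynomial law on `Hom(V, W)`.)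

A bigraded algebra `A(V) = ⨁ A^d_j(V)`, whose components are homogeneous strict polynomial functors
of weight `d` and whose multiplication is natural, is encoded by the maps `A(s, f)`, which act on
`A^d_j` as `s ^ j • A^d_j(f)`, for `s` in `R`. The weight `d` and the degree `j` are read off from
the action of the pair `(s, f) = (s, r • id)`, which is multiplication by `r ^ d * s ^ j` on `A^d_j`.
Conversely, such maps `A(s, f)` yield a decomposition of `A(V)` into these components:
see `PAlg.isInternal_comp` below.
-/

namespace StrictPoly

section Prelim

variable {k : Type*} [Field k]

/-- Change of scalars `R ⊗ M → S ⊗ M` along a homomorphism `R → S` of `k`-algebras. -/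
abbrev push {R S : Type*} [CommRing R] [Algebra k R] [CommRing S] [Algebra k S]
    (φ : R →ₐ[k] S) (M : Type*) [AddCommGroup M] [Module k M] : R ⊗[k] M →ₗ[k] S ⊗[k] M :=
  φ.toLinearMap.rTensor M

/-- The `R`-linear extension of a `k`-algebra homomorphism `A → R ⊗ B`. -/
noncomputable def extend {R A B : Type*} [CommRing R] [Algebra k R] [CommRing A] [Algebra k A]
    [CommRing B] [Algebra k B] (g : A →ₐ[k] R ⊗[k] B) : R ⊗[k] A →ₐ[R] R ⊗[k] B :=
  Algebra.TensorProduct.lift (Algebra.ofId R _) g (fun _ _ => Commute.all _ _)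

variable {R S A B C : Type*} [CommRing R] [Algebra k R] [CommRing S] [Algebra k S]
  [CommRing A] [Algebra k A] [CommRing B] [Algebra k B] [CommRing C] [Algebra k C]

@[simp]
theorem extend_tmul (g : A →ₐ[k] R ⊗[k] B) (r : R) (a : A) : extend g (r ⊗ₜ a) = r • g a := by
  simp [extend, Algebra.ofId_apply, Algebra.smul_def]

theorem algHom_tmul (g : R ⊗[k] A →ₐ[R] R ⊗[k] B) (r : R) (a : A) :
    g (r ⊗ₜ a) = r • g (1 ⊗ₜ a) := by
  rw [← map_smul, TensorProduct.smul_tmul', smul_eq_mul, mul_one]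

theorem algHom_ext_one {g h : R ⊗[k] A →ₐ[R] R ⊗[k] B}
    (H : ∀ a, g (1 ⊗ₜ a) = h (1 ⊗ₜ a)) : g = h := by
  apply AlgHom.ext
  intro x
  induction x with
  | zero => simp
  | tmul r a => rw [algHom_tmul g, algHom_tmul h, H]
  | add x y hx hy => rw [map_add, map_add, hx, hy]

theorem push_smul {M : Type*} [AddCommGroup M] [Module k M] (φ : R →ₐ[k] S) (r : R)
    (x : R ⊗[k] M) : push φ M (r • x) = φ r • push φ M x := by
  induction x with
  | zero => simp
  | tmul r a => simp [TensorProduct.smul_tmul']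
  | add x y hx hy => simp only [smul_add, map_add, hx, hy]

/-- Change of scalars as an algebra homomorphism. -/
noncomputable def pushAlg (φ : R →ₐ[k] S) (A : Type*) [CommRing A] [Algebra k A] :
    R ⊗[k] A →ₐ[k] S ⊗[k] A :=
  Algebra.TensorProduct.map φ (AlgHom.id k A)

theorem pushAlg_apply (φ : R →ₐ[k] S) (x : R ⊗[k] A) : pushAlg φ A x = push φ A x := rfl

theorem push_of_one (φ : R →ₐ[k] S) {g : R ⊗[k] A →ₐ[R] R ⊗[k] B} {h : S ⊗[k] A →ₐ[S] S ⊗[k] B}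
    (H : ∀ a, h (1 ⊗ₜ a) = push φ B (g (1 ⊗ₜ a))) (x : R ⊗[k] A) :
    h (push φ A x) = push φ B (g x) := by
  induction x with
  | zero => simp
  | tmul r a =>
    rw [algHom_tmul g, push_smul, ← H, ← algHom_tmul h]
    simp
  | add x y hx hy => simp only [map_add, hx, hy]

/-- The `R`-algebra homomorphism `R ⊗ A → R ⊗ B` induced by a `k`-algebra homomorphism `A → B`. -/
noncomputable abbrev ext (R : Type*) [CommRing R] [Algebra k R] (g : A →ₐ[k] B) :
    R ⊗[k] A →ₐ[R] R ⊗[k] B :=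
  Algebra.TensorProduct.map (AlgHom.id R R) g

theorem push_ext (φ : R →ₐ[k] S) (g : A →ₐ[k] B) (x : R ⊗[k] A) :
    push φ B (ext R g x) = ext S g (push φ A x) := by
  symm
  apply push_of_one
  intro a
  simp

end Prelim

/-- A graded strict polynomial algebra over `k` (with zero differential), with commutative values.
`map s f` is the action of the `R`-linear map `f : R ⊗ V → R ⊗ W`, multiplied by `s ^ j` on the
component of degree `j`. -/
structure PAlg (k : Type u) [Field k] where
  /-- The value at `V`. -/
  obj : FGModuleCat.{u} k → Type u
  [commRing : ∀ V, CommRing (obj V)]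
  [algebra : ∀ V, Algebra k (obj V)]
  /-- The action on morphisms, for all commutative `k`-algebras `R`. -/
  map : ∀ {R : Type u} [CommRing R] [Algebra k R] {V W : FGModuleCat.{u} k},
    R → (R ⊗[k] V →ₗ[R] R ⊗[k] W) → (R ⊗[k] obj V →ₐ[R] R ⊗[k] obj W)
  map_one_id : ∀ (R : Type u) [CommRing R] [Algebra k R] (V : FGModuleCat.{u} k),
    map (1 : R) (LinearMap.id : R ⊗[k] V →ₗ[R] R ⊗[k] V) = AlgHom.id R _
  map_mul_comp : ∀ {R : Type u} [CommRing R] [Algebra k R] {V W X : FGModuleCat.{u} k} (s t : R)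
    (g : R ⊗[k] W →ₗ[R] R ⊗[k] X) (f : R ⊗[k] V →ₗ[R] R ⊗[k] W),
    map (s * t) (g ∘ₗ f) = (map s g).comp (map t f)
  map_push : ∀ {R S : Type u} [CommRing R] [Algebra k R] [CommRing S] [Algebra k S]
    (φ : R →ₐ[k] S) {V W : FGModuleCat.{u} k} (s : R)
    (f : R ⊗[k] V →ₗ[R] R ⊗[k] W) (f' : S ⊗[k] V →ₗ[S] S ⊗[k] W),
    (∀ x, f' (push φ V x) = push φ W (f x)) →
    ∀ y, map (φ s) f' (push φ (obj V) y) = push φ (obj W) (map s f y)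

attribute [instance] PAlg.commRing PAlg.algebra

namespace PAlg

variable {k : Type u} [Field k]

/-- The component `A^d_j(V)` of weight `d` and degree `j` of `A(V)`: the scalar endomorphisms
`r • id` of `R ⊗ V` act by `r ^ d`, and `s` acts by `s ^ j`. -/
def comp (A : PAlg k) (d j : ℕ) (V : FGModuleCat.{u} k) : Submodule k (A.obj V) where
  carrier := {x | ∀ (R : Type u) [CommRing R] [Algebra k R] (r s : R),
    A.map s (r • LinearMap.id : R ⊗[k] V →ₗ[R] R ⊗[k] V) (1 ⊗ₜ x) = (r ^ d * s ^ j) ⊗ₜ x}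
  add_mem' hx hy R _ _ r s := by
    rw [TensorProduct.tmul_add, map_add, hx R r s, hy R r s, TensorProduct.tmul_add]
  zero_mem' R _ _ r s := by simp
  smul_mem' c x hx R _ _ r s := by
    rw [TensorProduct.tmul_smul, TensorProduct.tmul_smul, ← hx R r s]
    exact map_smul ((A.map s (r • LinearMap.id : R ⊗[k] V →ₗ[R] R ⊗[k] V)).restrictScalars k) c _

/-- Constructor from `k`-algebra homomorphisms `A(V) → R ⊗ A(W)`. -/
noncomputable def ofExtend (k : Type u) [Field k] (obj : FGModuleCat.{u} k → Type u)
    [∀ V, CommRing (obj V)] [∀ V, Algebra k (obj V)]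
    (g : ∀ {R : Type u} [CommRing R] [Algebra k R] {V W : FGModuleCat.{u} k},
      R → (R ⊗[k] V →ₗ[R] R ⊗[k] W) → (obj V →ₐ[k] R ⊗[k] obj W))
    (h_id : ∀ (R : Type u) [CommRing R] [Algebra k R] (V : FGModuleCat.{u} k),
      g (1 : R) (LinearMap.id : R ⊗[k] V →ₗ[R] R ⊗[k] V) = Algebra.TensorProduct.includeRight)
    (h_comp : ∀ {R : Type u} [CommRing R] [Algebra k R] {V W X : FGModuleCat.{u} k} (s t : R)
      (b : R ⊗[k] W →ₗ[R] R ⊗[k] X) (a : R ⊗[k] V →ₗ[R] R ⊗[k] W),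
      g (s * t) (b ∘ₗ a) = ((extend (g s b)).restrictScalars k).comp (g t a))
    (h_push : ∀ {R S : Type u} [CommRing R] [Algebra k R] [CommRing S] [Algebra k S]
      (φ : R →ₐ[k] S) {V W : FGModuleCat.{u} k} (s : R)
      (f : R ⊗[k] V →ₗ[R] R ⊗[k] W) (f' : S ⊗[k] V →ₗ[S] S ⊗[k] W),
      (∀ x, f' (push φ V x) = push φ W (f x)) → g (φ s) f' = (pushAlg φ (obj W)).comp (g s f)) :
    PAlg k where
  obj := obj
  map s f := extend (g s f)
  map_one_id R _ _ V := by
    apply algHom_ext_one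
    intro a
    rw [h_id]
    simp
  map_mul_comp s t b a := by
    apply algHom_ext_one
    intro x
    rw [h_comp]
    simp
  map_push φ V W s f f' h := by
    apply push_of_one
    intro a
    rw [h_push φ s f f' h]
    simp [pushAlg_apply]

/-- `A(f) : A(V) → R ⊗ A(W)` restricted to `A(V)`. -/
noncomputable def mapRes (A : PAlg k) {R : Type u} [CommRing R] [Algebra k R]
    {V W : FGModuleCat.{u} k} (s : R) (f : R ⊗[k] V →ₗ[R] R ⊗[k] W) :
    A.obj V →ₐ[k] R ⊗[k] A.obj W :=
  ((A.map s f).restrictScalars k).comp Algebra.TensorProduct.includeRight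

theorem mapRes_apply (A : PAlg k) {R : Type u} [CommRing R] [Algebra k R]
    {V W : FGModuleCat.{u} k} (s : R) (f : R ⊗[k] V →ₗ[R] R ⊗[k] W) (a : A.obj V) :
    A.mapRes s f a = A.map s f (1 ⊗ₜ a) := rfl

theorem ofExtend_mapRes (k : Type u) [Field k] (obj : FGModuleCat.{u} k → Type u)
    [∀ V, CommRing (obj V)] [∀ V, Algebra k (obj V)]
    (g : ∀ {R : Type u} [CommRing R] [Algebra k R] {V W : FGModuleCat.{u} k},
      R → (R ⊗[k] V →ₗ[R] R ⊗[k] W) → (obj V →ₐ[k] R ⊗[k] obj W)) (h_id) (h_comp) (h_push)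
    {R : Type u} [CommRing R] [Algebra k R] {V W : FGModuleCat.{u} k} (s : R)
    (f : R ⊗[k] V →ₗ[R] R ⊗[k] W) (a : obj V) :
    (ofExtend k obj g h_id h_comp h_push).mapRes s f a = g s f a :=
  (extend_tmul (g s f) 1 a).trans (one_smul _ _)

section Sym

variable {R S : Type u} [CommRing R] [Algebra k R] [CommRing S] [Algebra k S]
  {V W X : FGModuleCat.{u} k}

/-- The homomorphism `S(V) → R ⊗ S(W)`, `v ↦ f (1 ⊗ v)`. -/
noncomputable def symMap (f : R ⊗[k] V →ₗ[R] R ⊗[k] W) :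
    SymmetricAlgebra k V →ₐ[k] R ⊗[k] SymmetricAlgebra k W :=
  SymmetricAlgebra.lift
    (((SymmetricAlgebra.ι k W).baseChange R ∘ₗ f).restrictScalars k ∘ₗ TensorProduct.mk k R V 1)

theorem symMap_ι (f : R ⊗[k] V →ₗ[R] R ⊗[k] W) (v : V) :
    symMap f (SymmetricAlgebra.ι k V v) = (SymmetricAlgebra.ι k W).baseChange R (f (1 ⊗ₜ v)) := by
  simp [symMap]

theorem extend_symMap (f : R ⊗[k] V →ₗ[R] R ⊗[k] W) (x : R ⊗[k] V) :
    extend (symMap f) ((SymmetricAlgebra.ι k V).baseChange R x) =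
      (SymmetricAlgebra.ι k W).baseChange R (f x) := by
  induction x with
  | zero => simp
  | tmul r v =>
    rw [LinearMap.baseChange_tmul, extend_tmul, symMap_ι, ← map_smul, ← map_smul,
      TensorProduct.smul_tmul', smul_eq_mul, mul_one]
  | add x y hx hy => simp only [map_add, hx, hy]

theorem push_baseChange {M N : Type*} [AddCommGroup M] [Module k M] [AddCommGroup N] [Module k N]
    (φ : R →ₐ[k] S) (g : M →ₗ[k] N) (x : R ⊗[k] M) :
    push φ N (g.baseChange R x) = g.baseChange S (push φ M x) := by
  induction x with
  | zero => simp
  | tmul r v => simp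
  | add x y hx hy => simp only [map_add, hx, hy]

/-- The symmetric algebra `S(V)`, in degree `0`. -/
noncomputable def sym (k : Type u) [Field k] : PAlg k :=
  ofExtend k (fun V => SymmetricAlgebra k V) (fun _ f => symMap f)
    (by
      intro R _ _ V
      apply SymmetricAlgebra.algHom_ext
      ext v
      simp [symMap_ι])
    (by
      intro R _ _ V W X s t b a
      apply SymmetricAlgebra.algHom_ext
      ext v
      simp [symMap_ι, extend_symMap])
    (by
      intro R S _ _ _ _ φ V W s f f' h
      apply SymmetricAlgebra.algHom_ext
      ext v
      have := h (1 ⊗ₜ v)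
      simp only [LinearMap.rTensor_tmul, AlgHom.toLinearMap_apply, map_one] at this
      simp [symMap_ι, pushAlg_apply, this, push_baseChange])

end Sym

section Gamma

variable {R S : Type u} [CommRing R] [Algebra k R] [CommRing S] [Algebra k S]

open Finset hiding mem_antidiagonal antidiagonal in
open Finset.HasAntidiagonal in
theorem mul_dp_aux {B : Type*} [CommRing B] {a b : ℕ → B}
    (ha : ∀ n p, a n * a p = (n + p).choose n • a (n + p))
    (hb : ∀ n p, b n * b p = (n + p).choose n • b (n + p)) (n p : ℕ) :
    (∑ x ∈ antidiagonal n, a x.1 * b x.2) * (∑ x ∈ antidiagonal p, a x.1 * b x.2) =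
      (n + p).choose n • ∑ x ∈ antidiagonal (n + p), a x.1 * b x.2 := by
  have key : ∀ x ∈ antidiagonal n,
      ∑ y ∈ antidiagonal p, ((x.1 + y.1).choose x.1 * (x.2 + y.2).choose x.2) •
        (a (x.1 + y.1) * b (x.2 + y.2)) =
      ∑ z ∈ antidiagonal (n + p), (z.1.choose x.1 * z.2.choose x.2) • (a z.1 * b z.2) := by
    intro x hx
    rw [mem_antidiagonal] at hx
    refine sum_of_injOn (fun y => (x.1 + y.1, x.2 + y.2)) ?_ ?_ ?_ ?_
    · rintro ⟨y1, y2⟩ _ ⟨z1, z2⟩ _ h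
      simp only [Prod.mk.injEq] at h ⊢
      omega
    · rintro ⟨y1, y2⟩ hy
      simp only [mem_coe, mem_antidiagonal] at hy ⊢
      omega
    · rintro ⟨z1, z2⟩ hz hz'
      rw [mem_antidiagonal] at hz
      simp only [Set.mem_image, mem_coe, mem_antidiagonal, Prod.exists, not_exists, not_and,
        Prod.mk.injEq] at hz'
      by_cases h1 : z1 < x.1
      · simp [Nat.choose_eq_zero_of_lt h1]
      · by_cases h2 : z2 < x.2
        · simp [Nat.choose_eq_zero_of_lt h2]
        · exact absurd (show x.2 + (z2 - x.2) = z2 by omega)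
            (hz' (z1 - x.1) (z2 - x.2) (by simp only at hz; omega) (by omega))
    · rintro ⟨y1, y2⟩ _
      rfl
  calc _ = ∑ x ∈ antidiagonal n, ∑ y ∈ antidiagonal p,
        ((x.1 + y.1).choose x.1 * (x.2 + y.2).choose x.2) • (a (x.1 + y.1) * b (x.2 + y.2)) := by
        rw [sum_mul_sum]
        refine sum_congr rfl fun x _ => sum_congr rfl fun y _ => ?_
        rw [mul_mul_mul_comm, ha, hb, smul_mul_smul_comm]
    _ = ∑ x ∈ antidiagonal n, ∑ z ∈ antidiagonal (n + p),
        (z.1.choose x.1 * z.2.choose x.2) • (a z.1 * b z.2) := sum_congr rfl key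
    _ = _ := by
        rw [sum_comm, smul_sum]
        refine sum_congr rfl fun z hz => ?_
        rw [mem_antidiagonal] at hz
        rw [← hz, Nat.add_choose_eq, sum_smul]

open DividedPowerAlgebra in
/-- The exponential series of `r ⊗ w`, as a function of `w`. -/
noncomputable def expSeriesAux (R : Type u) [CommRing R] [Algebra k R] (W : Type u) [AddCommGroup W]
    [Module k W] (r : R) : W →+ Additive (PowerSeries (R ⊗[k] DividedPowerAlgebra k W)) where
  toFun w := Additive.ofMul (PowerSeries.mk fun n => (r ^ n) ⊗ₜ[k] dp k n w)
  map_zero' := by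
    apply Additive.toMul.injective
    ext n
    rcases n with _ | n <;>
      simp [dp_null, PowerSeries.coeff_one, Algebra.TensorProduct.one_def]
  map_add' v w := by
    apply Additive.toMul.injective
    ext n
    simp only [toMul_ofMul, PowerSeries.coeff_mk, toMul_add, PowerSeries.coeff_mul, dp_add,
      TensorProduct.tmul_sum]
    refine Finset.sum_congr rfl fun x hx => ?_
    rw [Finset.HasAntidiagonal.mem_antidiagonal] at hx
    rw [Algebra.TensorProduct.tmul_mul_tmul, ← pow_add, hx]

open DividedPowerAlgebra in
/-- The exponential series `∑ rⁿ ⊗ γₙ(w) Tⁿ` of `r ⊗ w`, extended to sums. -/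
noncomputable def expSeries (R : Type u) [CommRing R] [Algebra k R] (W : Type u) [AddCommGroup W]
    [Module k W] : R ⊗[k] W →+ Additive (PowerSeries (R ⊗[k] DividedPowerAlgebra k W)) :=
  TensorProduct.liftAddHom (R := k) (M := R) (N := W)
    (P := Additive (PowerSeries (R ⊗[k] DividedPowerAlgebra k W)))
    { toFun := expSeriesAux R W
      map_zero' := by
        refine AddMonoidHom.ext fun w => Additive.toMul.injective (PowerSeries.ext fun n => ?_)
        rcases n with _ | n <;>
          simp [expSeriesAux, dp_zero, PowerSeries.coeff_one, Algebra.TensorProduct.one_def]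
      map_add' := by
        intro r s
        refine AddMonoidHom.ext fun w => Additive.toMul.injective (PowerSeries.ext fun n => ?_)
        change PowerSeries.coeff n (PowerSeries.mk fun n => ((r + s) ^ n) ⊗ₜ[k] dp k n w) =
          PowerSeries.coeff n ((PowerSeries.mk fun n => (r ^ n) ⊗ₜ[k] dp k n w) *
            (PowerSeries.mk fun n => (s ^ n) ⊗ₜ[k] dp k n w))
        simp only [PowerSeries.coeff_mk, PowerSeries.coeff_mul]
        rw [add_pow, ← Finset.Nat.sum_antidiagonal_eq_sum_range_succ_mk
          (fun x => r ^ x.1 * s ^ x.2 * (n.choose x.1 : R)), TensorProduct.sum_tmul]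
        refine Finset.sum_congr rfl fun x hx => ?_
        rw [Finset.HasAntidiagonal.mem_antidiagonal] at hx
        rw [Algebra.TensorProduct.tmul_mul_tmul, dp_mul, hx, mul_comm _ (Nat.cast _),
          ← nsmul_eq_mul, TensorProduct.smul_tmul] }
    (by
      intro c r w
      apply Additive.toMul.injective
      ext n
      simp [expSeriesAux, dp_smul, smul_pow, TensorProduct.smul_tmul])

/-- The divided powers `γₙ(x) ∈ R ⊗ Γ(W)` of an element `x` of `R ⊗ W`; they are determined by
`γₙ(r ⊗ w) = rⁿ ⊗ γₙ(w)` and `γₙ(x + y) = ∑ γᵢ(x) γₙ₋ᵢ(y)`. -/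
noncomputable def dpow {W : Type u} [AddCommGroup W] [Module k W] (n : ℕ) (x : R ⊗[k] W) :
    R ⊗[k] DividedPowerAlgebra k W :=
  PowerSeries.coeff n (expSeries R W x).toMul

section

variable {W : Type u} [AddCommGroup W] [Module k W]

theorem dpow_tmul (n : ℕ) (r : R) (w : W) :
    dpow n (r ⊗ₜ[k] w) = (r ^ n) ⊗ₜ DividedPowerAlgebra.dp k n w := by
  simp [dpow, expSeries, expSeriesAux]

theorem dpow_add (n : ℕ) (x y : R ⊗[k] W) :
    dpow n (x + y) = ∑ z ∈ Finset.HasAntidiagonal.antidiagonal n, dpow z.1 x * dpow z.2 y := by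
  simp [dpow, PowerSeries.coeff_mul]

theorem dpow_null (n : ℕ) : dpow n (0 : R ⊗[k] W) = if n = 0 then 1 else 0 := by
  simp [dpow, PowerSeries.coeff_one]

theorem dpow_zero (x : R ⊗[k] W) : dpow 0 x = 1 := by
  induction x with
  | zero => simp [dpow_null]
  | tmul r w => simp [dpow_tmul, DividedPowerAlgebra.dp_zero, Algebra.TensorProduct.one_def]
  | add x y hx hy => simp [dpow_add, hx, hy]

theorem dpow_smul (n : ℕ) (r : R) (x : R ⊗[k] W) : dpow n (r • x) = r ^ n • dpow n x := by
  induction x generalizing n with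
  | zero => rcases n with _ | n <;> simp [dpow_null]
  | tmul r w => simp [dpow_tmul, TensorProduct.smul_tmul', mul_pow]
  | add x y hx hy =>
    rw [smul_add, dpow_add, dpow_add, Finset.smul_sum]
    refine Finset.sum_congr rfl fun z hz => ?_
    rw [Finset.HasAntidiagonal.mem_antidiagonal] at hz
    rw [hx, hy, smul_mul_smul_comm, ← pow_add, hz]

theorem dpow_mul (n p : ℕ) (x : R ⊗[k] W) :
    dpow n x * dpow p x = (n + p).choose n • dpow (n + p) x := by
  induction x generalizing n p with
  | zero =>
    rcases n with _ | n
    · simp [dpow_null]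
    · rcases p with _ | p <;> simp [dpow_null]
  | tmul r w =>
    rw [dpow_tmul, dpow_tmul, dpow_tmul, Algebra.TensorProduct.tmul_mul_tmul,
      DividedPowerAlgebra.dp_mul, pow_add, TensorProduct.tmul_smul]
  | add x y hx hy =>
    rw [dpow_add, dpow_add, dpow_add]
    exact mul_dp_aux (a := fun n => dpow n x) (b := fun n => dpow n y) hx hy n p

theorem dpow_push (φ : R →ₐ[k] S) (n : ℕ) (x : R ⊗[k] W) :
    dpow n (push φ W x) = push φ _ (dpow n x) := by
  rw [← pushAlg_apply]
  induction x generalizing n with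
  | zero => rcases n with _ | n <;> simp [dpow_null]
  | tmul r w => simp [dpow_tmul, pushAlg]
  | add x y hx hy => simp only [map_add, dpow_add, hx, hy, map_sum, map_mul]

end

variable {V W X : FGModuleCat.{u} k}

/-- The homomorphism `Γ(V) → R ⊗ Γ(W)`, `γₙ(v) ↦ γₙ(f (1 ⊗ v))`. -/
noncomputable def gammaMap (f : R ⊗[k] V →ₗ[R] R ⊗[k] W) :
    DividedPowerAlgebra k V →ₐ[k] R ⊗[k] DividedPowerAlgebra k W :=
  DividedPowerAlgebra.lift' (f := fun x => dpow x.1 (f (1 ⊗ₜ x.2)))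
    (fun m => dpow_zero _)
    (fun n r m => by
      simp only
      rw [← TensorProduct.smul_tmul, ← algebraMap_smul R r (1 : R),
        ← TensorProduct.smul_tmul', map_smul, dpow_smul, ← map_pow, algebraMap_smul])
    (fun n p m => dpow_mul _ _ _)
    (fun n u v => by
      simp only
      rw [TensorProduct.tmul_add, map_add, dpow_add])

theorem gammaMap_dp (f : R ⊗[k] V →ₗ[R] R ⊗[k] W) (n : ℕ) (v : V) :
    gammaMap f (DividedPowerAlgebra.dp k n v) = dpow n (f (1 ⊗ₜ v)) := by
  simp [gammaMap]

theorem extend_gammaMap (f : R ⊗[k] V →ₗ[R] R ⊗[k] W) (n : ℕ) (x : R ⊗[k] V) :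
    extend (gammaMap f) (dpow n x) = dpow n (f x) := by
  induction x generalizing n with
  | zero => rcases n with _ | n <;> simp [dpow_null]
  | tmul r v =>
    rw [dpow_tmul, extend_tmul, gammaMap_dp, ← dpow_smul, ← map_smul, TensorProduct.smul_tmul',
      smul_eq_mul, mul_one]
  | add x y hx hy => simp only [map_add, dpow_add, hx, hy, map_sum, map_mul]

theorem gamma_hom_ext {M : Type u} [AddCommGroup M] [Module k M] {B : Type u} [CommRing B]
    [Algebra k B] {f g : DividedPowerAlgebra k M →ₐ[k] B}
    (h : ∀ n m, f (DividedPowerAlgebra.dp k n m) = g (DividedPowerAlgebra.dp k n m)) : f = g :=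
  DividedPowerAlgebra.algHom_ext h

/-- The divided power algebra `Γ(V)`, in degree `0`. -/
noncomputable def gamma (k : Type u) [Field k] : PAlg k :=
  ofExtend k (fun V => DividedPowerAlgebra k V) (fun _ f => gammaMap f)
    (by
      intro R _ _ V
      apply gamma_hom_ext (M := V) (B := R ⊗[k] DividedPowerAlgebra k V)
      intro n v
      simp [gammaMap_dp, dpow_tmul])
    (by
      intro R _ _ V W X s t b a
      apply gamma_hom_ext (M := V) (B := R ⊗[k] DividedPowerAlgebra k X)
      intro n v
      simp [gammaMap_dp, extend_gammaMap])
    (by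
      intro R S _ _ _ _ φ V W s f f' h
      apply gamma_hom_ext (M := V) (B := S ⊗[k] DividedPowerAlgebra k W)
      intro n v
      have := h (1 ⊗ₜ v)
      simp only [LinearMap.rTensor_tmul, AlgHom.toLinearMap_apply, map_one] at this
      simp [gammaMap_dp, pushAlg_apply, this, dpow_push])

end Gamma
section Constructions

variable {R S : Type u} [CommRing R] [Algebra k R] [CommRing S] [Algebra k S]
  {V W X : FGModuleCat.{u} k}

/-- The extension of `A.mapRes` is `A.map`. -/
theorem extend_mapRes (A : PAlg k) (s : R) (f : R ⊗[k] V →ₗ[R] R ⊗[k] W) :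
    extend (A.mapRes s f) = A.map s f :=
  algHom_ext_one fun a => by simp [mapRes_apply]

theorem mapRes_push (A : PAlg k) (φ : R →ₐ[k] S) (s : R)
    (f : R ⊗[k] V →ₗ[R] R ⊗[k] W) (f' : S ⊗[k] V →ₗ[S] S ⊗[k] W)
    (h : ∀ x, f' (push φ V x) = push φ W (f x)) (a : A.obj V) :
    A.mapRes (φ s) f' a = push φ _ (A.mapRes s f a) := by
  rw [mapRes_apply, mapRes_apply, ← A.map_push φ s f f' h]
  simp

theorem mapRes_one_id (A : PAlg k) (a : A.obj V) :
    A.mapRes (1 : R) (LinearMap.id : R ⊗[k] V →ₗ[R] R ⊗[k] V) a = 1 ⊗ₜ a := by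
  rw [mapRes_apply, A.map_one_id]
  rfl

theorem mapRes_mul_comp (A : PAlg k) (s t : R) (g : R ⊗[k] W →ₗ[R] R ⊗[k] X)
    (f : R ⊗[k] V →ₗ[R] R ⊗[k] W) (a : A.obj V) :
    A.mapRes (s * t) (g ∘ₗ f) a = A.map s g (A.mapRes t f a) := by
  rw [mapRes_apply, A.map_mul_comp]
  rfl

/-- The homomorphism induced on quotients by a homomorphism `A → R ⊗ A'`. -/
noncomputable def descend {A A' : Type u} [CommRing A] [Algebra k A] [CommRing A'] [Algebra k A']
    (J : Ideal A) (J' : Ideal A') (g : A →ₐ[k] R ⊗[k] A')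
    (h : ∀ a ∈ J, ext R (Ideal.Quotient.mkₐ k J') (g a) = 0) : A ⧸ J →ₐ[k] R ⊗[k] (A' ⧸ J') :=
  Ideal.Quotient.liftₐ J (((ext R (Ideal.Quotient.mkₐ k J')).restrictScalars k).comp g) h

theorem descend_mk {A A' : Type u} [CommRing A] [Algebra k A] [CommRing A'] [Algebra k A']
    (J : Ideal A) (J' : Ideal A') (g : A →ₐ[k] R ⊗[k] A')
    (h : ∀ a ∈ J, ext R (Ideal.Quotient.mkₐ k J') (g a) = 0) (a : A) :
    descend J J' g h (Ideal.Quotient.mk J a) = ext R (Ideal.Quotient.mkₐ k J') (g a) := rfl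

/-- The quotient of a graded `P_k`-algebra by a family of ideals stable under all morphisms. -/
noncomputable def quot (A : PAlg k) (J : ∀ V, Ideal (A.obj V))
    (hJ : ∀ {R : Type u} [CommRing R] [Algebra k R] {V W : FGModuleCat.{u} k} (s : R)
      (f : R ⊗[k] V →ₗ[R] R ⊗[k] W), ∀ a ∈ J V,
      ext R (Ideal.Quotient.mkₐ k (J W)) (A.mapRes s f a) = 0) : PAlg k :=
  ofExtend k (fun V => A.obj V ⧸ J V)
    (fun {_ _ _ V W} s f => descend (J V) (J W) (A.mapRes s f) (hJ s f))
    (by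
      intro R _ _ V
      apply Ideal.Quotient.algHom_ext
      ext a
      simp [descend_mk, mapRes_one_id])
    (by
      intro R _ _ V W X s t b a
      apply Ideal.Quotient.algHom_ext
      ext x
      simp only [AlgHom.comp_apply, AlgHom.restrictScalars_apply, Ideal.Quotient.mkₐ_eq_mk,
        descend_mk, mapRes_mul_comp]
      generalize A.mapRes t a x = y
      induction y with
      | zero => simp
      | tmul r y =>
        rw [algHom_tmul]
        simp [mapRes_apply, descend_mk]
      | add x y hx hy => simp only [map_add, hx, hy])
    (by
      intro R S _ _ _ _ φ V W s f f' h
      apply Ideal.Quotient.algHom_ext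
      ext x
      simp only [AlgHom.comp_apply, Ideal.Quotient.mkₐ_eq_mk, descend_mk,
        A.mapRes_push φ s f f' h, pushAlg_apply, push_ext])

theorem quot_mapRes (A : PAlg k) (J : ∀ V, Ideal (A.obj V)) (hJ) (s : R)
    (f : R ⊗[k] V →ₗ[R] R ⊗[k] W) (a : A.obj V) :
    (A.quot J hJ).mapRes s f (Ideal.Quotient.mk (J V) a) =
      ext R (Ideal.Quotient.mkₐ k (J W)) (A.mapRes s f a) :=
  ofExtend_mapRes k (fun V => A.obj V ⧸ J V) _ _ _ _ s f (Ideal.Quotient.mk (J V) a)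

theorem ext_val_injective {A : Type u} [CommRing A] [Algebra k A] (B : Subalgebra k A) (R : Type u)
    [CommRing R] [Algebra k R] : Function.Injective (ext R B.val) :=
  Module.Flat.lTensor_preserves_injective_linearMap (M := R) B.val.toLinearMap
    Subtype.val_injective

/-- The restriction of an `R`-algebra homomorphism to subalgebras. -/
noncomputable def restr {A A' : Type u} [CommRing A] [Algebra k A] [CommRing A'] [Algebra k A']
    (B : Subalgebra k A) (B' : Subalgebra k A') (g : A →ₐ[k] R ⊗[k] A')
    (h : ∀ a ∈ B, g a ∈ (ext R B'.val).range) : B →ₐ[k] R ⊗[k] B' :=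
  ((AlgEquiv.ofInjective (ext R B'.val) (ext_val_injective B' R)).symm.toAlgHom.restrictScalars
    k).comp ((g.comp B.val).codRestrict ((ext R B'.val).range.restrictScalars k)
      (fun a => h a a.2))

theorem ext_restr {A A' : Type u} [CommRing A] [Algebra k A] [CommRing A'] [Algebra k A']
    (B : Subalgebra k A) (B' : Subalgebra k A') (g : A →ₐ[k] R ⊗[k] A')
    (h : ∀ a ∈ B, g a ∈ (ext R B'.val).range) (a : B) :
    ext R B'.val (restr B B' g h a) = g a := by
  have := congrArg Subtype.val ((AlgEquiv.ofInjective (ext R B'.val)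
    (ext_val_injective B' R)).apply_symm_apply ⟨g a, h a a.2⟩)
  exact this

/-- The graded `P_k`-subalgebra given by a family of subalgebras stable under all morphisms. -/
noncomputable def sub (A : PAlg k) (B : ∀ V, Subalgebra k (A.obj V))
    (hB : ∀ {R : Type u} [CommRing R] [Algebra k R] {V W : FGModuleCat.{u} k} (s : R)
      (f : R ⊗[k] V →ₗ[R] R ⊗[k] W), ∀ a ∈ B V, A.mapRes s f a ∈ (ext R (B W).val).range) :
    PAlg k :=
  ofExtend k (fun V => B V) (fun {R _ _ V W} s f => restr (B V) (B W) (A.mapRes s f) (hB s f))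
    (by
      intro R _ _ V
      ext a
      apply ext_val_injective (B V) R
      rw [ext_restr, mapRes_one_id]
      simp)
    (by
      intro R _ _ V W X s t b a
      ext x
      apply ext_val_injective (B X) R
      rw [ext_restr, mapRes_mul_comp, AlgHom.comp_apply,
        ← ext_restr (B V) (B W) (A.mapRes t a) (hB t a)]
      generalize restr (B V) (B W) (A.mapRes t a) (hB t a) x = y
      induction y with
      | zero => simp
      | tmul r y =>
        simp only [Algebra.TensorProduct.map_tmul, AlgHom.restrictScalars_apply, extend_tmul,
          map_smul, ext_restr]
        rw [algHom_tmul]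
        rfl
      | add x y hx hy => simp only [map_add, hx, hy])
    (by
      intro R S _ _ _ _ φ V W s f f' h
      ext x
      apply ext_val_injective (B W) S
      rw [ext_restr, A.mapRes_push φ s f f' h, AlgHom.comp_apply, pushAlg_apply, ← push_ext,
        ext_restr])

theorem sub_mapRes (A : PAlg k) (B : ∀ V, Subalgebra k (A.obj V)) (hB) (s : R)
    (f : R ⊗[k] V →ₗ[R] R ⊗[k] W) (a : B V) :
    (A.sub B hB).mapRes s f a = restr (B V) (B W) (A.mapRes s f) (hB s f) a :=
  ofExtend_mapRes k (fun V => B V) _ _ _ _ s f a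

/-- The homomorphism `A(V)[X] → R ⊗ A(W)[X]` that extends `A(f)` and fixes `X`. -/
noncomputable def polyMap (A : PAlg k) (s : R) (f : R ⊗[k] V →ₗ[R] R ⊗[k] W) :
    Polynomial (A.obj V) →ₐ[k] R ⊗[k] Polynomial (A.obj W) :=
  Polynomial.eval₂AlgHom
    (((ext R (Polynomial.CAlgHom (R := k) (A := A.obj W))).restrictScalars k).comp
      (A.mapRes s f)) (1 ⊗ₜ Polynomial.X) (fun _ => Commute.all _ _)

/-- The polynomial ring `A(V)[X]`, with `X` of weight and degree `0`. -/
noncomputable def poly (A : PAlg k) : PAlg k :=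
  ofExtend k (fun V => Polynomial (A.obj V)) (fun s f => A.polyMap s f)
    (by
      intro R _ _ V
      apply Polynomial.algHom_ext'
      · ext a
        simp [polyMap, mapRes_one_id]
      · simp [polyMap])
    (by
      intro R _ _ V W X s t b a
      apply Polynomial.algHom_ext'
      · ext x
        simp only [polyMap, AlgHom.comp_apply, AlgHom.restrictScalars_apply,
          Polynomial.CAlgHom_apply,
          Polynomial.eval₂AlgHom_apply, Polynomial.eval₂_C, RingHom.coe_coe, mapRes_mul_comp]
        generalize A.mapRes t a x = y
        induction y with
        | zero => simp
        | tmul r y =>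
          rw [algHom_tmul]
          simp [mapRes_apply]
        | add x y hx hy => simp only [map_add, hx, hy]
      · simp [polyMap])
    (by
      intro R S _ _ _ _ φ V W s f f' h
      apply Polynomial.algHom_ext'
      · ext x
        simp only [polyMap, AlgHom.comp_apply, AlgHom.restrictScalars_apply,
          Polynomial.CAlgHom_apply,
          Polynomial.eval₂AlgHom_apply, Polynomial.eval₂_C, RingHom.coe_coe,
          A.mapRes_push φ s f f' h, pushAlg_apply]
        rw [push_ext]
      · simp [polyMap, pushAlg])

theorem poly_mapRes (A : PAlg k) (s : R) (f : R ⊗[k] V →ₗ[R] R ⊗[k] W)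
    (q : Polynomial (A.obj V)) : A.poly.mapRes s f q = A.polyMap s f q :=
  ofExtend_mapRes k (fun V => Polynomial (A.obj V)) _ _ _ _ s f q

/-- The tensor product `A(V) ⊗ B(V)`, with the product `(a ⊗ b)(a' ⊗ b') = aa' ⊗ bb'`. -/
noncomputable def tensor (A B : PAlg k) : PAlg k :=
  ofExtend k (fun V => A.obj V ⊗[k] B.obj V)
    (fun {R _ _ V W} s f => Algebra.TensorProduct.productMap
      (((ext R (Algebra.TensorProduct.includeLeft (R := k) (S := k) (A := A.obj W)
        (B := B.obj W))).restrictScalars k).comp (A.mapRes s f))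
      (((ext R (Algebra.TensorProduct.includeRight (R := k) (A := A.obj W)
        (B := B.obj W))).restrictScalars k).comp (B.mapRes s f)))
    (by
      intro R _ _ V
      apply Algebra.TensorProduct.ext
      · ext a
        simp [mapRes_one_id]
      · ext a
        simp [mapRes_one_id])
    (by
      intro R _ _ V W X s t b a
      apply Algebra.TensorProduct.ext
      · ext x
        simp only [AlgHom.comp_apply, AlgHom.restrictScalars_apply,
          Algebra.TensorProduct.includeLeft_apply, Algebra.TensorProduct.productMap_apply_tmul,
          map_one, mul_one, mapRes_mul_comp]
        generalize A.mapRes t a x = y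
        induction y with
        | zero => simp
        | tmul r y =>
          rw [algHom_tmul]
          simp [mapRes_apply, ← Algebra.TensorProduct.one_def]
        | add x y hx hy => simp only [map_add, hx, hy]
      · ext x
        simp only [AlgHom.comp_apply, AlgHom.restrictScalars_apply,
          Algebra.TensorProduct.includeRight_apply, Algebra.TensorProduct.productMap_apply_tmul,
          map_one, one_mul, mapRes_mul_comp]
        generalize B.mapRes t a x = y
        induction y with
        | zero => simp
        | tmul r y =>
          rw [algHom_tmul]
          simp [mapRes_apply, ← Algebra.TensorProduct.one_def]
        | add x y hx hy => simp only [map_add, hx, hy])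
    (by
      intro R S _ _ _ _ φ V W s f f' h
      apply Algebra.TensorProduct.ext
      · ext x
        simp only [AlgHom.comp_apply, AlgHom.restrictScalars_apply,
          Algebra.TensorProduct.includeLeft_apply, Algebra.TensorProduct.productMap_apply_tmul,
          map_one, mul_one, A.mapRes_push φ s f f' h, pushAlg_apply, push_ext]
      · ext x
        simp only [AlgHom.comp_apply, AlgHom.restrictScalars_apply,
          Algebra.TensorProduct.includeRight_apply, Algebra.TensorProduct.productMap_apply_tmul,
          map_one, one_mul, B.mapRes_push φ s f f' h, pushAlg_apply, push_ext])

/-- The algebra `A` with the degree of the component of weight `d` raised by `d * i`, that is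
`A(V[i])`: the argument `V`, of weight `1`, is placed in degree `i`. -/
noncomputable def shift (A : PAlg k) (i : ℕ) : PAlg k where
  obj := A.obj
  map s f := A.map s (s ^ i • f)
  map_one_id R _ _ V := by rw [one_pow, one_smul, A.map_one_id]
  map_mul_comp s t g f := by
    rw [← A.map_mul_comp, LinearMap.comp_smul, LinearMap.smul_comp, smul_smul, mul_pow,
      mul_comm (t ^ i)]
  map_push φ V W s f f' h := by
    refine A.map_push φ s (s ^ i • f) _ fun x => ?_
    rw [LinearMap.smul_apply, LinearMap.smul_apply, h, push_smul, map_pow]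

end Constructions
/-- A morphism of graded `P_k`-algebras. -/
structure Hom (A B : PAlg k) where
  /-- The underlying algebra homomorphisms. -/
  app : ∀ V, A.obj V →ₐ[k] B.obj V
  naturality : ∀ {R : Type u} [CommRing R] [Algebra k R] {V W : FGModuleCat.{u} k} (s : R)
    (f : R ⊗[k] V →ₗ[R] R ⊗[k] W) (x : R ⊗[k] A.obj V),
    ext R (app W) (A.map s f x) = B.map s f (ext R (app V) x)

/-- An isomorphism of graded `P_k`-algebras. -/
structure Iso (A B : PAlg k) where
  /-- The underlying algebra isomorphisms. -/
  app : ∀ V, A.obj V ≃ₐ[k] B.obj V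
  naturality : ∀ {R : Type u} [CommRing R] [Algebra k R] {V W : FGModuleCat.{u} k} (s : R)
    (f : R ⊗[k] V →ₗ[R] R ⊗[k] W) (x : R ⊗[k] A.obj V),
    ext R (app W).toAlgHom (A.map s f x) = B.map s f (ext R (app V).toAlgHom x)

/-- The identity morphism. -/
noncomputable def Hom.id (A : PAlg k) : Hom A A where
  app V := AlgHom.id k _
  naturality s f x := by simp [ext]

/-- The composite of two morphisms. -/
noncomputable def Hom.comp {A B C : PAlg k} (g : Hom B C) (f : Hom A B) : Hom A C where
  app V := (g.app V).comp (f.app V)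
  naturality {R _ _ V W} s a x := by
    have key : ∀ (U : FGModuleCat.{u} k) (y : R ⊗[k] A.obj U),
        ext R ((g.app U).comp (f.app U)) y = ext R (g.app U) (ext R (f.app U) y) := by
      intro U y
      induction y with
      | zero => simp
      | tmul r y => simp
      | add x y hx hy => simp only [map_add, hx, hy]
    rw [key, key, f.naturality, g.naturality]

theorem Hom.mapRes {A B : PAlg k} (g : Hom A B) {R : Type u} [CommRing R] [Algebra k R]
    {V W : FGModuleCat.{u} k} (s : R) (f : R ⊗[k] V →ₗ[R] R ⊗[k] W) (a : A.obj V) :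
    B.mapRes s f (g.app V a) = ext R (g.app W) (A.mapRes s f a) := by
  rw [mapRes_apply, mapRes_apply, g.naturality]
  simp

/-- The ground field, as a constant algebra. -/
noncomputable def unit (k : Type u) [Field k] : PAlg k :=
  ofExtend k (fun _ => k) (fun _ _ => Algebra.ofId k _)
    (fun _ _ _ _ => Subsingleton.elim _ _) (fun _ _ _ _ => Subsingleton.elim _ _)
    (fun _ _ _ _ _ _ _ => Subsingleton.elim _ _)

theorem tensor_mapRes (A B : PAlg k) {R : Type u} [CommRing R] [Algebra k R]
    {V W : FGModuleCat.{u} k} (s : R) (f : R ⊗[k] V →ₗ[R] R ⊗[k] W) (a : A.obj V) (b : B.obj V) :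
    (A.tensor B).mapRes s f (a ⊗ₜ[k] b) =
      ext R (Algebra.TensorProduct.includeLeft (R := k) (S := k) (A := A.obj W)
        (B := B.obj W)) (A.mapRes s f a) *
      ext R (Algebra.TensorProduct.includeRight (R := k) (A := A.obj W)
        (B := B.obj W)) (B.mapRes s f b) := by
  refine (extend_tmul _ 1 _).trans ?_
  rw [one_smul]
  exact Algebra.TensorProduct.productMap_apply_tmul _ _ _ _

/-- A family of algebra homomorphisms is natural if it is so on elements of the form `1 ⊗ a`. -/
theorem naturality_of_one {A B : PAlg k} (g : ∀ V, A.obj V →ₐ[k] B.obj V) {R : Type u}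
    [CommRing R] [Algebra k R] {V W : FGModuleCat.{u} k} (s : R) (f : R ⊗[k] V →ₗ[R] R ⊗[k] W)
    (h : ∀ a, ext R (g W) (A.mapRes s f a) = B.mapRes s f (g V a)) (x : R ⊗[k] A.obj V) :
    ext R (g W) (A.map s f x) = B.map s f (ext R (g V) x) := by
  induction x with
  | zero => simp
  | tmul r x =>
    rw [algHom_tmul, ← mapRes_apply, map_smul, h, Algebra.TensorProduct.map_tmul, algHom_tmul]
    rfl
  | add x y hx hy => simp only [map_add, hx, hy]

/-- The canonical morphism `A → A ⊗ B`. -/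
noncomputable def inl (A B : PAlg k) : Hom A (A.tensor B) where
  app V := (Algebra.TensorProduct.includeLeft : A.obj V →ₐ[k] A.obj V ⊗[k] B.obj V)
  naturality {R _ _ V W} s f x := by
    refine naturality_of_one (A := A) (B := A.tensor B)
      (fun V => (Algebra.TensorProduct.includeLeft : A.obj V →ₐ[k] A.obj V ⊗[k] B.obj V)) s f
      (fun a => ?_) x
    refine Eq.trans ?_ (tensor_mapRes A B s f a 1).symm
    rw [map_one, map_one, mul_one]
    rfl

section Colimit

variable (T : ℕ → PAlg k) (j : ∀ n, Hom (T n) (T (n + 1)))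

/-- Transition morphisms of a sequence. -/
noncomputable def trans {n m : ℕ} (h : n ≤ m) : Hom (T n) (T m) :=
  Nat.leRec (motive := fun m _ => Hom (T n) (T m)) (Hom.id (T n)) (fun i _ f => (j i).comp f) h

/-- Transition homomorphisms at `V`. -/
noncomputable abbrev transApp (V : FGModuleCat.{u} k) (n m : ℕ) (h : n ≤ m) :
    (T n).obj V →ₐ[k] (T m).obj V :=
  (trans T j h).app V

instance (V : FGModuleCat.{u} k) :
    DirectedSystem (fun n => (T n).obj V) (fun n m h => transApp T j V n m h) where
  map_self n x := by
    simp only [transApp, trans, Nat.leRec_self]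
    rfl
  map_map {l m n} hlm hmn x := by
    induction hmn with
    | refl =>
      simp only [transApp, trans, Nat.leRec_self]
      rfl
    | step hmn ih =>
      have e1 : trans T j (Nat.le.step hmn) = (j _).comp (trans T j hmn) := by
        simp only [trans]
        rw [Nat.leRec_succ]
      have e2 : trans T j (hlm.trans (Nat.le.step hmn)) =
          (j _).comp (trans T j (hlm.trans hmn)) := by
        simp only [trans]
        rw [Nat.leRec_succ]
      simp only [transApp, e1, e2] at ih ⊢
      simp only [Hom.comp, AlgHom.comp_apply, ih]

/-- The colimit of a sequence of graded strict polynomial algebras. -/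
noncomputable def colim : PAlg k :=
  ofExtend k (fun V => DirectLimit (fun n => (T n).obj V) (transApp T j V))
    (fun {R _ _ V W} s f => DirectLimit.Algebra.lift _ _ _
      (fun n => ((ext R (DirectLimit.Algebra.of (fun n => (T n).obj W) (transApp T j W)
        n)).restrictScalars k).comp ((T n).mapRes s f))
      (fun n m h x => by
        simp only [AlgHom.comp_apply, AlgHom.restrictScalars_apply]
        rw [transApp, Hom.mapRes]
        generalize (T n).mapRes s f x = y
        induction y with
        | zero => simp
        | tmul r y => simp
        | add x y hx hy => simp only [map_add, hx, hy]))
    (by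
      intro R _ _ V
      apply DirectLimit.Algebra.hom_ext
      intro n
      rw [DirectLimit.Algebra.lift_comp_of]
      ext a
      simp [mapRes_one_id])
    (by
      intro R _ _ V W X s t b a
      apply DirectLimit.Algebra.hom_ext
      intro n
      ext x
      simp only [AlgHom.comp_apply, AlgHom.restrictScalars_apply,
        DirectLimit.Algebra.lift_of, mapRes_mul_comp]
      generalize (T n).mapRes t a x = y
      induction y with
      | zero => simp
      | tmul r y =>
        rw [algHom_tmul]
        simp [mapRes_apply]
      | add x y hx hy => simp only [map_add, hx, hy])
    (by
      intro R S _ _ _ _ φ V W s f f' h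
      apply DirectLimit.Algebra.hom_ext
      intro n
      ext x
      simp only [AlgHom.comp_apply, AlgHom.restrictScalars_apply, DirectLimit.Algebra.lift_of,
        (T n).mapRes_push φ s f f' h, pushAlg_apply, push_ext])

end Colimit

/-- The tensor product `A₀ ⊗ ⋯ ⊗ Aₙ₋₁`. -/
noncomputable def finTensor (A : ℕ → PAlg k) : ℕ → PAlg k
  | 0 => unit k
  | n + 1 => (finTensor A n).tensor (A n)

/-- The tensor product of a sequence of algebras: the colimit of the finite tensor products
`A₀ ⊗ ⋯ ⊗ Aₙ₋₁` along the maps `x ↦ x ⊗ 1`. -/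
noncomputable def infTensor (A : ℕ → PAlg k) : PAlg k :=
  colim (finTensor A) (fun n => inl (finTensor A n) (A n))

end PAlg

/-- A strict polynomial functor. -/
structure PFun (k : Type u) [Field k] where
  /-- The values. -/
  obj : FGModuleCat.{u} k → Type u
  [addCommGroup : ∀ V, AddCommGroup (obj V)]
  [module : ∀ V, Module k (obj V)]
  /-- The action on morphisms. -/
  map : ∀ {R : Type u} [CommRing R] [Algebra k R] {V W : FGModuleCat.{u} k},
    (R ⊗[k] V →ₗ[R] R ⊗[k] W) → (R ⊗[k] obj V →ₗ[R] R ⊗[k] obj W)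
  map_id : ∀ (R : Type u) [CommRing R] [Algebra k R] (V : FGModuleCat.{u} k),
    map (LinearMap.id : R ⊗[k] V →ₗ[R] R ⊗[k] V) = LinearMap.id
  map_comp : ∀ {R : Type u} [CommRing R] [Algebra k R] {V W X : FGModuleCat.{u} k}
    (g : R ⊗[k] W →ₗ[R] R ⊗[k] X) (f : R ⊗[k] V →ₗ[R] R ⊗[k] W),
    map (g ∘ₗ f) = map g ∘ₗ map f
  map_push : ∀ {R S : Type u} [CommRing R] [Algebra k R] [CommRing S] [Algebra k S]
    (φ : R →ₐ[k] S) {V W : FGModuleCat.{u} k}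
    (f : R ⊗[k] V →ₗ[R] R ⊗[k] W) (f' : S ⊗[k] V →ₗ[S] S ⊗[k] W),
    (∀ x, f' (push φ V x) = push φ W (f x)) →
    ∀ y, map f' (push φ (obj V) y) = push φ (obj W) (map f y)

attribute [instance] PFun.addCommGroup PFun.module

namespace PAlg

variable {k : Type u} [Field k]

/-- The composite `V ↦ A(F(V))`, for a strict polynomial functor `F` with finite dimensional
values. -/
noncomputable def precomp (A : PAlg k) (F : PFun k) [hF : ∀ V, Module.Finite k (F.obj V)] :
    PAlg k where
  obj V := A.obj (FGModuleCat.of k (F.obj V))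
  map {R _ _ V W} s f := A.map (V := FGModuleCat.of k (F.obj V)) (W := FGModuleCat.of k (F.obj W))
    s (F.map f)
  map_one_id R _ _ V := by
    rw [F.map_id]
    exact A.map_one_id R (FGModuleCat.of k (F.obj V))
  map_mul_comp {R _ _ V W X} s t g f := by
    rw [F.map_comp]
    exact A.map_mul_comp (V := FGModuleCat.of k (F.obj V)) (W := FGModuleCat.of k (F.obj W))
      (X := FGModuleCat.of k (F.obj X)) s t (F.map g) (F.map f)
  map_push φ V W s f f' h :=
    A.map_push (V := FGModuleCat.of k (F.obj V)) (W := FGModuleCat.of k (F.obj W)) φ s _ _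
      (F.map_push φ f f' h)

/-- The value of `A` on a linear map. -/
noncomputable def linMap (A : PAlg k) {V W : FGModuleCat.{u} k} (f : V →ₗ[k] W) :
    A.obj V →ₐ[k] A.obj W :=
  ((Algebra.TensorProduct.lid k (A.obj W)).toAlgHom).comp (A.mapRes (1 : k) (f.baseChange k))

/-- `A` is exponential if the maps `A(V) ⊗ A(W) → A(V ⊕ W)` induced by the multiplication and the
inclusions of `V` and `W` are isomorphisms. -/
def IsExponential (A : PAlg k) : Prop :=
  ∀ V W : FGModuleCat.{u} k, Function.Bijective (Algebra.TensorProduct.productMap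
    (A.linMap (W := FGModuleCat.of k (V × W)) (LinearMap.inl k V W))
    (A.linMap (W := FGModuleCat.of k (V × W)) (LinearMap.inr k V W)))

end PAlg

section Twist

variable {k : Type u} [Field k] (p : ℕ) [Fact p.Prime] [CharP k p]

/-- The subspace of `S(V)` spanned by the `p ^ r`-th powers of the elements of `V`. -/
def twistSub (k : Type u) [Field k] (p r : ℕ) (V : Type u) [AddCommGroup V] [Module k V] :
    Submodule k (SymmetricAlgebra k V) :=
  Submodule.span k (Set.range fun v => SymmetricAlgebra.ι k V v ^ p ^ r)

theorem add_pow_prime_pow (k : Type u) [Field k] (p : ℕ) [Fact p.Prime] [CharP k p] {A : Type*} [CommRing A] [Algebra k A] (r : ℕ) (x y : A) :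
    (x + y) ^ p ^ r = x ^ p ^ r + y ^ p ^ r := by
  obtain ⟨z, hz⟩ := exists_add_pow_prime_pow_eq (Fact.out : p.Prime) x y r
  have h0 : (p : A) = 0 := by
    rw [← map_natCast (algebraMap k A), CharP.cast_eq_zero, map_zero]
  rw [hz, h0]
  ring

variable {R S : Type u} [CommRing R] [Algebra k R] [CommRing S] [Algebra k S]
  {V W X : FGModuleCat.{u} k}

theorem pow_mem_twistSub (r : ℕ) (y : R ⊗[k] W) :
    (SymmetricAlgebra.ι k W).baseChange R y ^ p ^ r ∈ (twistSub k p r W).baseChange R := by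
  have hp : p ^ r ≠ 0 := pow_ne_zero r (Fact.out : p.Prime).ne_zero
  induction y with
  | zero => simp [zero_pow hp]
  | tmul a w =>
    rw [LinearMap.baseChange_tmul, Algebra.TensorProduct.tmul_pow]
    exact Submodule.tmul_mem_baseChange_of_mem _ (Submodule.subset_span ⟨w, rfl⟩)
  | add x y hx hy =>
    rw [map_add, add_pow_prime_pow k p]
    exact add_mem hx hy

theorem symMap_mem_twistSub (r : ℕ) (f : R ⊗[k] V →ₗ[R] R ⊗[k] W) {a : SymmetricAlgebra k V}
    (ha : a ∈ twistSub k p r V) : PAlg.symMap f a ∈ (twistSub k p r W).baseChange R := by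
  induction ha using Submodule.span_induction with
  | mem x hx =>
    obtain ⟨v, rfl⟩ := hx
    simp only
    rw [map_pow, PAlg.symMap_ι]
    exact pow_mem_twistSub p r _
  | zero => simp
  | add x y _ _ hx hy => rw [map_add]; exact add_mem hx hy
  | smul c x _ hx =>
    rw [map_smul, ← algebraMap_smul R]
    exact Submodule.smul_mem _ _ hx

theorem baseChange_subtype_injective {M : Type u} [AddCommGroup M] [Module k M]
    (P : Submodule k M) (R : Type u) [CommRing R] [Algebra k R] :
    Function.Injective (P.subtype.baseChange R) :=
  Module.Flat.lTensor_preserves_injective_linearMap (M := R) P.subtype Subtype.val_injective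

theorem restrLin_aux {M N : Type u} [AddCommGroup M] [Module k M] [AddCommGroup N]
    [Module k N] (P : Submodule k M) (Q : Submodule k N) (g : R ⊗[k] M →ₗ[R] R ⊗[k] N)
    (h : ∀ a ∈ P, g (1 ⊗ₜ a) ∈ Q.baseChange R) (x : R ⊗[k] P) :
    g (P.subtype.baseChange R x) ∈ LinearMap.range (Q.subtype.baseChange R) := by
  induction x with
  | zero => simp
  | tmul r x =>
    have : r ⊗ₜ[k] (x : M) = r • ((1 : R) ⊗ₜ[k] (x : M)) := by
      rw [TensorProduct.smul_tmul', smul_eq_mul, mul_one]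
    rw [LinearMap.baseChange_tmul, Submodule.subtype_apply, this, map_smul]
    exact Submodule.smul_mem _ _ (h x x.2)
  | add x y hx hy => rw [map_add, map_add]; exact add_mem hx hy

/-- The restriction of a linear map `R ⊗ M → R ⊗ N` to submodules. -/
noncomputable def restrLin {M N : Type u} [AddCommGroup M] [Module k M] [AddCommGroup N]
    [Module k N] (P : Submodule k M) (Q : Submodule k N) (g : R ⊗[k] M →ₗ[R] R ⊗[k] N)
    (h : ∀ a ∈ P, g (1 ⊗ₜ a) ∈ Q.baseChange R) : R ⊗[k] P →ₗ[R] R ⊗[k] Q :=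
  (LinearEquiv.ofInjective (Q.subtype.baseChange R)
    (baseChange_subtype_injective Q R)).symm.toLinearMap ∘ₗ
    (g ∘ₗ P.subtype.baseChange R).codRestrict _ (restrLin_aux P Q g h)

theorem subtype_restrLin {M N : Type u} [AddCommGroup M] [Module k M] [AddCommGroup N]
    [Module k N] (P : Submodule k M) (Q : Submodule k N) (g : R ⊗[k] M →ₗ[R] R ⊗[k] N)
    (h : ∀ a ∈ P, g (1 ⊗ₜ a) ∈ Q.baseChange R) (x : R ⊗[k] P) :
    Q.subtype.baseChange R (restrLin P Q g h x) = g (P.subtype.baseChange R x) := by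
  have := congrArg Subtype.val ((LinearEquiv.ofInjective (Q.subtype.baseChange R)
    (baseChange_subtype_injective Q R)).apply_symm_apply
    ⟨g (P.subtype.baseChange R x), restrLin_aux P Q g h x⟩)
  exact this

/-- The Frobenius twist `V ↦ V^(r)`: the strict polynomial subfunctor of `V ↦ S(V)` generated by the
`p ^ r`-th powers of the elements of `V`. -/
noncomputable def twist (k : Type u) [Field k] (p : ℕ) [Fact p.Prime] [CharP k p] (r : ℕ) :
    PFun k where
  obj V := twistSub k p r V
  map {R _ _ V W} f := restrLin (twistSub k p r V) (twistSub k p r W)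
    (extend (PAlg.symMap f)).toLinearMap (fun a ha => by
      rw [AlgHom.toLinearMap_apply, extend_tmul, one_smul]
      exact symMap_mem_twistSub p r f ha)
  map_id R _ _ V := by
    refine LinearMap.ext fun x => baseChange_subtype_injective (twistSub k p r V) R ?_
    rw [subtype_restrLin]
    exact DFunLike.congr_fun ((PAlg.sym k).map_one_id R V) _
  map_comp {R _ _ V W X} g f := by
    refine LinearMap.ext fun x => baseChange_subtype_injective (twistSub k p r X) R ?_
    rw [subtype_restrLin, LinearMap.comp_apply, subtype_restrLin, subtype_restrLin]
    exact DFunLike.congr_fun ((PAlg.sym k).map_mul_comp 1 1 g f) _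
  map_push {R S _ _ _ _} φ V W f f' h y := by
    refine baseChange_subtype_injective (twistSub k p r W) S ?_
    rw [subtype_restrLin, ← PAlg.push_baseChange, ← PAlg.push_baseChange, subtype_restrLin]
    exact (PAlg.sym k).map_push φ 1 f f' h _

instance twist_finite (r : ℕ) (V : FGModuleCat.{u} k) :
    Module.Finite k ((twist k p r).obj V) := by
  obtain ⟨s, hs⟩ := (Module.Finite.fg_top : (⊤ : Submodule k V).FG)
  have key : twistSub k p r V ≤
      Submodule.span k ((fun v => SymmetricAlgebra.ι k V v ^ p ^ r) '' (s : Set V)) := by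
    refine Submodule.span_le.2 ?_
    rintro _ ⟨v, rfl⟩
    have hv : v ∈ Submodule.span k (s : Set V) := hs ▸ Submodule.mem_top
    simp only [SetLike.mem_coe]
    induction hv using Submodule.span_induction with
    | mem x hx => exact Submodule.subset_span ⟨x, hx, rfl⟩
    | zero => simp [zero_pow (pow_ne_zero r (Fact.out : p.Prime).ne_zero)]
    | add x y _ _ hx hy =>
      rw [map_add, add_pow_prime_pow k p]
      exact add_mem hx hy
    | smul c x _ hx =>
      rw [map_smul, smul_pow]
      exact Submodule.smul_mem _ _ hx
  have : FiniteDimensional k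
      (Submodule.span k ((fun v => SymmetricAlgebra.ι k V v ^ p ^ r) '' (s : Set V))) :=
    FiniteDimensional.span_of_finite k (s.finite_toSet.image _)
  exact Submodule.finiteDimensional_of_le key

end Twist

namespace PAlg

variable {k : Type u} [Field k]

theorem sym_mapRes {R : Type u} [CommRing R] [Algebra k R] {V W : FGModuleCat.{u} k} (s : R)
    (f : R ⊗[k] V →ₗ[R] R ⊗[k] W) (a : SymmetricAlgebra k V) :
    (sym k).mapRes s f a = symMap f a :=
  (extend_tmul _ 1 _).trans (one_smul _ _)

/-- The ideal of `S(V)` generated by the `p`-th powers of elements of `V`. -/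
def truncIdeal (k : Type u) [Field k] (p : ℕ) (V : Type u) [AddCommGroup V] [Module k V] :
    Ideal (SymmetricAlgebra k V) :=
  Ideal.span (twistSub k p 1 V : Set (SymmetricAlgebra k V))

theorem truncIdeal_stable (p : ℕ) [Fact p.Prime] [CharP k p] {R : Type u} [CommRing R]
    [Algebra k R] {V W : FGModuleCat.{u} k} (f : R ⊗[k] V →ₗ[R] R ⊗[k] W)
    (a : SymmetricAlgebra k V) (ha : a ∈ truncIdeal k p V) :
    ext R (Ideal.Quotient.mkₐ k (truncIdeal k p W)) (symMap f a) = 0 := by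
  induction ha using Submodule.span_induction with
  | mem x hx =>
    obtain ⟨y, hy⟩ := symMap_mem_twistSub p 1 f hx
    rw [← hy]
    clear hy
    induction y with
    | zero => simp
    | tmul r y =>
      have : Ideal.Quotient.mk (truncIdeal k p W) (y : SymmetricAlgebra k W) = 0 :=
        Ideal.Quotient.eq_zero_iff_mem.2 (Ideal.subset_span y.2)
      simp [this]
    | add x y hx hy => rw [map_add, map_add, hx, hy, add_zero]
  | zero => simp
  | add x y _ _ hx hy => rw [map_add, map_add, hx, hy, add_zero]
  | smul c x _ hx => rw [smul_eq_mul, map_mul, map_mul, hx, mul_zero]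

/-- The truncated polynomial algebra `Q(V)`, the quotient of `S(V)` by the ideal generated by
`V^(1)`, in degree `0`. -/
noncomputable def trunc (k : Type u) [Field k] (p : ℕ) [Fact p.Prime] [CharP k p] : PAlg k :=
  (sym k).quot (fun V => truncIdeal k p V) (fun {R _ _ V W} s f a ha => by
    have h := truncIdeal_stable p f a ha
    rw [← sym_mapRes s f a] at h
    exact h)

end PAlg

namespace PAlg

section Components

variable {k : Type u} [Field k]

/-- The coefficient of a monomial, `R[X₀, X₁] ⊗ M → R ⊗ M`. -/
noncomputable def coeffTensor (R : Type u) [CommRing R] [Algebra k R] (M : Type u) [AddCommGroup M]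
    [Module k M] (m : Fin 2 →₀ ℕ) : MvPolynomial (Fin 2) R ⊗[k] M →ₗ[k] R ⊗[k] M :=
  ((MvPolynomial.lcoeff R m).restrictScalars k).rTensor M

theorem coeffTensor_monomial_smul_push (R : Type u) [CommRing R] [Algebra k R] (M : Type u)
    [AddCommGroup M] [Module k M] (m n : Fin 2 →₀ ℕ) (z : R ⊗[k] M) :
    coeffTensor R M m (MvPolynomial.monomial n (1 : R) •
      push (IsScalarTower.toAlgHom k R (MvPolynomial (Fin 2) R)) M z) = if n = m then z else 0 := by
  induction z with
  | zero => simp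
  | tmul r x =>
    have h : MvPolynomial.coeff m (MvPolynomial.monomial n (1 : R) * MvPolynomial.C r) =
        if n = m then r else 0 := by
      rw [mul_comm, MvPolynomial.coeff_C_mul, MvPolynomial.coeff_monomial, mul_ite, mul_one, mul_zero]
    change MvPolynomial.coeff m (MvPolynomial.monomial n (1 : R) * MvPolynomial.C r) ⊗ₜ[k] x = _
    rw [h]
    split_ifs <;> simp
  | add x y hx hy =>
    rw [map_add, smul_add, map_add, hx, hy]
    split_ifs <;> simp

/-- The action of the generic scalars `X₀` (on weights) and `X₁` (on degrees) on `A(V)`. -/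
noncomputable def coact (A : PAlg k) (V : FGModuleCat.{u} k) :
    A.obj V →ₐ[k] MvPolynomial (Fin 2) k ⊗[k] A.obj V :=
  A.mapRes (MvPolynomial.X 1 : MvPolynomial (Fin 2) k)
    ((MvPolynomial.X 0 : MvPolynomial (Fin 2) k) • LinearMap.id)

/-- The projection of `A(V)` onto its component of weight `m 0` and degree `m 1`. -/
noncomputable def proj (A : PAlg k) (V : FGModuleCat.{u} k) (m : Fin 2 →₀ ℕ) :
    A.obj V →ₗ[k] A.obj V :=
  (TensorProduct.lid k _).toLinearMap ∘ₗ coeffTensor k _ m ∘ₗ (A.coact V).toLinearMap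

theorem tensor_eq_sum (M : Type u) [AddCommGroup M] [Module k M]
    (y : MvPolynomial (Fin 2) k ⊗[k] M) : ∃ t : Finset (Fin 2 →₀ ℕ),
    y = ∑ m ∈ t, MvPolynomial.monomial m (1 : k) ⊗ₜ[k]
      (TensorProduct.lid k M (coeffTensor k M m y)) := by
  classical
  have key : ∀ y : MvPolynomial (Fin 2) k ⊗[k] M, ∃ t : Finset (Fin 2 →₀ ℕ), ∀ t', t ⊆ t' →
      y = ∑ m ∈ t', MvPolynomial.monomial m (1 : k) ⊗ₜ[k]
      (TensorProduct.lid k M (coeffTensor k M m y)) := by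
    intro y
    induction y with
    | zero => exact ⟨∅, by simp⟩
    | tmul q x =>
      refine ⟨q.support, fun t' ht => ?_⟩
      simp only [coeffTensor, LinearMap.rTensor_tmul, LinearMap.coe_restrictScalars,
        MvPolynomial.lcoeff_apply, TensorProduct.lid_tmul, TensorProduct.tmul_smul,
        TensorProduct.smul_tmul', MvPolynomial.smul_monomial, smul_eq_mul, mul_one]
      rw [← TensorProduct.sum_tmul]
      congr 1
      conv_lhs => rw [MvPolynomial.as_sum q]
      exact Finset.sum_subset ht fun m _ hm => by
        rw [MvPolynomial.notMem_support_iff.1 hm, MvPolynomial.monomial_zero]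
    | add x y hx hy =>
      obtain ⟨t, ht⟩ := hx
      obtain ⟨t₂, ht₂⟩ := hy
      refine ⟨t ∪ t₂, fun t' h => ?_⟩
      have h1 := ht t' (Finset.union_subset_left h)
      have h2 := ht₂ t' (Finset.union_subset_right h)
      simp only [map_add, TensorProduct.tmul_add, Finset.sum_add_distrib]
      rw [← h1, ← h2]
  obtain ⟨t, ht⟩ := key y
  exact ⟨t, ht t subset_rfl⟩

theorem coact_eq_sum (A : PAlg k) (V : FGModuleCat.{u} k) (x : A.obj V) :
    ∃ t : Finset (Fin 2 →₀ ℕ),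
    A.coact V x = ∑ m ∈ t, MvPolynomial.monomial m (1 : k) ⊗ₜ[k] (A.proj V m x) :=
  tensor_eq_sum (A.obj V) (A.coact V x)

theorem mapRes_smul_id (A : PAlg k) {R S : Type u} [CommRing R] [Algebra k R] [CommRing S]
    [Algebra k S] (φ : R →ₐ[k] S) (V : FGModuleCat.{u} k) (r s : R) (x : A.obj V) :
    A.mapRes (φ s) (φ r • LinearMap.id : S ⊗[k] V →ₗ[S] S ⊗[k] V) x =
      push φ _ (A.mapRes s (r • LinearMap.id : R ⊗[k] V →ₗ[R] R ⊗[k] V) x) :=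
  A.mapRes_push φ s _ _ (fun v => by simp [push_smul]) x

theorem sum_proj (A : PAlg k) (V : FGModuleCat.{u} k) (x : A.obj V) :
    ∃ t : Finset (Fin 2 →₀ ℕ), x = ∑ m ∈ t, A.proj V m x := by
  obtain ⟨t, ht⟩ := A.coact_eq_sum V x
  refine ⟨t, ?_⟩
  have h := A.mapRes_smul_id (MvPolynomial.aeval (R := k) (fun _ : Fin 2 => (1 : k))) V
    (MvPolynomial.X 0) (MvPolynomial.X 1) x
  rw [MvPolynomial.aeval_X, MvPolynomial.aeval_X, one_smul, mapRes_one_id] at h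
  change _ = push _ _ (A.coact V x) at h
  rw [ht, map_sum] at h
  have h2 := congrArg (TensorProduct.lid k (A.obj V)) h
  simpa [MvPolynomial.aeval_monomial] using h2

theorem mem_comp_iff (A : PAlg k) (d j : ℕ) (V : FGModuleCat.{u} k) (x : A.obj V) :
    x ∈ A.comp d j V ↔ ∀ (R : Type u) [CommRing R] [Algebra k R] (r s : R),
      A.mapRes s (r • LinearMap.id : R ⊗[k] V →ₗ[R] R ⊗[k] V) x = (r ^ d * s ^ j) ⊗ₜ x :=
  Iff.rfl

theorem proj_mem (A : PAlg k) (V : FGModuleCat.{u} k) (m : Fin 2 →₀ ℕ) (x : A.obj V) :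
    A.proj V m x ∈ A.comp (m 0) (m 1) V := by
  classical
  rw [mem_comp_iff]
  intro R _ _ r s
  obtain ⟨t, ht⟩ := A.coact_eq_sum V x
  let S := MvPolynomial (Fin 2) R
  let φ : MvPolynomial (Fin 2) k →ₐ[k] S := MvPolynomial.aeval
    (fun i => if i = 0 then (MvPolynomial.C r * MvPolynomial.X 0 : S)
      else MvPolynomial.C s * MvPolynomial.X 1)
  let ι : MvPolynomial (Fin 2) k →ₐ[k] S := MvPolynomial.aeval (fun i => (MvPolynomial.X i : S))
  let ψ : R →ₐ[k] S := IsScalarTower.toAlgHom k R S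
  have hψ : ∀ a, ψ a = MvPolynomial.C a := fun _ => rfl
  have hι1 : ∀ i, ι (MvPolynomial.X i) = MvPolynomial.X i := fun i => MvPolynomial.aeval_X _ i
  have hφ0 : φ (MvPolynomial.X 0) = MvPolynomial.C r * MvPolynomial.X 0 :=
    (MvPolynomial.aeval_X _ _).trans (if_pos rfl)
  have hφ1 : φ (MvPolynomial.X 1) = MvPolynomial.C s * MvPolynomial.X 1 :=
    (MvPolynomial.aeval_X _ _).trans (if_neg one_ne_zero)
  have e1 := A.mapRes_smul_id φ V (MvPolynomial.X 0) (MvPolynomial.X 1) x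
  have e2 := A.mapRes_mul_comp (ψ s) (ι (MvPolynomial.X 1))
    (ψ r • LinearMap.id : S ⊗[k] V →ₗ[S] S ⊗[k] V)
    (ι (MvPolynomial.X 0) • LinearMap.id : S ⊗[k] V →ₗ[S] S ⊗[k] V) x
  rw [A.mapRes_smul_id ι V (MvPolynomial.X 0) (MvPolynomial.X 1) x] at e2
  have e3 : A.mapRes (ψ s * ι (MvPolynomial.X 1)) ((ψ r • LinearMap.id : S ⊗[k] V →ₗ[S] S ⊗[k] V)
      ∘ₗ (ι (MvPolynomial.X 0) • LinearMap.id : S ⊗[k] V →ₗ[S] S ⊗[k] V)) x =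
      A.mapRes (φ (MvPolynomial.X 1)) (φ (MvPolynomial.X 0) • LinearMap.id :
        S ⊗[k] V →ₗ[S] S ⊗[k] V) x := by
    have h1 : ψ s * ι (MvPolynomial.X 1) = φ (MvPolynomial.X 1) := by
      rw [hψ, hι1, hφ1]
    have h0 : (ψ r • LinearMap.id : S ⊗[k] V →ₗ[S] S ⊗[k] V)
        ∘ₗ (ι (MvPolynomial.X 0) • LinearMap.id : S ⊗[k] V →ₗ[S] S ⊗[k] V) =
        φ (MvPolynomial.X 0) • LinearMap.id := by
      rw [hψ, hι1, hφ0, LinearMap.comp_smul, LinearMap.smul_comp, LinearMap.id_comp, smul_smul,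
        mul_comm]
    rw [h1, h0]
  rw [e3, e1] at e2
  change push φ _ (A.coact V x) = A.map (ψ s) _ (push ι _ (A.coact V x)) at e2
  have hφ : ∀ n : Fin 2 →₀ ℕ, φ (MvPolynomial.monomial n 1) =
      MvPolynomial.monomial n (1 : R) * ψ (r ^ n 0 * s ^ n 1) := by
    intro n
    rw [hψ, MvPolynomial.monomial_eq, MvPolynomial.monomial_eq, map_mul, map_one, map_one, map_one,
      one_mul, one_mul, Finsupp.prod_fintype _ _ (by simp), Finsupp.prod_fintype _ _ (by simp),
      Fin.prod_univ_two, Fin.prod_univ_two, map_mul, map_pow, map_pow, hφ0, hφ1, map_mul, map_pow,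
      map_pow]
    ring
  have hι : ∀ n : Fin 2 →₀ ℕ, ι (MvPolynomial.monomial n 1) = MvPolynomial.monomial n (1 : R) := by
    intro n
    simp [ι, MvPolynomial.monomial_eq]
  have hL : push φ _ (A.coact V x) = ∑ n ∈ t, MvPolynomial.monomial n (1 : R) •
      push ψ _ ((r ^ n 0 * s ^ n 1) ⊗ₜ[k] A.proj V n x) := by
    rw [ht, map_sum]
    refine Finset.sum_congr rfl fun n _ => ?_
    simp only [LinearMap.rTensor_tmul, AlgHom.toLinearMap_apply, hφ, TensorProduct.smul_tmul',
      smul_eq_mul]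
  have hR : A.map (ψ s) (ψ r • LinearMap.id : S ⊗[k] V →ₗ[S] S ⊗[k] V)
      (push ι _ (A.coact V x)) = ∑ n ∈ t, MvPolynomial.monomial n (1 : R) •
      push ψ _ (A.mapRes s (r • LinearMap.id : R ⊗[k] V →ₗ[R] R ⊗[k] V) (A.proj V n x)) := by
    rw [ht, map_sum, map_sum]
    refine Finset.sum_congr rfl fun n _ => ?_
    simp only [LinearMap.rTensor_tmul, AlgHom.toLinearMap_apply, hι]
    rw [algHom_tmul, ← mapRes_apply, A.mapRes_smul_id ψ V r s]
  rw [hL, hR] at e2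
  have e4 := congrArg (coeffTensor R (A.obj V) m) e2
  simp only [map_sum, coeffTensor_monomial_smul_push, ψ, S, Finset.sum_ite_eq'] at e4
  by_cases hm : m ∈ t
  · rw [if_pos hm, if_pos hm] at e4
    exact e4.symm
  · have h0 : A.proj V m x = 0 := by
      have h5 := congrArg (fun y => TensorProduct.lid k _ (coeffTensor k (A.obj V) m y)) ht
      change A.proj V m x = _ at h5
      rw [h5]
      simp only [map_sum]
      refine Finset.sum_eq_zero fun n hn => ?_
      have hne : n ≠ m := fun h => hm (h ▸ hn)
      simp [coeffTensor, MvPolynomial.coeff_monomial, hne]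
    rw [h0]
    simp

theorem proj_of_mem (A : PAlg k) (V : FGModuleCat.{u} k) (m : Fin 2 →₀ ℕ) (d j : ℕ) {x : A.obj V}
    (hx : x ∈ A.comp d j V) : A.proj V m x = if m 0 = d ∧ m 1 = j then x else 0 := by
  classical
  have h : A.coact V x = _ := hx (MvPolynomial (Fin 2) k) (MvPolynomial.X 0) (MvPolynomial.X 1)
  have h2 : (MvPolynomial.X 0 ^ d * MvPolynomial.X 1 ^ j : MvPolynomial (Fin 2) k) =
      MvPolynomial.monomial (Finsupp.single 0 d + Finsupp.single 1 j) 1 := by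
    rw [MvPolynomial.X_pow_eq_monomial, MvPolynomial.X_pow_eq_monomial,
      MvPolynomial.monomial_mul, mul_one]
  have h3 : (Finsupp.single (0 : Fin 2) d + Finsupp.single 1 j = m) ↔ (m 0 = d ∧ m 1 = j) := by
    constructor
    · rintro rfl
      simp
    · rintro ⟨rfl, rfl⟩
      ext i
      fin_cases i <;> simp
  simp only [proj, LinearMap.comp_apply, AlgHom.toLinearMap_apply, h, h2, coeffTensor,
    LinearMap.rTensor_tmul, LinearMap.coe_restrictScalars, MvPolynomial.lcoeff_apply,
    MvPolynomial.coeff_monomial, LinearEquiv.coe_coe, TensorProduct.lid_tmul, h3]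
  split_ifs <;> simp

/-- `A(V)` is the direct sum of its components `A^d_j(V)`. -/
theorem isInternal_comp (A : PAlg k) (V : FGModuleCat.{u} k) :
    DirectSum.IsInternal (fun dj : ℕ × ℕ => A.comp dj.1 dj.2 V) := by
  classical
  constructor
  · rw [injective_iff_map_eq_zero]
    intro z hz
    have key : ∀ (z : DirectSum (ℕ × ℕ) fun dj => A.comp dj.1 dj.2 V) (dj : ℕ × ℕ),
        A.proj V (Finsupp.single 0 dj.1 + Finsupp.single 1 dj.2)
          (DirectSum.coeAddMonoidHom (fun dj : ℕ × ℕ => A.comp dj.1 dj.2 V) z) = z dj := by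
      intro z dj
      induction z using DirectSum.induction_on with
      | zero => simp
      | of i x =>
        rw [DirectSum.coeAddMonoidHom_of, A.proj_of_mem V _ i.1 i.2 x.2]
        by_cases h : i = dj
        · subst h
          simp
        · rw [DirectSum.of_eq_of_ne _ _ _ (Ne.symm h), if_neg]
          · rfl
          · simp only [Finsupp.add_apply, Finsupp.single_apply]
            rintro ⟨h1, h2⟩
            simp at h1 h2
            exact h (Prod.ext h1.symm h2.symm)
      | add x y hx hy => rw [map_add, map_add, hx, hy]; rfl
    ext dj
    rw [← key z dj, hz, map_zero]
    rfl
  · intro x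
    obtain ⟨t, ht⟩ := A.sum_proj V x
    refine ⟨∑ m ∈ t, DirectSum.of (fun dj : ℕ × ℕ => A.comp dj.1 dj.2 V) (m 0, m 1)
      ⟨A.proj V m x, A.proj_mem V m x⟩, ?_⟩
    rw [map_sum]
    simp only [DirectSum.coeAddMonoidHom_of]
    exact ht.symm

theorem mul_mem_comp (A : PAlg k) (V : FGModuleCat.{u} k) {d e i j : ℕ} {x y : A.obj V}
    (hx : x ∈ A.comp d i V) (hy : y ∈ A.comp e j V) : x * y ∈ A.comp (d + e) (i + j) V := by
  rw [mem_comp_iff] at *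
  intro R _ _ r s
  rw [map_mul, hx, hy, Algebra.TensorProduct.tmul_mul_tmul]
  congr 1
  ring

end Components

end PAlg

namespace PAlg

variable {k : Type u} [Field k]

/-- A nonnegative decreasing filtration of `A`: a decreasing sequence of subfunctors `Fⁿ` with
`F⁰ = A`, zero intersection and `Fᵐ Fⁿ ⊆ Fᵐ⁺ⁿ`. As `stable` involves `s` as well as `f`, it says that
`Fⁿ` is a strict polynomial subfunctor which is the sum of its homogeneous components, see
`proj_mem_sub`. -/
structure Filtration (A : PAlg k) where
  /-- The steps of the filtration. -/
  sub : ℕ → ∀ V, Submodule k (A.obj V)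
  sub_zero : ∀ V, sub 0 V = ⊤
  antitone : ∀ n V, sub (n + 1) V ≤ sub n V
  iInf_eq_bot : ∀ V, ⨅ n, sub n V = ⊥
  mul_mem : ∀ {m n : ℕ} {V : FGModuleCat.{u} k} {x y : A.obj V}, x ∈ sub m V → y ∈ sub n V →
    x * y ∈ sub (m + n) V
  stable : ∀ {R : Type u} [CommRing R] [Algebra k R] {V W : FGModuleCat.{u} k} (n : ℕ) (s : R)
    (f : R ⊗[k] V →ₗ[R] R ⊗[k] W), ∀ a ∈ sub n V, A.map s f (1 ⊗ₜ a) ∈ (sub n W).baseChange R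

namespace Filtration

variable {A : PAlg k} (F : Filtration A)

/-- Each step of a filtration is the sum of its homogeneous components. -/
theorem proj_mem_sub (n : ℕ) (V : FGModuleCat.{u} k) (m : Fin 2 →₀ ℕ) {a : A.obj V}
    (ha : a ∈ F.sub n V) : A.proj V m a ∈ F.sub n V := by
  obtain ⟨y, hy⟩ : A.coact V a ∈ (F.sub n V).baseChange (MvPolynomial (Fin 2) k) :=
    F.stable n _ _ a ha
  rw [proj, LinearMap.comp_apply, LinearMap.comp_apply, AlgHom.toLinearMap_apply, ← hy]
  clear hy
  induction y with
  | zero => simp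
  | tmul q x =>
    change TensorProduct.lid k _ (MvPolynomial.coeff m q ⊗ₜ[k] (x : A.obj V)) ∈ _
    rw [TensorProduct.lid_tmul]
    exact Submodule.smul_mem _ _ x.2
  | add x y hx hy => rw [map_add, map_add, map_add]; exact add_mem hx hy

/-- The Rees algebra: polynomials in `A(V)[X]` whose `n`-th coefficient lies in `Fⁿ`. -/
noncomputable def reesSub (V : FGModuleCat.{u} k) : Subalgebra k (Polynomial (A.obj V)) where
  carrier := {q | ∀ n, q.coeff n ∈ F.sub n V}
  mul_mem' {a b} ha hb n := by
    rw [Polynomial.coeff_mul]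
    refine Submodule.sum_mem _ fun x hx => ?_
    rw [Finset.HasAntidiagonal.mem_antidiagonal] at hx
    rw [← hx]
    exact F.mul_mem (ha _) (hb _)
  add_mem' ha hb n := by
    rw [Polynomial.coeff_add]
    exact add_mem (ha n) (hb n)
  algebraMap_mem' c n := by
    rw [Polynomial.algebraMap_apply, Polynomial.coeff_C]
    split_ifs with h
    · rw [h, F.sub_zero]
      trivial
    · exact zero_mem _

/-- The element `a Xⁿ` of the Rees algebra, for `a` in `Fⁿ`. -/
noncomputable def reesMon (n : ℕ) (V : FGModuleCat.{u} k) : F.sub n V →ₗ[k] F.reesSub V where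
  toFun a := ⟨Polynomial.monomial n (a : A.obj V), fun m => by
    rw [Polynomial.coeff_monomial]
    split_ifs with h
    · exact h ▸ a.2
    · exact zero_mem _⟩
  map_add' a b := Subtype.ext (by simp)
  map_smul' c a := Subtype.ext (Polynomial.smul_monomial c n (a : A.obj V)).symm

theorem reesMon_coe (n : ℕ) (V : FGModuleCat.{u} k) (a : F.sub n V) :
    (F.reesMon n V a : Polynomial (A.obj V)) = Polynomial.monomial n (a : A.obj V) := rfl

theorem eq_sum_reesMon (V : FGModuleCat.{u} k) (q : F.reesSub V) :
    q = ∑ n ∈ (q : Polynomial (A.obj V)).support,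
      F.reesMon n V ⟨(q : Polynomial (A.obj V)).coeff n, q.2 n⟩ := by
  apply Subtype.ext
  rw [AddSubmonoidClass.coe_finsetSum]
  exact Polynomial.as_sum_support _

variable {R : Type u} [CommRing R] [Algebra k R] {V W : FGModuleCat.{u} k}

theorem polyMap_monomial (A : PAlg k) (s : R) (f : R ⊗[k] V →ₗ[R] R ⊗[k] W) (n : ℕ)
    (a : A.obj V) :
    A.polyMap s f (Polynomial.monomial n a) =
      ext R (Polynomial.CAlgHom (R := k) (A := A.obj W)) (A.mapRes s f a) *
        (1 ⊗ₜ (Polynomial.X ^ n)) := by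
  rw [polyMap, Polynomial.eval₂AlgHom_apply]
  refine (Polynomial.eval₂_monomial _ _).trans ?_
  rw [Algebra.TensorProduct.tmul_pow, one_pow]
  rfl

theorem polyMap_reesMon (s : R) (f : R ⊗[k] V →ₗ[R] R ⊗[k] W) (n : ℕ)
    (a : A.obj V) (y : R ⊗[k] F.sub n W) (hy : A.mapRes s f a = (F.sub n W).subtype.baseChange R y) :
    A.polyMap s f (Polynomial.monomial n a) =
      ext R (F.reesSub W).val ((F.reesMon n W).baseChange R y) := by
  rw [polyMap_monomial, hy]
  clear hy
  induction y with
  | zero => simp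
  | tmul r y =>
    change (r ⊗ₜ[k] Polynomial.C (y : A.obj W)) * ((1 : R) ⊗ₜ[k] (Polynomial.X ^ n)) =
      r ⊗ₜ[k] Polynomial.monomial n (y : A.obj W)
    rw [Algebra.TensorProduct.tmul_mul_tmul, mul_one, Polynomial.C_mul_X_pow_eq_monomial]
  | add x y hx hy => simp only [map_add, add_mul, hx, hy]

theorem exists_mapRes (n : ℕ) (s : R) (f : R ⊗[k] V →ₗ[R] R ⊗[k] W) (a : F.sub n V) :
    ∃ y : R ⊗[k] F.sub n W, A.mapRes s f a = (F.sub n W).subtype.baseChange R y := by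
  obtain ⟨y, hy⟩ := F.stable n s f a a.2
  exact ⟨y, hy.symm⟩

theorem reesSub_stable (s : R) (f : R ⊗[k] V →ₗ[R] R ⊗[k] W) (q : Polynomial (A.obj V))
    (hq : q ∈ F.reesSub V) : A.polyMap s f q ∈ (ext R (F.reesSub W).val).range := by
  rw [Polynomial.as_sum_support q, map_sum]
  refine sum_mem fun n _ => ?_
  obtain ⟨y, hy⟩ := F.exists_mapRes n s f ⟨q.coeff n, hq n⟩
  exact ⟨_, (F.polyMap_reesMon s f n _ y hy).symm⟩

/-- The Rees algebra of the filtration, as a graded strict polynomial algebra. -/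
noncomputable def rees : PAlg k :=
  A.poly.sub (fun V => F.reesSub V) (fun {R _ _ V W} s f q hq => by
    have h := F.reesSub_stable s f q hq
    have e := poly_mapRes A s f q
    exact Eq.mpr (congrArg (fun x => x ∈ (ext R (F.reesSub W).val).range) e) h)

/-- The action of `f` on the Rees algebra. -/
noncomputable def reesMap (s : R) (f : R ⊗[k] V →ₗ[R] R ⊗[k] W) :
    F.reesSub V →ₐ[k] R ⊗[k] F.reesSub W :=
  restr (F.reesSub V) (F.reesSub W) (A.polyMap s f) (F.reesSub_stable s f)

theorem rees_mapRes (s : R) (f : R ⊗[k] V →ₗ[R] R ⊗[k] W) (q : F.reesSub V) :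
    F.rees.mapRes s f q = F.reesMap s f q := by
  refine (sub_mapRes A.poly (fun V => F.reesSub V) _ s f q).trans ?_
  apply ext_val_injective (F.reesSub W) R
  refine (ext_restr _ _ _ _ _).trans (Eq.trans ?_ (ext_restr _ _ _ _ _).symm)
  exact poly_mapRes A s f _

theorem reesMap_reesMon (s : R) (f : R ⊗[k] V →ₗ[R] R ⊗[k] W) (n : ℕ)
    (a : F.sub n V) (y : R ⊗[k] F.sub n W)
    (hy : A.mapRes s f a = (F.sub n W).subtype.baseChange R y) :
    F.reesMap s f (F.reesMon n V a) = (F.reesMon n W).baseChange R y := by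
  apply ext_val_injective (F.reesSub W) R
  rw [← F.polyMap_reesMon s f n a y hy, reesMap, ext_restr, reesMon_coe]

/-- The ideal of the Rees algebra of polynomials whose `n`-th coefficient lies in `Fⁿ⁺¹`. -/
noncomputable def grIdeal (V : FGModuleCat.{u} k) : Ideal (F.reesSub V) where
  carrier := {q | ∀ n, (q : Polynomial (A.obj V)).coeff n ∈ F.sub (n + 1) V}
  add_mem' {a b} ha hb n := by
    rw [Subalgebra.coe_add, Polynomial.coeff_add]
    exact add_mem (ha n) (hb n)
  zero_mem' n := by
    rw [Subalgebra.coe_zero, Polynomial.coeff_zero]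
    exact zero_mem _
  smul_mem' c x hx n := by
    rw [smul_eq_mul, Subalgebra.coe_mul, Polynomial.coeff_mul]
    refine Submodule.sum_mem _ fun z hz => ?_
    rw [Finset.HasAntidiagonal.mem_antidiagonal] at hz
    rw [← hz, add_assoc]
    exact F.mul_mem (c.2 _) (hx _)

theorem reesMon_mem_grIdeal_iff (n : ℕ) (V : FGModuleCat.{u} k) (a : F.sub n V) :
    F.reesMon n V a ∈ F.grIdeal V ↔ (a : A.obj V) ∈ F.sub (n + 1) V := by
  constructor
  · intro h
    have := h n
    rwa [reesMon_coe, Polynomial.coeff_monomial_same] at this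
  · intro h m
    rw [reesMon_coe, Polynomial.coeff_monomial]
    split_ifs with hm
    · exact hm ▸ h
    · exact zero_mem _

theorem grIdeal_stable (s : R) (f : R ⊗[k] V →ₗ[R] R ⊗[k] W) (q : F.reesSub V)
    (hq : q ∈ F.grIdeal V) :
    ext (A := F.reesSub W) (B := F.reesSub W ⧸ F.grIdeal W) R
      (Ideal.Quotient.mkₐ k (F.grIdeal W)) (F.reesMap s f q) = 0 := by
  rw [F.eq_sum_reesMon V q, map_sum, map_sum]
  refine Finset.sum_eq_zero fun n _ => ?_
  obtain ⟨y, hy⟩ := F.exists_mapRes (n + 1) s f ⟨(q : Polynomial (A.obj V)).coeff n, hq n⟩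
  have e := F.reesMap_reesMon s f n ⟨(q : Polynomial (A.obj V)).coeff n, q.2 n⟩
    ((Submodule.inclusion (F.antitone n W)).baseChange R y) (by
      rw [← LinearMap.comp_apply, ← LinearMap.baseChange_comp]
      exact hy)
  rw [e]
  clear e hy
  induction y with
  | zero => simp
  | tmul r y =>
    have h0 : Ideal.Quotient.mk (F.grIdeal W)
        (F.reesMon n W (Submodule.inclusion (F.antitone n W) y)) = 0 :=
      Ideal.Quotient.eq_zero_iff_mem.2 ((F.reesMon_mem_grIdeal_iff n W _).2 y.2)
    rw [LinearMap.baseChange_tmul, LinearMap.baseChange_tmul, Algebra.TensorProduct.map_tmul,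
      Ideal.Quotient.mkₐ_eq_mk, h0, TensorProduct.tmul_zero]
  | add x y hx hy => simp only [map_add, hx, hy, add_zero]

/-- The associated graded algebra `gr A(V) = ⨁ Fⁿ / Fⁿ⁺¹`, as the quotient of the Rees algebra
`⨁ Fⁿ Xⁿ` by `⨁ Fⁿ⁺¹ Xⁿ`; weights and degrees are those of `A`. -/
noncomputable def gr : PAlg k :=
  F.rees.quot (fun V => F.grIdeal V) (fun {R _ _ _ W} s f q hq =>
    (congrArg (ext (A := F.reesSub W) (B := F.reesSub W ⧸ F.grIdeal W) R
      (Ideal.Quotient.mkₐ k (F.grIdeal W))) (F.rees_mapRes s f q)).trans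
      (F.grIdeal_stable s f q hq))

/-- The class in `grⁿ A(V) = Fⁿ / Fⁿ⁺¹` of an element of `Fⁿ`. -/
noncomputable def toGr (n : ℕ) (V : FGModuleCat.{u} k) : F.sub n V →ₗ[k] F.gr.obj V :=
  (Ideal.Quotient.mkₐ k (F.grIdeal V)).toLinearMap ∘ₗ F.reesMon n V

/-- The summand `grⁿ A(V)` of `gr A(V)`. -/
noncomputable def piece (n : ℕ) (V : FGModuleCat.{u} k) : Submodule k (F.gr.obj V) :=
  LinearMap.range (F.toGr n V)

theorem toGr_eq_zero_iff (n : ℕ) (V : FGModuleCat.{u} k) (a : F.sub n V) :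
    F.toGr n V a = 0 ↔ (a : A.obj V) ∈ F.sub (n + 1) V :=
  Ideal.Quotient.eq_zero_iff_mem.trans (F.reesMon_mem_grIdeal_iff n V a)

theorem toGr_mul (m n : ℕ) (V : FGModuleCat.{u} k) (a : F.sub m V) (b : F.sub n V) :
    F.toGr m V a * F.toGr n V b = F.toGr (m + n) V ⟨a * b, F.mul_mem a.2 b.2⟩ := by
  refine ((Ideal.Quotient.mk (F.grIdeal V)).map_mul _ _).symm.trans (congrArg _ ?_)
  exact Subtype.ext (Polynomial.monomial_mul_monomial _ _ _ _)

theorem gr_mapRes_toGr (s : R) (f : R ⊗[k] V →ₗ[R] R ⊗[k] W) (n : ℕ) (a : F.sub n V)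
    (y : R ⊗[k] F.sub n W) (hy : A.mapRes s f a = (F.sub n W).subtype.baseChange R y) :
    F.gr.mapRes s f (F.toGr n V a) = (F.toGr n W).baseChange R y := by
  have h1 : F.gr.mapRes s f (F.toGr n V a) =
      ext (A := F.reesSub W) (B := F.reesSub W ⧸ F.grIdeal W) R
      (Ideal.Quotient.mkₐ k (F.grIdeal W)) (F.reesMap s f (F.reesMon n V a)) := by
    rw [← rees_mapRes]
    exact quot_mapRes F.rees (fun V => F.grIdeal V) _ s f (F.reesMon n V a)
  rw [F.reesMap_reesMon s f n a y hy] at h1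
  refine h1.trans ?_
  clear hy h1
  induction y with
  | zero =>
    rw [map_zero, map_zero, map_zero]
    rfl
  | tmul r y => rfl
  | add x y hx hy =>
    rw [map_add, map_add, map_add, hx, hy]
    rfl

/-- The algebra `gr A(V)` is the direct sum of the spaces `grⁿ A(V)`. -/
theorem isInternal_piece (V : FGModuleCat.{u} k) : DirectSum.IsInternal (fun n => F.piece n V) := by
  classical
  constructor
  · rw [injective_iff_map_eq_zero]
    intro z hz
    have hz' : ∀ n, ∃ a : F.sub n V, F.toGr n V a = z n := fun n => (z n).2
    choose a ha using hz'
    have e : DirectSum.coeAddMonoidHom (fun n => F.piece n V) z =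
        Ideal.Quotient.mk (F.grIdeal V) (∑ n ∈ DFinsupp.support z, F.reesMon n V (a n)) := by
      rw [DirectSum.coeAddMonoidHom_eq_dfinsuppSum, DFinsupp.sum, map_sum]
      exact Finset.sum_congr rfl fun n _ => (ha n).symm
    have h1 : (∑ n ∈ DFinsupp.support z, F.reesMon n V (a n)) ∈ F.grIdeal V :=
      Ideal.Quotient.eq_zero_iff_mem.1 (e.symm.trans hz)
    ext n
    by_cases hn : n ∈ DFinsupp.support z
    · have h2 := h1 n
      rw [AddSubmonoidClass.coe_finsetSum, Polynomial.finsetSum_coeff] at h2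
      simp only [reesMon_coe, Polynomial.coeff_monomial] at h2
      rw [Finset.sum_ite_eq', if_pos hn] at h2
      exact (ha n).symm.trans ((F.toGr_eq_zero_iff n V _).2 h2)
    · rw [DFinsupp.notMem_support_iff.1 hn]
      rfl
  · intro x
    obtain ⟨q, rfl⟩ := Ideal.Quotient.mk_surjective (I := F.grIdeal V) x
    refine ⟨∑ n ∈ (q : Polynomial (A.obj V)).support, DirectSum.of (fun n => F.piece n V) n
      ⟨F.toGr n V ⟨(q : Polynomial (A.obj V)).coeff n, q.2 n⟩, ⟨_, rfl⟩⟩, ?_⟩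
    rw [map_sum]
    simp only [DirectSum.coeAddMonoidHom_of]
    refine Eq.trans ?_ (congrArg (Ideal.Quotient.mk (F.grIdeal V)) (F.eq_sum_reesMon V q).symm)
    rw [map_sum]
    rfl

/-- A filtration is quasi-trivial if `gr A` is exponential, its components have finite dimensional
values, and there is an isomorphism of algebras `A(k) ≃ gr A(k)` that preserves weights and
degrees. -/
def IsQuasiTrivial : Prop :=
  F.gr.IsExponential ∧ (∀ d j V, Module.Finite k (F.gr.comp d j V)) ∧
    ∃ φ : A.obj (FGModuleCat.of k k) ≃ₐ[k] F.gr.obj (FGModuleCat.of k k),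
      ∀ d j, (A.comp d j (FGModuleCat.of k k)).map φ.toLinearMap =
        F.gr.comp d j (FGModuleCat.of k k)

end Filtration

/-- The subspace `P ⊗ B(V)` of `A(V) ⊗ B(V)`, for a subspace `P` of `A(V)`. -/
noncomputable def tensorLeft (A B : PAlg k) {V : FGModuleCat.{u} k} (P : Submodule k (A.obj V)) :
    Submodule k ((A.tensor B).obj V) :=
  LinearMap.range (P.subtype.rTensor (B.obj V))

/-- `Γ(V[i])`: the divided power algebra on `V` placed in degree `i`. -/
noncomputable def gammaDeg (k : Type u) [Field k] (i : ℕ) : PAlg k := (gamma k).shift i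

/-- The ideal of `Γ(V[i])` generated by `V = Γ¹(V)`. -/
noncomputable def principalIdeal (k : Type u) [Field k] (i : ℕ) (V : FGModuleCat.{u} k) :
    Ideal ((gammaDeg k i).obj V) :=
  Ideal.span (Set.range (DividedPowerAlgebra.embed k V))

/-- `Γ(V^(r)[j])`: the divided power algebra on `V^(r)` placed in degree `j`. -/
noncomputable def gammaTwist (k : Type u) [Field k] (p : ℕ) [Fact p.Prime] [CharP k p] (r j : ℕ) :
    PAlg k :=
  (gammaDeg k j).precomp (twist k p r)

/-- `Q(V[i])`: the truncated polynomial algebra on `V` placed in degree `i`. -/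
noncomputable def truncDeg (k : Type u) [Field k] (p : ℕ) [Fact p.Prime] [CharP k p] (i : ℕ) :
    PAlg k :=
  (trunc k p).shift i

/-- `Q(V^(r)[j])`: the truncated polynomial algebra on `V^(r)` placed in degree `j`. -/
noncomputable def truncTwist (k : Type u) [Field k] (p : ℕ) [Fact p.Prime] [CharP k p] (r j : ℕ) :
    PAlg k :=
  (truncDeg k p j).precomp (twist k p r)

end PAlg


end StrictPoly

/-! Let γₙ denote divided powers. In characteristic `p`, Lucas' theorem gives γ_{p^r}(v)^p = 0, and
for n = ∑ d_r p^r in base `p` it writes γₙ(v) as the product of the γ_{p^r}(v)^{d_r} / d_r!. Hence,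
once a basis b of V is chosen, Γ(V) is the truncated polynomial algebra on the elements γ_{p^r}(b_j)
(`gammaEquiv`).

Both filtrations consist of the powers of an ideal I generated by all γₙ(v) with n in a set N of
exponents. For (1), N = {1}. For (2), N is the set of positive integers and I is the augmentation
ideal. Give γ_{p^r}(b_j) order 1 if p^r is in N and order 0 otherwise. Under the conditions of
`IsAdmissible`, I is stable under all linear maps over all R, and Iⁿ is exactly the part of order at
least n, although I is defined without a basis (`X_pow_dvd_grading` is the nontrivial inclusion). So
gr Γ(V) is again a truncated polynomial algebra, on the classes of the same elements, which keep
their weights and degrees (`truncToGr_bijective`, `grEquiv`). Quasi-triviality follows: a basis of V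
⊕ W is the union of bases of V and W, there are finitely many monomials of given weight, and Γ(k),
gr Γ(k) have corresponding generators.

The natural isomorphisms are built as morphisms into gr Γ(V). If the mixed terms of γ_{p^r}(v + w)
are products of two generators of I, the class of γ_{p^r}(v) is additive in v (`grElt_add`); being
also p^r-semilinear, it is a linear function of v^{p^r} in V^(r). For positive N this works for
every r and gives Q(V^(r)) → gr Γ(V). For N = {1} it works for r = 0 and gives Q(V) → gr Γ(V). In
gr⁰ = Γ(V)/(V), moreover, every γₙ(v) with n prime to p vanishes, so that the γ_{pn}(v) add like the
divided powers of v^p (`gammaTwistLift_twistElt`); this gives Γ(V^(1)) → gr⁰. The morphisms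
assembled from these pieces carry generators with zero p-th powers to the truncated polynomial
generators of gr Γ(V), and are therefore bijective (`bijective_of_gen`). -/

namespace StrictPoly

/-! ### Sequences of divided powers -/

section DPSeq

variable {B : Type*} [CommRing B]

/-- Sequences that satisfy the relations between the divided powers of an element. -/
structure IsDPSeq (a : ℕ → B) : Prop where
  zero : a 0 = 1
  mul : ∀ n m, a n * a m = (n + m).choose n • a (n + m)

namespace IsDPSeq

theorem one_pow {a : ℕ → B} (ha : IsDPSeq a) (n : ℕ) : a 1 ^ n = n.factorial • a n := by
  induction n with
  | zero => simp [ha.zero]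
  | succ n ih =>
    rw [pow_succ, ih, smul_mul_assoc, ha.mul, smul_smul, Nat.choose_succ_self_right,
      Nat.factorial_succ, mul_comm]

theorem coeff_one : IsDPSeq fun n => PowerSeries.coeff n (1 : PowerSeries B) where
  zero := by simp
  mul n m := by
    rcases n with _ | n
    · simp
    · simp [PowerSeries.coeff_one]

/-- The exponential series of a sum is the product of the exponential series, so the relations must
survive Cauchy products. This is Vandermonde's identity, contained in `mul_dp_aux`. -/
theorem coeff_mul {f g : PowerSeries B} (hf : IsDPSeq fun n => PowerSeries.coeff n f)
    (hg : IsDPSeq fun n => PowerSeries.coeff n g) :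
    IsDPSeq fun n => PowerSeries.coeff n (f * g) where
  zero := by
    have h1 := hf.zero
    have h2 := hg.zero
    simp only [PowerSeries.coeff_zero_eq_constantCoeff] at h1 h2
    simp [h1, h2]
  mul n m := by
    simp only [PowerSeries.coeff_mul]
    exact PAlg.mul_dp_aux hf.mul hg.mul n m

theorem coeff_prod {ι : Type*} (s : Finset ι) {f : ι → PowerSeries B}
    (hf : ∀ i, IsDPSeq fun n => PowerSeries.coeff n (f i)) :
    IsDPSeq fun n => PowerSeries.coeff n (∏ i ∈ s, f i) := by
  classical
  induction s using Finset.induction with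
  | empty => simpa using coeff_one
  | insert i s hi ih =>
    simp only [Finset.prod_insert hi]
    exact coeff_mul (hf i) ih

theorem map {C : Type*} [CommRing C] {a : ℕ → B} (ha : IsDPSeq a) (φ : B →+* C) :
    IsDPSeq fun n => φ (a n) where
  zero := by simp [ha.zero]
  mul n m := by rw [← map_mul, ha.mul, map_nsmul]

theorem smul {k : Type*} [CommRing k] [Algebra k B] {a : ℕ → B} (ha : IsDPSeq a) (c : k) :
    IsDPSeq fun n => c ^ n • a n where
  zero := by simp [ha.zero]
  mul n m := by rw [smul_mul_smul_comm, ha.mul, pow_add, smul_comm]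

end IsDPSeq

end DPSeq

theorem isDPSeq_dp (k : Type*) [CommRing k] {M : Type*} [AddCommGroup M] [Module k M] (m : M) :
    IsDPSeq fun n => DividedPowerAlgebra.dp k n m :=
  ⟨DividedPowerAlgebra.dp_zero, fun _ _ => DividedPowerAlgebra.dp_mul⟩

/-! ### Homomorphisms out of a divided power algebra -/

section Lift

variable {k : Type*} [CommRing k] {B : Type*} [CommRing B] [Algebra k B]

/-- The series `∑ cⁿ aₙ Tⁿ`. -/
noncomputable def dpSeries (a : ℕ → B) (c : k) : PowerSeries B :=
  PowerSeries.mk fun n => c ^ n • a n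

theorem dpSeries_add {a : ℕ → B} (ha : IsDPSeq a) (c d : k) :
    dpSeries a (c + d) = dpSeries a c * dpSeries a d := by
  ext n
  simp only [dpSeries, PowerSeries.coeff_mk, PowerSeries.coeff_mul]
  rw [(Commute.all c d).add_pow', Finset.sum_smul]
  refine Finset.sum_congr rfl fun x hx => ?_
  rw [Finset.HasAntidiagonal.mem_antidiagonal] at hx
  rw [smul_mul_smul_comm, ha.mul, hx, smul_comm, smul_assoc]

theorem dpSeries_mul (a : ℕ → B) (c d : k) :
    dpSeries a (c * d) = PowerSeries.rescale (algebraMap k B c) (dpSeries a d) := by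
  ext n
  simp only [dpSeries, PowerSeries.coeff_mk, PowerSeries.coeff_rescale, mul_pow, mul_smul]
  rw [← map_pow, ← Algebra.smul_def]

variable {M : Type*} [AddCommGroup M] [Module k M] {ι : Type*} [Fintype ι]

/-- The homomorphism `Γ(M) → B` that takes the divided powers of the elements of a basis to given
sequences of divided powers. -/
noncomputable def gammaLift (b : Module.Basis ι k M) (a : ι → ℕ → B) (ha : ∀ i, IsDPSeq (a i)) :
    DividedPowerAlgebra k M →ₐ[k] B :=
  have H (m : M) : IsDPSeq fun n => PowerSeries.coeff n (∏ i, dpSeries (a i) (b.repr m i)) :=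
    IsDPSeq.coeff_prod _ fun i => by
      simpa [dpSeries] using (ha i).smul (b.repr m i)
  DividedPowerAlgebra.lift'
    -- This value is forced: the addition and homogeneity formulas make γₙ(∑ cᵢ bᵢ) the coefficient
    -- of Tⁿ in the product of the exponential series of the cᵢ bᵢ.
    (f := fun x => PowerSeries.coeff x.1 (∏ i, dpSeries (a i) (b.repr x.2 i)))
    (fun m => (H m).zero)
    (fun n c m => by
      simp only [map_smul, Finsupp.smul_apply, smul_eq_mul, dpSeries_mul, ← map_prod,
        PowerSeries.coeff_rescale]
      rw [← map_pow, ← Algebra.smul_def])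
    (fun n p m => (H m).mul n p)
    (fun n u v => by
      simp only [map_add, Finsupp.add_apply, dpSeries_add (ha _), Finset.prod_mul_distrib,
        PowerSeries.coeff_mul])

theorem gammaLift_dp (b : Module.Basis ι k M) (a : ι → ℕ → B) (ha : ∀ i, IsDPSeq (a i)) (n : ℕ)
    (i : ι) : gammaLift b a ha (DividedPowerAlgebra.dp k n (b i)) = a i n := by
  classical
  have h0 : ∀ j, j ≠ i → dpSeries (a j) (b.repr (b i) j) = 1 := by
    intro j hj
    ext n
    rw [Module.Basis.repr_self, Finsupp.single_eq_of_ne hj]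
    rcases n with _ | n
    · simp [dpSeries, (ha j).zero]
    · simp [dpSeries, PowerSeries.coeff_one]
  rw [gammaLift, DividedPowerAlgebra.lift'_apply_dp]
  simp only
  rw [Finset.prod_eq_single i (fun j _ hj => h0 j hj) (by simp)]
  simp [dpSeries]

theorem gamma_hom_ext_basis (b : Module.Basis ι k M) {f g : DividedPowerAlgebra k M →ₐ[k] B}
    (h : ∀ n i, f (DividedPowerAlgebra.dp k n (b i)) = g (DividedPowerAlgebra.dp k n (b i))) :
    f = g := by
  refine DividedPowerAlgebra.algHom_ext fun n m => ?_
  have hm : m ∈ Submodule.span k (Set.range b) := by simp [b.span_eq]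
  induction hm using Submodule.span_induction generalizing n with
  | mem x hx => obtain ⟨i, rfl⟩ := hx; exact h n i
  | zero => rw [DividedPowerAlgebra.dp_null]; split_ifs <;> simp
  | add x y _ _ hx hy => simp only [DividedPowerAlgebra.dp_add, map_sum, map_mul, hx, hy]
  | smul c x _ hx => simp only [DividedPowerAlgebra.dp_smul, map_smul, hx]

end Lift

/-! ### Divided powers in characteristic `p` -/

section CharP

variable (k : Type*) [Field k] (p : ℕ) [hp : Fact p.Prime] [CharP k p]

theorem nsmul_eq_of_modEq {B : Type*} [CommRing B] [Algebra k B] {m n : ℕ} (h : m ≡ n [MOD p])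
    (x : B) : m • x = n • x := by
  have : (m : k) = n := (CharP.natCast_eq_natCast k p).2 h
  rw [← Nat.cast_smul_eq_nsmul k, this, Nat.cast_smul_eq_nsmul]

/-- By Lucas, the binomial coefficients of (p(n + m), pn) and (n + m, n) agree modulo `p`. So the
γ_{pn}(v) behave like the divided powers of a new element; in gr⁰ it will be v^p in V^(1). -/
theorem IsDPSeq.mul_prime {B : Type*} [CommRing B] [Algebra k B] {a : ℕ → B} (ha : IsDPSeq a) :
    IsDPSeq fun n => a (p * n) where
  zero := by simp [ha.zero]
  mul n m := by
    rw [ha.mul, ← mul_add]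
    refine nsmul_eq_of_modEq k p ?_ _
    have := Choose.choose_modEq_choose_mod_mul_choose_div_nat (p := p) (n := p * (n + m))
      (k := p * n)
    simpa [Nat.mul_div_cancel_left _ hp.out.pos] using this

/-- The power is an integer multiple of a_{p^{r+1}}. Its last multiplication contributes the
binomial coefficient of (p^{r+1}, p^r), which `p` divides. -/
theorem IsDPSeq.pow_prime {B : Type*} [CommRing B] [Algebra k B] {a : ℕ → B} (ha : IsDPSeq a)
    (r : ℕ) : a (p ^ r) ^ p = 0 := by
  have h : ∀ j, ∃ c : ℕ, a (p ^ r) ^ j = c • a (j * p ^ r) := by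
    intro j
    induction j with
    | zero => exact ⟨1, by simp [ha.zero]⟩
    | succ j ih =>
      obtain ⟨c, hc⟩ := ih
      refine ⟨c * ((j + 1) * p ^ r).choose (j * p ^ r), ?_⟩
      rw [pow_succ, hc, smul_mul_assoc, ha.mul, smul_smul, add_mul, one_mul]
  obtain ⟨q, hq⟩ : ∃ q, p = q + 1 := ⟨p - 1, (Nat.succ_pred hp.out.ne_zero).symm⟩
  obtain ⟨c, hc⟩ := h q
  have e : q * p ^ r + p ^ r = p ^ (r + 1) := by
    rw [pow_succ', ← Nat.succ_mul, Nat.succ_eq_add_one, ← hq]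
  have h1 : a (p ^ r) ^ p = a (p ^ r) ^ q * a (p ^ r) := by
    rw [← pow_succ, ← hq]
  rw [h1, hc, smul_mul_assoc, ha.mul, e, Nat.choose_symm_of_eq_add (b := p ^ r) (by omega)]
  have h2 : p ∣ (p ^ (r + 1)).choose (p ^ r) :=
    hp.out.dvd_choose_pow (pow_ne_zero _ hp.out.ne_zero)
      (Nat.pow_lt_pow_right hp.out.one_lt (Nat.lt_succ_self r)).ne
  rw [nsmul_eq_of_modEq k p (Nat.modEq_zero_iff_dvd.2 h2), zero_smul, smul_zero]

/-- For a sequence `z`, the product of the elements `z_r ^ d_r / d_r!`, where the `d_r` are the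
digits of `n` in base `p`. -/
noncomputable def digitExp (k : Type*) [Field k] (p : ℕ) [hp : Fact p.Prime] {B : Type*}
    [CommRing B] [Algebra k B] (z : ℕ → B) (n : ℕ) : B :=
  if h : n = 0 then 1 else
    ((n % p).factorial : k)⁻¹ • (z 0 ^ (n % p) * digitExp k p (fun r => z (r + 1)) (n / p))
termination_by n
decreasing_by exact Nat.div_lt_self (Nat.pos_of_ne_zero h) hp.out.one_lt

variable {B : Type*} [CommRing B] [Algebra k B]

omit [CharP k p] in
theorem digitExp_zero (z : ℕ → B) : digitExp k p z 0 = 1 := by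
  rw [digitExp, dif_pos rfl]

theorem digitExp_eq (z : ℕ → B) (n : ℕ) : digitExp k p z n =
    ((n % p).factorial : k)⁻¹ • (z 0 ^ (n % p) * digitExp k p (fun r => z (r + 1)) (n / p)) := by
  by_cases h : n = 0
  · subst h
    simp [digitExp_zero]
  · rw [digitExp, dif_neg h]

theorem map_digitExp {C : Type*} [CommRing C] [Algebra k C] (φ : B →ₐ[k] C) (z : ℕ → B) (n : ℕ) :
    φ (digitExp k p z n) = digitExp k p (fun r => φ (z r)) n := by
  induction n using Nat.strong_induction_on generalizing z with
  | _ n ih =>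
    by_cases h : n = 0
    · subst h
      simp [digitExp_zero]
    · rw [digitExp_eq k p z, digitExp_eq k p (fun r => φ (z r)), map_smul, map_mul, map_pow,
        ih _ (Nat.div_lt_self (Nat.pos_of_ne_zero h) hp.out.one_lt)]

/-- The only nonzero digit of `p ^ r` is a 1 in place `r`. -/
theorem digitExp_pow (z : ℕ → B) (r : ℕ) : digitExp k p z (p ^ r) = z r := by
  induction r generalizing z with
  | zero =>
    rw [digitExp_eq, pow_zero, Nat.mod_eq_of_lt hp.out.one_lt, Nat.div_eq_of_lt hp.out.one_lt,
      digitExp_zero]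
    simp
  | succ r ih =>
    rw [digitExp_eq, pow_succ', Nat.mul_mod_right, Nat.mul_div_cancel_left _ hp.out.pos, ih]
    simp

theorem factorial_ne_zero_of_lt {n : ℕ} (h : n < p) : (n.factorial : k) ≠ 0 := by
  rw [Ne, CharP.cast_eq_zero_iff k p, hp.out.dvd_factorial]
  omega

/-- Induction on the sum by removing the last digit, the binomial coefficient being split by Lucas.
If the last digits add up without a carry, the inverse factorials combine to their binomial
coefficient. If there is a carry, both sides vanish: the left contains a power of `z 0` with
exponent at least `p`, and on the right the last digit of n + m is smaller than that of n. -/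
theorem digitExp_mul {z : ℕ → B} (hz : ∀ r, z r ^ p = 0) (n m : ℕ) :
    digitExp k p z n * digitExp k p z m = (n + m).choose n • digitExp k p z (n + m) := by
  induction h : n + m using Nat.strong_induction_on generalizing z n m with
  | _ N ih =>
    subst h
    by_cases h0 : n + m = 0
    · obtain ⟨rfl, rfl⟩ : n = 0 ∧ m = 0 := by omega
      simp [digitExp_zero]
    have lucas := Choose.choose_modEq_choose_mod_mul_choose_div_nat (p := p) (n := n + m) (k := n)
    rw [nsmul_eq_of_modEq k p lucas, digitExp_eq k p z n, digitExp_eq k p z m,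
      digitExp_eq k p z (n + m), smul_mul_smul_comm, mul_mul_mul_comm, ← pow_add]
    have hn := Nat.mod_lt n hp.out.pos
    have hm := Nat.mod_lt m hp.out.pos
    by_cases hc : n % p + m % p < p
    · have e1 : (n + m) % p = n % p + m % p := by
        rw [Nat.add_mod, Nat.mod_eq_of_lt hc]
      have e2 : (n + m) / p = n / p + m / p := by
        rw [Nat.add_div hp.out.pos, if_neg (by omega), add_zero]
      have hlt : n / p + m / p < n + m := by
        rw [← e2]
        exact Nat.div_lt_self (Nat.pos_of_ne_zero h0) hp.out.one_lt
      rw [ih _ hlt (fun r => hz (r + 1)) _ _ rfl, e1, e2, mul_smul_comm,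
        ← Nat.cast_smul_eq_nsmul k, ← Nat.cast_smul_eq_nsmul k, smul_smul, smul_smul]
      congr 1
      have f1 := factorial_ne_zero_of_lt k p hn
      have f2 := factorial_ne_zero_of_lt k p hm
      have f3 := factorial_ne_zero_of_lt k p hc
      have f4 : ((n % p + m % p).choose (n % p) : k) * (n % p).factorial * (m % p).factorial =
          (n % p + m % p).factorial := by
        have := Nat.choose_mul_factorial_mul_factorial (Nat.le_add_right (n % p) (m % p))
        rw [Nat.add_sub_cancel_left] at this
        exact_mod_cast congrArg (Nat.cast (R := k)) this
      push_cast
      field_simp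
      rw [← f4]
      ring
    · have h1 : z 0 ^ (n % p + m % p) = 0 := pow_eq_zero_of_le (by omega) (hz 0)
      have h2 : ((n + m) % p).choose (n % p) = 0 := by
        apply Nat.choose_eq_zero_of_lt
        rw [Nat.add_mod, Nat.mod_eq_sub_mod (by omega), Nat.mod_eq_of_lt (by omega)]
        omega
      rw [h1, h2]
      simp

theorem isDPSeq_digitExp {z : ℕ → B} (hz : ∀ r, z r ^ p = 0) : IsDPSeq (digitExp k p z) :=
  ⟨digitExp_zero k p z, digitExp_mul k p hz⟩

/-- Split n as n % p + p(n / p). By Lucas the binomial coefficient that relates a_n to the product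
of the two terms is 1 modulo `p`, and (n % p)! is invertible, so that a_{n % p} is a multiple of a
power of a_1. -/
theorem IsDPSeq.eq_mul {a : ℕ → B} (ha : IsDPSeq a) (n : ℕ) :
    a n = ((n % p).factorial : k)⁻¹ • (a 1 ^ (n % p) * a (p * (n / p))) := by
  have hn := Nat.mod_lt n hp.out.pos
  have f1 := factorial_ne_zero_of_lt k p hn
  have lucas := Choose.choose_modEq_choose_mod_mul_choose_div_nat (p := p) (n := n) (k := n % p)
  rw [Nat.mod_mod, Nat.choose_self, Nat.div_eq_of_lt hn, Nat.choose_zero_right] at lucas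
  rw [ha.one_pow, smul_mul_assoc, ha.mul, Nat.mod_add_div, nsmul_eq_of_modEq k p lucas,
    ← Nat.cast_smul_eq_nsmul k, smul_smul, inv_mul_cancel₀ f1]
  simp

/-- Iterate `eq_mul`, passing from a_n to the sequence a_{pn} of `mul_prime`. Thus a sequence of
divided powers is determined by its terms of index p^r. -/
theorem IsDPSeq.eq_digitExp {a : ℕ → B} (ha : IsDPSeq a) (n : ℕ) :
    a n = digitExp k p (fun r => a (p ^ r)) n := by
  induction n using Nat.strong_induction_on generalizing a with
  | _ n ih =>
    by_cases h : n = 0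
    · subst h
      rw [ha.zero, digitExp_zero]
    · have := ih (n / p) (Nat.div_lt_self (Nat.pos_of_ne_zero h) hp.out.one_lt)
        (ha.mul_prime k p)
      rw [digitExp_eq, ha.eq_mul k p n]
      simp only [pow_zero, pow_succ']
      rw [← this]

end CharP

/-! ### Truncated polynomial algebras -/

/-- The algebra `k[X_s]/(X_s ^ p)`. -/
def TruncPoly (k : Type*) [Field k] (p : ℕ) (σ : Type*) : Type _ :=
  MvPolynomial σ k ⧸ Ideal.span (Set.range fun s : σ => (MvPolynomial.X s : MvPolynomial σ k) ^ p)

namespace TruncPoly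

variable {k : Type*} [Field k] {p : ℕ} {σ : Type*} {B : Type*} [CommRing B] [Algebra k B]

noncomputable instance : CommRing (TruncPoly k p σ) :=
  inferInstanceAs (CommRing (MvPolynomial σ k ⧸ Ideal.span (Set.range fun s : σ =>
    (MvPolynomial.X s : MvPolynomial σ k) ^ p)))

noncomputable instance : Algebra k (TruncPoly k p σ) :=
  inferInstanceAs (Algebra k (MvPolynomial σ k ⧸ Ideal.span (Set.range fun s : σ =>
    (MvPolynomial.X s : MvPolynomial σ k) ^ p)))

variable (k p σ) in
/-- The quotient map from the polynomial algebra. -/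
noncomputable def mk : MvPolynomial σ k →ₐ[k] TruncPoly k p σ :=
  Ideal.Quotient.mkₐ k (Ideal.span (Set.range fun s : σ =>
    (MvPolynomial.X s : MvPolynomial σ k) ^ p))

theorem mk_surjective : Function.Surjective (mk k p σ) :=
  Ideal.Quotient.mk_surjective

variable (k p) in
/-- The generators of the truncated polynomial algebra. -/
noncomputable def gen (s : σ) : TruncPoly k p σ :=
  mk k p σ (MvPolynomial.X s)

theorem gen_pow (s : σ) : gen k p s ^ p = 0 := by
  rw [gen, ← map_pow]
  exact Ideal.Quotient.eq_zero_iff_mem.2 (Ideal.subset_span ⟨s, rfl⟩)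

/-- The homomorphism defined by a family of elements whose `p`-th powers vanish. -/
noncomputable def lift (y : σ → B) (hy : ∀ s, y s ^ p = 0) : TruncPoly k p σ →ₐ[k] B :=
  Ideal.Quotient.liftₐ _ (MvPolynomial.aeval y) fun a ha => by
    induction ha using Submodule.span_induction with
    | mem x hx =>
      obtain ⟨s, rfl⟩ := hx
      simp [hy]
    | zero => simp
    | add x y _ _ hx hy => rw [map_add, hx, hy, add_zero]
    | smul c x _ hx => rw [smul_eq_mul, map_mul, hx, mul_zero]

theorem lift_gen (y : σ → B) (hy : ∀ s, y s ^ p = 0) (s : σ) :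
    lift y hy (gen k p s) = y s :=
  MvPolynomial.aeval_X y s

theorem adjoin_gen : Algebra.adjoin k (Set.range (gen k p : σ → TruncPoly k p σ)) = ⊤ := by
  have h : Set.range (gen k p : σ → TruncPoly k p σ) = mk k p σ '' Set.range MvPolynomial.X := by
    rw [← Set.range_comp]
    rfl
  rw [h, ← AlgHom.map_adjoin, MvPolynomial.adjoin_range_X, Algebra.map_top,
    AlgHom.range_eq_top]
  exact mk_surjective

theorem hom_ext {f g : TruncPoly k p σ →ₐ[k] B} (h : ∀ s, f (gen k p s) = g (gen k p s)) :
    f = g := by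
  refine AlgHom.ext_of_adjoin_eq_top adjoin_gen ?_
  rintro _ ⟨s, rfl⟩
  exact h s

theorem lift_surjective {y : σ → B} (hy : ∀ s, y s ^ p = 0)
    (h : Algebra.adjoin k (Set.range y) = ⊤) :
    Function.Surjective (lift (k := k) y hy) := by
  rw [← AlgHom.range_eq_top, eq_top_iff, ← h]
  refine Algebra.adjoin_le ?_
  rintro _ ⟨s, rfl⟩
  exact ⟨gen k p s, lift_gen y hy s⟩

end TruncPoly

/-- The divided power algebra of a vector space of characteristic `p` is a truncated polynomial
algebra on the elements `γ_{p^r}(b)`, for `b` in a basis. -/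
noncomputable def gammaEquiv {k : Type*} [Field k] (p : ℕ) [Fact p.Prime] [CharP k p]
    {M : Type*} [AddCommGroup M] [Module k M] {ι : Type*} [Fintype ι] (b : Module.Basis ι k M) :
    TruncPoly k p (ι × ℕ) ≃ₐ[k] DividedPowerAlgebra k M :=
  -- `pow_prime` makes the map to Γ(M) well defined and `isDPSeq_digitExp` the map back. On
  -- generators, the composites are identities by `eq_digitExp` and `digitExp_pow`.
  AlgEquiv.ofAlgHom
    (TruncPoly.lift (fun s => DividedPowerAlgebra.dp k (p ^ s.2) (b s.1))
      fun s => (isDPSeq_dp k (b s.1)).pow_prime k p s.2)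
    (gammaLift b (fun i => digitExp k p fun r => TruncPoly.gen k p (i, r))
      fun i => isDPSeq_digitExp k p fun r => TruncPoly.gen_pow (i, r))
    (gamma_hom_ext_basis b fun n i => by
      rw [AlgHom.comp_apply, gammaLift_dp, map_digitExp, AlgHom.id_apply,
        (isDPSeq_dp k (b i)).eq_digitExp k p n]
      simp only [TruncPoly.lift_gen])
    (TruncPoly.hom_ext fun s => by
      rw [AlgHom.comp_apply, TruncPoly.lift_gen, gammaLift_dp, digitExp_pow, AlgHom.id_apply])

theorem gammaEquiv_gen {k : Type*} [Field k] (p : ℕ) [Fact p.Prime] [CharP k p]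
    {M : Type*} [AddCommGroup M] [Module k M] {ι : Type*} [Fintype ι] (b : Module.Basis ι k M)
    (i : ι) (r : ℕ) : gammaEquiv p b (TruncPoly.gen k p (i, r)) =
      DividedPowerAlgebra.dp k (p ^ r) (b i) := by
  simp only [gammaEquiv, AlgEquiv.ofAlgHom_apply, TruncPoly.lift_gen]

theorem adjoin_dp_basis {k : Type*} [Field k] (p : ℕ) [Fact p.Prime] [CharP k p]
    {M : Type*} [AddCommGroup M] [Module k M] {ι : Type*} [Fintype ι] (b : Module.Basis ι k M) :
    Algebra.adjoin k
      (Set.range fun s : ι × ℕ => DividedPowerAlgebra.dp k (p ^ s.2) (b s.1)) = ⊤ := by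
  have h : (Set.range fun s : ι × ℕ => DividedPowerAlgebra.dp k (p ^ s.2) (b s.1)) =
      (gammaEquiv p b).toAlgHom '' Set.range (TruncPoly.gen k p) := by
    rw [← Set.range_comp]
    exact congrArg Set.range (funext fun s => (gammaEquiv_gen p b s.1 s.2).symm)
  rw [h, ← AlgHom.map_adjoin, TruncPoly.adjoin_gen, Algebra.map_top, AlgHom.range_eq_top]
  exact (gammaEquiv p b).surjective

theorem span_monomials {k : Type*} [CommRing k] {σ B : Type*} [CommRing B] [Algebra k B]
    {y : σ → B} (h : Algebra.adjoin k (Set.range y) = ⊤) :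
    Submodule.span k (Set.range fun a : σ →₀ ℕ => a.prod fun s n => y s ^ n) = ⊤ := by
  have h1 : Function.Surjective (MvPolynomial.aeval (R := k) y) := by
    rw [← AlgHom.range_eq_top, ← Algebra.adjoin_range_eq_range_aeval, h]
  have h2 : (Set.range fun a : σ →₀ ℕ => a.prod fun s n => y s ^ n) =
      (MvPolynomial.aeval (R := k) y).toLinearMap ''
        Set.range (MvPolynomial.basisMonomials σ k) := by
    rw [← Set.range_comp]
    refine congrArg Set.range (funext fun a => ?_)
    simp [MvPolynomial.aeval_monomial]
  rw [h2, Submodule.span_image, Module.Basis.span_eq, Submodule.map_top]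
  exact LinearMap.range_eq_top.2 h1

/-! ### Algebras with homogeneous generators -/

namespace PAlg

variable {k : Type u} [Field k]

theorem one_mem_comp (A : PAlg k) (V : FGModuleCat.{u} k) : (1 : A.obj V) ∈ A.comp 0 0 V := by
  rw [mem_comp_iff]
  intro R _ _ r s
  rw [map_one, pow_zero, pow_zero, mul_one, Algebra.TensorProduct.one_def]

theorem pow_mem_comp (A : PAlg k) (V : FGModuleCat.{u} k) {d i : ℕ} {x : A.obj V}
    (hx : x ∈ A.comp d i V) (n : ℕ) : x ^ n ∈ A.comp (n * d) (n * i) V := by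
  induction n with
  | zero => simpa using A.one_mem_comp V
  | succ n ih =>
    rw [pow_succ, add_mul, add_mul, one_mul, one_mul]
    exact A.mul_mem_comp V ih hx

theorem monomial_mem_comp (A : PAlg k) (V : FGModuleCat.{u} k) {σ : Type*} {y : σ → A.obj V}
    {d j : σ → ℕ} (hy : ∀ s, y s ∈ A.comp (d s) (j s) V) (a : σ →₀ ℕ) :
    (a.prod fun s n => y s ^ n) ∈
      A.comp (a.sum fun s n => n * d s) (a.sum fun s n => n * j s) V := by
  classical
  simp only [Finsupp.prod, Finsupp.sum]
  induction a.support using Finset.induction with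
  | empty => simpa using A.one_mem_comp V
  | insert s t hs ih =>
    rw [Finset.prod_insert hs, Finset.sum_insert hs, Finset.sum_insert hs]
    exact A.mul_mem_comp V (A.pow_mem_comp V (hy s) _) ih

/-- If `A(V)` is generated by homogeneous elements, its components are spanned by monomials. -/
theorem comp_le_span (A : PAlg k) (V : FGModuleCat.{u} k) {σ : Type*} {y : σ → A.obj V}
    {d j : σ → ℕ} (hy : ∀ s, y s ∈ A.comp (d s) (j s) V)
    (h : Algebra.adjoin k (Set.range y) = ⊤) (D J : ℕ) :
    A.comp D J V ≤ Submodule.span k ((fun a : σ →₀ ℕ => a.prod fun s n => y s ^ n) ''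
      {a | (a.sum fun s n => n * d s) = D}) := by
  intro x hx
  have h1 := A.proj_of_mem V (Finsupp.single 0 D + Finsupp.single 1 J) D J hx
  rw [if_pos (by simp)] at h1
  rw [← h1]
  have h2 : x ∈ Submodule.span k (Set.range fun a : σ →₀ ℕ => a.prod fun s n => y s ^ n) := by
    rw [span_monomials h]
    trivial
  -- The projection of every element of the span lies in the target, so the homogeneity of `x` has
  -- served its purpose.
  generalize x = z at h2
  induction h2 using Submodule.span_induction with
  | mem x hx =>
    obtain ⟨a, rfl⟩ := hx
    rw [A.proj_of_mem V _ _ _ (A.monomial_mem_comp V hy a)]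
    split_ifs with ha
    · exact Submodule.subset_span ⟨a, by simpa using ha.1.symm, rfl⟩
    · exact zero_mem _
  | zero => rw [map_zero]; exact zero_mem _
  | add x y _ _ hx hy => rw [map_add]; exact add_mem hx hy
  | smul c x _ hx => rw [map_smul]; exact Submodule.smul_mem _ _ hx

/-- Weights alone suffice: in a monomial of weight D each exponent is at most D, and a generator of
weight p^r can occur only if r < p^r ≤ D. As ι is finite, this leaves finitely many monomials. -/
theorem finite_comp (A : PAlg k) (V : FGModuleCat.{u} k) {p : ℕ} (hp : 1 < p) {ι : Type*}
    [Fintype ι] {y : ι × ℕ → A.obj V} {j : ι × ℕ → ℕ}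
    (hy : ∀ s, y s ∈ A.comp (p ^ s.2) (j s) V)
    (h : Algebra.adjoin k (Set.range y) = ⊤) (D J : ℕ) : Module.Finite k (A.comp D J V) := by
  classical
  have hfin : {a : ι × ℕ →₀ ℕ | (a.sum fun s n => n * p ^ s.2) = D}.Finite := by
    refine (Finset.finsupp (Finset.univ ×ˢ Finset.range (D + 1))
      (fun _ : ι × ℕ => Finset.range (D + 1))).finite_toSet.subset ?_
    intro a ha
    have key : ∀ s ∈ a.support, a s * p ^ s.2 ≤ D := by
      intro s hs
      rw [← (show _ = D from ha)]
      exact Finset.single_le_sum (f := fun s => a s * p ^ s.2) (fun _ _ => Nat.zero_le _) hs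
    rw [Finset.mem_coe, Finset.mem_finsupp_iff]
    refine ⟨fun s hs => ?_, fun s hs => ?_⟩
    · have h1 : 1 ≤ a s := Nat.one_le_iff_ne_zero.2 (Finsupp.mem_support_iff.1 hs)
      have h2 := (Nat.le_mul_of_pos_left (p ^ s.2) h1).trans (key s hs)
      have h3 : s.2 < p ^ s.2 := Nat.lt_pow_self hp
      simp only [Finset.mem_product, Finset.mem_univ, Finset.mem_range, true_and]
      omega
    · have h2 := (Nat.le_mul_of_pos_right (a s) (pow_pos (by omega : 0 < p) s.2))
      rw [Finset.mem_range]
      by_cases h0 : a s = 0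
      · omega
      · have h3 := key s (Finsupp.mem_support_iff.2 h0)
        omega
  have := FiniteDimensional.span_of_finite k
    (hfin.image fun a : ι × ℕ →₀ ℕ => a.prod fun s n => y s ^ n)
  exact Submodule.finiteDimensional_of_le (A.comp_le_span V hy h D J)

/-- An isomorphism of algebras that is compatible with the action of scalars on generators
preserves weights and degrees. -/
theorem map_comp_of_gen (A B : PAlg k) (V : FGModuleCat.{u} k) (φ : A.obj V ≃ₐ[k] B.obj V)
    {σ : Type*} {y : σ → A.obj V} {d j : σ → ℕ} (hy : ∀ s, y s ∈ A.comp (d s) (j s) V)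
    (hφ : ∀ s, φ (y s) ∈ B.comp (d s) (j s) V) (h : Algebra.adjoin k (Set.range y) = ⊤)
    (D J : ℕ) : (A.comp D J V).map φ.toLinearMap = B.comp D J V := by
  -- Both sides are algebra homomorphisms in `x`, so it is enough that each generator and its image
  -- have the same weight and degree.
  have key : ∀ (R : Type u) [CommRing R] [Algebra k R] (r s : R) (x : A.obj V),
      B.mapRes s (r • LinearMap.id : R ⊗[k] V →ₗ[R] R ⊗[k] V) (φ x) =
        ext R φ.toAlgHom (A.mapRes s (r • LinearMap.id : R ⊗[k] V →ₗ[R] R ⊗[k] V) x) := by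
    intro R _ _ r s x
    have : (B.mapRes s (r • LinearMap.id : R ⊗[k] V →ₗ[R] R ⊗[k] V)).comp φ.toAlgHom =
        ((ext R φ.toAlgHom).restrictScalars k).comp
          (A.mapRes s (r • LinearMap.id : R ⊗[k] V →ₗ[R] R ⊗[k] V)) := by
      refine AlgHom.ext_of_adjoin_eq_top h ?_
      rintro _ ⟨t, rfl⟩
      have h1 := (A.mem_comp_iff _ _ V _).1 (hy t) R r s
      have h2 := (B.mem_comp_iff _ _ V _).1 (hφ t) R r s
      change B.mapRes s _ (φ (y t)) = ext R φ.toAlgHom (A.mapRes s _ (y t))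
      rw [h1, h2]
      rfl
    exact DFunLike.congr_fun this x
  have inj : ∀ (R : Type u) [CommRing R] [Algebra k R],
      Function.Injective (ext R φ.toAlgHom) := fun R _ _ =>
    Module.Flat.lTensor_preserves_injective_linearMap (M := R) φ.toLinearMap φ.injective
  ext x
  obtain ⟨x, rfl⟩ := φ.surjective x
  have e : φ x ∈ (A.comp D J V).map φ.toLinearMap ↔ x ∈ A.comp D J V :=
    ⟨fun ⟨y, hy, hxy⟩ => φ.injective hxy ▸ hy, fun hx => ⟨x, hx, rfl⟩⟩
  rw [e, mem_comp_iff, mem_comp_iff]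
  refine forall_congr' fun R => forall_congr' fun _ => forall_congr' fun _ =>
    forall_congr' fun r => forall_congr' fun s => ?_
  rw [key]
  constructor
  · intro h
    rw [h]
    rfl
  · intro h
    apply inj R
    rw [h]
    rfl

end PAlg

/-! ### Bases of Frobenius twists -/

section Twist

variable {k : Type u} [Field k] (p : ℕ) [hp : Fact p.Prime] [CharP k p] {ι : Type*} [Fintype ι]
  {V : Type u} [AddCommGroup V] [Module k V]

/-- The element `v ^ (p ^ r)` of `V^(r)`. -/
def twistPow (k : Type u) [Field k] (p r : ℕ) {V : Type u} [AddCommGroup V] [Module k V] (v : V) :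
    twistSub k p r V :=
  ⟨SymmetricAlgebra.ι k V v ^ p ^ r, Submodule.subset_span ⟨v, rfl⟩⟩

theorem twistPow_add (r : ℕ) (v w : V) :
    twistPow k p r (v + w) = twistPow k p r v + twistPow k p r w :=
  Subtype.ext (by simp [twistPow, add_pow_prime_pow k p])

omit hp [CharP k p] in
theorem twistPow_smul (r : ℕ) (c : k) (v : V) :
    twistPow k p r (c • v) = c ^ p ^ r • twistPow k p r v :=
  Subtype.ext (by simp [twistPow, smul_pow])

omit hp [CharP k p] in
theorem span_twistPow (r : ℕ) :
    Submodule.span k (Set.range (twistPow k p r : V → twistSub k p r V)) = ⊤ := by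
  rw [eq_top_iff]
  rintro ⟨x, hx⟩ -
  have : ∀ x (hx : x ∈ twistSub k p r V), (⟨x, hx⟩ : twistSub k p r V) ∈
      Submodule.span k (Set.range (twistPow k p r : V → twistSub k p r V)) := by
    intro x hx
    induction hx using Submodule.span_induction with
    | mem x hx =>
      obtain ⟨v, rfl⟩ := hx
      exact Submodule.subset_span ⟨v, rfl⟩
    | zero => exact zero_mem _
    | add x y hx hy h1 h2 => exact add_mem h1 h2
    | smul c x hx h1 => exact Submodule.smul_mem _ c h1
  exact this x hx

/-- The basis of `V^(r)` given by the powers of the elements of a basis of `V`. -/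
noncomputable def twistBasis (r : ℕ) (b : Module.Basis ι k V) :
    Module.Basis ι k (twistSub k p r V) :=
  Module.Basis.mk (v := fun i => twistPow k p r (b i))
    (by
      have hpr : p ^ r ≠ 0 := pow_ne_zero r hp.out.ne_zero
      -- In the polynomial ring on `b`, the elements b_i^{p^r} are distinct monomials.
      refine LinearIndependent.of_comp ((SymmetricAlgebra.equivMvPolynomial b).toLinearMap ∘ₗ
        (twistSub k p r V).subtype) ?_
      have h : (⇑((SymmetricAlgebra.equivMvPolynomial b).toLinearMap ∘ₗ
          (twistSub k p r V).subtype) ∘ fun i => twistPow k p r (b i)) =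
          MvPolynomial.basisMonomials ι k ∘ fun i => Finsupp.single i (p ^ r) := by
        funext i
        simp [twistPow, MvPolynomial.X_pow_eq_monomial]
      rw [h]
      exact (MvPolynomial.basisMonomials ι k).linearIndependent.comp _
        (Finsupp.single_left_injective hpr))
    (by
      rw [← span_twistPow (k := k) (V := V) p r]
      refine Submodule.span_le.2 ?_
      rintro _ ⟨v, rfl⟩
      have hv : v ∈ Submodule.span k (Set.range b) := by simp [b.span_eq]
      rw [SetLike.mem_coe]
      induction hv using Submodule.span_induction with
      | mem x hx =>
        obtain ⟨i, rfl⟩ := hx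
        exact Submodule.subset_span ⟨i, rfl⟩
      | zero =>
        have := twistPow_smul p r (0 : k) (0 : V)
        rw [zero_smul, zero_pow (pow_ne_zero r hp.out.ne_zero), zero_smul] at this
        rw [this]
        exact zero_mem _
      | add x y _ _ hx hy => rw [twistPow_add]; exact add_mem hx hy
      | smul c x _ hx => rw [twistPow_smul]; exact Submodule.smul_mem _ _ hx)

omit [Fintype ι] in
theorem twistBasis_apply (r : ℕ) (b : Module.Basis ι k V) (i : ι) :
    twistBasis p r b i = twistPow k p r (b i) :=
  Module.Basis.mk_apply _ _ i

/-- The linear map on `V^(r)` defined by a semilinear map on `V`. -/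
theorem exists_twistLift [FiniteDimensional k V] (r : ℕ) {M : Type*} [AddCommGroup M] [Module k M]
    (g : V → M) (hadd : ∀ v w, g (v + w) = g v + g w)
    (hsmul : ∀ (c : k) v, g (c • v) = c ^ p ^ r • g v) :
    ∃ L : twistSub k p r V →ₗ[k] M, ∀ v, L (twistPow k p r v) = g v := by
  let b := Module.finBasis k V
  -- The basis only serves to define the map. Both sides of the formula are additive and
  -- p^r-semilinear in v, so it extends from the basis to all v.
  refine ⟨(twistBasis p r b).constr k fun i => g (b i), fun v => ?_⟩
  have hv : v ∈ Submodule.span k (Set.range b) := by simp [b.span_eq]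
  induction hv using Submodule.span_induction with
  | mem x hx =>
    obtain ⟨i, rfl⟩ := hx
    rw [← twistBasis_apply, Module.Basis.constr_basis]
  | zero =>
    have h1 := twistPow_smul p r (0 : k) (0 : V)
    have h2 := hsmul (0 : k) (0 : V)
    rw [zero_smul, zero_pow (pow_ne_zero r hp.out.ne_zero), zero_smul] at h1 h2
    rw [h1, h2, map_zero]
  | add x y _ _ hx hy => rw [twistPow_add, map_add, hx, hy, hadd]
  | smul c x _ hx => rw [twistPow_smul, map_smul, hx, hsmul]

end Twist

/-! ### Gradings of truncated polynomial algebras -/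

namespace TruncPoly

variable {k : Type*} [Field k] {p : ℕ} {σ : Type*} (w : σ → ℕ)

variable (k p) in
/-- The grading of the truncated polynomial algebra with the generators in degrees `w`, as a
coaction. -/
noncomputable def grading : TruncPoly k p σ →ₐ[k] Polynomial (TruncPoly k p σ) :=
  lift (fun s => Polynomial.C (gen k p s) * Polynomial.X ^ w s) fun s => by
    -- Here `p` is an arbitrary natural number. For p = 0 the relation of a generator reads 1 = 0,
    -- and the algebra is zero.
    by_cases hp : p = 0
    · subst hp
      have h : (1 : TruncPoly k 0 σ) = 0 := by rw [← gen_pow (k := k) s, pow_zero]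
      rw [pow_zero, ← map_one Polynomial.C, h, map_zero]
    · rw [mul_pow, ← map_pow, gen_pow, map_zero, zero_mul]

theorem grading_gen (s : σ) :
    grading k p w (gen k p s) = Polynomial.C (gen k p s) * Polynomial.X ^ w s :=
  lift_gen _ _ s

/-- The counit law of the coaction. It makes `t` the sum of its homogeneous components, which are
the coefficients of `grading k p w t`; in particular the coaction is injective. -/
theorem eval_one_grading (t : TruncPoly k p σ) : (grading k p w t).eval 1 = t := by
  have h : ((Polynomial.aeval (R := TruncPoly k p σ) 1).restrictScalars k).comp (grading k p w) =
      AlgHom.id k _ := hom_ext fun s => by simp [grading_gen]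
  have := DFunLike.congr_fun h t
  simpa [Polynomial.aeval_def] using this

/-- The monomials in the generators. -/
noncomputable def mon (k : Type*) [Field k] (p : ℕ) {σ : Type*} (a : σ →₀ ℕ) : TruncPoly k p σ :=
  a.prod fun s n => gen k p s ^ n

theorem span_mon : Submodule.span k (Set.range (mon k p : (σ →₀ ℕ) → TruncPoly k p σ)) = ⊤ :=
  span_monomials adjoin_gen

theorem grading_mon (a : σ →₀ ℕ) : grading k p w (mon k p a) =
    Polynomial.C (mon k p a) * Polynomial.X ^ (a.sum fun s n => n * w s) := by
  simp only [mon, Finsupp.prod, Finsupp.sum, map_prod, map_pow, grading_gen, mul_pow,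
    Finset.prod_mul_distrib, ← pow_mul, Finset.prod_pow_eq_pow_sum]
  simp only [mul_comm]

theorem coeff_grading_mon (a : σ →₀ ℕ) (n : ℕ) : (grading k p w (mon k p a)).coeff n =
    if n = (a.sum fun s n => n * w s) then mon k p a else 0 := by
  rw [grading_mon, Polynomial.coeff_C_mul_X_pow]

/-- Taking coefficients gives orthogonal projections. This is clear on monomials, and these span. -/
theorem coeff_grading_coeff_grading (t : TruncPoly k p σ) (m n : ℕ) :
    (grading k p w ((grading k p w t).coeff n)).coeff m =
      if m = n then (grading k p w t).coeff n else 0 := by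
  have ht : t ∈ Submodule.span k (Set.range (mon k p : (σ →₀ ℕ) → TruncPoly k p σ)) := by
    rw [span_mon]; trivial
  induction ht using Submodule.span_induction with
  | mem x hx =>
    obtain ⟨a, rfl⟩ := hx
    rw [coeff_grading_mon]
    split_ifs with h h'
    · rw [coeff_grading_mon, if_pos (h'.trans h)]
    · rw [coeff_grading_mon, if_neg (fun h3 => h' (h3.trans h.symm))]
    · simp
    · simp
  | zero => simp
  | add x y _ _ hx hy =>
    simp only [map_add, Polynomial.coeff_add, hx, hy]
    split_ifs <;> simp
  | smul c x _ hx =>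
    simp only [map_smul, Polynomial.coeff_smul, hx]
    split_ifs <;> simp

end TruncPoly

/-! ### The associated graded algebra of a truncated polynomial algebra -/

namespace PAlg.Filtration

open TruncPoly

variable {k : Type u} [Field k] {A : PAlg k} (F : Filtration A) {V : FGModuleCat.{u} k}

theorem sub_antitone {m n : ℕ} (h : m ≤ n) : F.sub n V ≤ F.sub m V := by
  induction h with
  | refl => exact le_rfl
  | step _ ih => exact (F.antitone _ V).trans ih

theorem toGr_zero_one : F.toGr 0 V ⟨1, by rw [F.sub_zero]; trivial⟩ = 1 := rfl

theorem pow_mem {n : ℕ} {x : A.obj V} (hx : x ∈ F.sub n V) (m : ℕ) : x ^ m ∈ F.sub (m * n) V := by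
  induction m with
  | zero => rw [zero_mul, F.sub_zero]; trivial
  | succ m ih =>
    rw [pow_succ, add_mul, one_mul]
    exact F.mul_mem ih hx

/-- Classes of the same element with respect to indices such as (m + 1)n and mn + n have to be
compared repeatedly. -/
theorem toGr_congr {m n : ℕ} (h : m = n) {x y : A.obj V} (hx : x ∈ F.sub m V)
    (hy : y ∈ F.sub n V) (e : x = y) : F.toGr m V ⟨x, hx⟩ = F.toGr n V ⟨y, hy⟩ := by
  subst h e
  rfl

theorem toGr_pow {n : ℕ} {x : A.obj V} (hx : x ∈ F.sub n V) (m : ℕ) :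
    F.toGr n V ⟨x, hx⟩ ^ m = F.toGr (m * n) V ⟨x ^ m, F.pow_mem hx m⟩ := by
  induction m with
  | zero =>
    rw [pow_zero, ← F.toGr_zero_one]
    exact F.toGr_congr (zero_mul n).symm _ _ (pow_zero x).symm
  | succ m ih =>
    rw [pow_succ, ih, toGr_mul]
    exact F.toGr_congr (by ring) _ _ (pow_succ x m).symm

theorem prod_mem {σ : Type*} {z : σ → A.obj V} {w : σ → ℕ} (hz : ∀ s, z s ∈ F.sub (w s) V)
    (a : σ →₀ ℕ) : (a.prod fun s n => z s ^ n) ∈ F.sub (a.sum fun s n => n * w s) V := by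
  classical
  simp only [Finsupp.prod, Finsupp.sum]
  induction a.support using Finset.induction with
  | empty =>
    rw [Finset.sum_empty, F.sub_zero]
    trivial
  | insert s t hs ih =>
    rw [Finset.prod_insert hs, Finset.sum_insert hs]
    exact F.mul_mem (F.pow_mem (hz s) _) ih

theorem toGr_prod {σ : Type*} {z : σ → A.obj V} {w : σ → ℕ} (hz : ∀ s, z s ∈ F.sub (w s) V)
    (a : σ →₀ ℕ) : (a.prod fun s n => F.toGr (w s) V ⟨z s, hz s⟩ ^ n) =
      F.toGr (a.sum fun s n => n * w s) V ⟨a.prod fun s n => z s ^ n, F.prod_mem hz a⟩ := by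
  classical
  -- The membership that gives the right side a meaning is proved together with the formula, by one
  -- induction over finite subsets.
  have key : ∀ t : Finset σ, ∃ h, (∏ s ∈ t, F.toGr (w s) V ⟨z s, hz s⟩ ^ a s) =
      F.toGr (∑ s ∈ t, a s * w s) V ⟨∏ s ∈ t, z s ^ a s, h⟩ := by
    intro t
    induction t using Finset.induction with
    | empty =>
      refine ⟨by rw [Finset.sum_empty, F.sub_zero]; trivial, ?_⟩
      rw [Finset.prod_empty, ← F.toGr_zero_one]
      exact F.toGr_congr Finset.sum_empty.symm _ _ Finset.prod_empty.symm
    | insert s t hs ih =>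
      obtain ⟨h, e⟩ := ih
      refine ⟨?_, ?_⟩
      · rw [Finset.prod_insert hs, Finset.sum_insert hs]
        exact F.mul_mem (F.pow_mem (hz s) _) h
      · rw [Finset.prod_insert hs, e, toGr_pow, toGr_mul]
        refine F.toGr_congr ?_ _ _ ?_
        · rw [Finset.sum_insert hs]
        · rw [Finset.prod_insert hs]
  exact (key a.support).2

variable {p : ℕ} {σ : Type*} (w : σ → ℕ)
  (e : TruncPoly k p σ ≃ₐ[k] A.obj V) (h1 : ∀ s, e (gen k p s) ∈ F.sub (w s) V)

include h1 in
theorem mon_mem (a : σ →₀ ℕ) : e (mon k p a) ∈ F.sub (a.sum fun s n => n * w s) V := by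
  have := F.prod_mem h1 a
  rwa [mon, Finsupp.prod, map_prod, Finset.prod_congr rfl fun s _ => map_pow e _ _]

/-- The homomorphism from the truncated polynomial algebra to `gr A(V)` given by the classes of
the generators of `A(V)`. -/
noncomputable def truncToGr : TruncPoly k p σ →ₐ[k] F.gr.obj V :=
  lift (fun s => F.toGr (w s) V ⟨e (gen k p s), h1 s⟩) fun s => by
    rw [toGr_pow]
    have h0 : (⟨e (gen k p s) ^ p, F.pow_mem (h1 s) p⟩ : F.sub (p * w s) V) = 0 :=
      Subtype.ext ((map_pow e _ _).symm.trans (by rw [gen_pow, map_zero]; rfl))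
    rw [h0, map_zero]

theorem truncToGr_gen (s : σ) :
    F.truncToGr w e h1 (gen k p s) = F.toGr (w s) V ⟨e (gen k p s), h1 s⟩ :=
  lift_gen _ _ s

theorem truncToGr_mon (a : σ →₀ ℕ) : F.truncToGr w e h1 (mon k p a) =
    F.toGr (a.sum fun s n => n * w s) V ⟨e (mon k p a), F.mon_mem w e h1 a⟩ := by
  have h := F.toGr_prod h1 a
  have h2 : F.truncToGr w e h1 (mon k p a) =
      a.prod fun s n => F.toGr (w s) V ⟨e (gen k p s), h1 s⟩ ^ n := by
    simp only [mon, Finsupp.prod, map_prod, map_pow, truncToGr_gen]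
  rw [h2, h]
  refine F.toGr_congr rfl _ _ ?_
  simp only [mon, Finsupp.prod, map_prod, map_pow]

include h1 in
theorem coeff_grading_mem (n : ℕ) (t : TruncPoly k p σ) :
    e ((grading k p w t).coeff n) ∈ F.sub n V := by
  have ht : t ∈ Submodule.span k (Set.range (mon k p : (σ →₀ ℕ) → TruncPoly k p σ)) := by
    rw [span_mon]; trivial
  induction ht using Submodule.span_induction with
  | mem x hx =>
    obtain ⟨a, rfl⟩ := hx
    rw [coeff_grading_mon]
    split_ifs with h
    · rw [h]
      exact F.mon_mem w e h1 a
    · rw [map_zero]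
      exact zero_mem _
  | zero => simp
  | add x y _ _ hx hy =>
    rw [map_add, Polynomial.coeff_add, map_add]
    exact add_mem hx hy
  | smul c x _ hx =>
    rw [map_smul, Polynomial.coeff_smul, map_smul]
    exact Submodule.smul_mem _ _ hx

/-- Both sides are linear in `t`. For a monomial of order n this is the multiplicativity of classes,
and the component of order n of any other monomial is zero. -/
theorem truncToGr_coeff_grading (n : ℕ) (t : TruncPoly k p σ) :
    F.truncToGr w e h1 ((grading k p w t).coeff n) =
      F.toGr n V ⟨e ((grading k p w t).coeff n), F.coeff_grading_mem w e h1 n t⟩ := by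
  have ht : t ∈ Submodule.span k (Set.range (mon k p : (σ →₀ ℕ) → TruncPoly k p σ)) := by
    rw [span_mon]; trivial
  have hz : ∀ (h : (0 : A.obj V) ∈ F.sub n V), F.toGr n V ⟨0, h⟩ = 0 := fun _ =>
    map_zero (F.toGr n V)
  induction ht using Submodule.span_induction with
  | mem x hx =>
    obtain ⟨a, rfl⟩ := hx
    by_cases h : n = (a.sum fun s n => n * w s)
    · have h2 : (grading k p w (mon k p a)).coeff n = mon k p a := by
        rw [coeff_grading_mon, if_pos h]
      exact (congrArg _ h2).trans ((F.truncToGr_mon w e h1 a).trans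
        (F.toGr_congr h.symm _ _ (by rw [h2])))
    · have h2 : (grading k p w (mon k p a)).coeff n = 0 := by
        rw [coeff_grading_mon, if_neg h]
      exact (congrArg _ h2).trans ((map_zero _).trans ((hz (zero_mem _)).symm.trans
        (F.toGr_congr rfl _ _ (by rw [h2, map_zero]))))
  | zero =>
    have h2 : (grading k p w (0 : TruncPoly k p σ)).coeff n = 0 := by
      rw [map_zero, Polynomial.coeff_zero]
    exact (congrArg _ h2).trans ((map_zero _).trans ((hz (zero_mem _)).symm.trans
      (F.toGr_congr rfl _ _ (by rw [h2, map_zero]))))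
  | add x y _ _ hx hy =>
    have h2 : (grading k p w (x + y)).coeff n =
        (grading k p w x).coeff n + (grading k p w y).coeff n := by
      rw [map_add, Polynomial.coeff_add]
    refine (congrArg _ h2).trans ?_
    rw [map_add, hx, hy, ← map_add]
    exact F.toGr_congr rfl _ _ (by rw [h2, map_add])
  | smul c x _ hx =>
    have h2 : (grading k p w (c • x)).coeff n = c • (grading k p w x).coeff n := by
      rw [map_smul, Polynomial.coeff_smul]
    refine (congrArg _ h2).trans ?_
    rw [map_smul, hx, ← map_smul]
    exact F.toGr_congr rfl _ _ (by rw [h2, map_smul])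

/-- If `Fⁿ` consists of the elements of order at least `n` for the grading by `w`, the algebra
`gr A(V)` is again a truncated polynomial algebra. -/
theorem truncToGr_bijective
    (h2 : ∀ n, ∀ x ∈ F.sub n V, Polynomial.X ^ n ∣ grading k p w (e.symm x)) :
    Function.Bijective (F.truncToGr w e h1) := by
  constructor
  · rw [injective_iff_map_eq_zero]
    intro t ht
    have hsum : t = ∑ n ∈ (grading k p w t).support, (grading k p w t).coeff n := by
      conv_lhs => rw [← eval_one_grading w t, Polynomial.eval_eq_sum]
      simp [Polynomial.sum]
    classical
    have h3 : DirectSum.coeAddMonoidHom (fun n => F.piece n V)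
        (∑ n ∈ (grading k p w t).support, DirectSum.of (fun n => F.piece n V) n
          ⟨F.toGr n V ⟨_, F.coeff_grading_mem w e h1 n t⟩, ⟨_, rfl⟩⟩) = 0 := by
      rw [map_sum]
      simp only [DirectSum.coeAddMonoidHom_of]
      refine (Finset.sum_congr rfl fun n _ =>
        (F.truncToGr_coeff_grading w e h1 n t).symm).trans ?_
      rw [← map_sum, ← hsum, ht]
    have h4 := (injective_iff_map_eq_zero _).1 (F.isInternal_piece V).1 _ h3
    -- As gr A is the direct sum of its pieces, the image of each homogeneous component of `t`
    -- vanishes separately.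
    have h5 : ∀ n ∈ (grading k p w t).support,
        F.toGr n V ⟨_, F.coeff_grading_mem w e h1 n t⟩ = 0 := by
      intro n hn
      have h6 := DFunLike.congr_fun h4 n
      rw [DFinsupp.finsetSum_apply, Finset.sum_eq_single n] at h6
      · rw [DirectSum.of_eq_same] at h6
        exact congrArg Subtype.val h6
      · intro m _ hm
        exact DirectSum.of_eq_of_ne _ _ _ hm.symm
      · exact fun h => absurd hn h
    rw [hsum]
    refine Finset.sum_eq_zero fun n hn => ?_
    -- The component of order n lies in Fⁿ⁺¹, hence has order at least n + 1 by `h2`. Being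
    -- homogeneous of order n, it is zero.
    have h7 := h2 (n + 1) _ ((F.toGr_eq_zero_iff n V _).1 (h5 n hn))
    rw [AlgEquiv.symm_apply_apply, Polynomial.X_pow_dvd_iff] at h7
    have h8 := h7 n n.lt_succ_self
    rwa [coeff_grading_coeff_grading, if_pos rfl] at h8
  · intro y
    obtain ⟨y, rfl⟩ := (F.isInternal_piece V).2 y
    induction y using DirectSum.induction_on with
    | zero => exact ⟨0, by simp⟩
    | of n x =>
      obtain ⟨_, ⟨a, rfl⟩⟩ := x
      -- The preimage of the class of `a` is the component of `a` of order n; the other components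
      -- must be shown to contribute an element of Fⁿ⁺¹.
      refine ⟨(grading k p w (e.symm a)).coeff n, ?_⟩
      rw [DirectSum.coeAddMonoidHom_of, truncToGr_coeff_grading, ← sub_eq_zero, ← map_sub,
        toGr_eq_zero_iff]
      change e ((grading k p w (e.symm a)).coeff n) - (a : A.obj V) ∈ F.sub (n + 1) V
      have hX := Polynomial.X_pow_dvd_iff.1 (h2 n a a.2)
      have hsum : (a : A.obj V) = ∑ m ∈ insert n (grading k p w (e.symm a)).support,
          e ((grading k p w (e.symm a)).coeff m) := by
        rw [← map_sum, Finset.sum_insert_of_eq_zero_if_notMem]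
        · have h3 := eval_one_grading w (e.symm (a : A.obj V))
          rw [Polynomial.eval_eq_sum, Polynomial.sum] at h3
          simp only [one_pow, mul_one] at h3
          rw [h3, AlgEquiv.apply_symm_apply]
        · exact fun h => Polynomial.notMem_support_iff.1 h
      rw [← Finset.add_sum_erase _ _ (Finset.mem_insert_self n _)] at hsum
      have h4 := eq_neg_of_add_eq_zero_left (a := e ((grading k p w (e.symm a)).coeff n) - a)
        (by rw [sub_add_eq_add_sub, ← hsum, sub_self])
      rw [h4]
      refine neg_mem (sum_mem fun m hm => ?_)
      -- Components of order below n vanish by `h2`, because `a` is in Fⁿ. Those of order m > n lie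
      -- in Fᵐ, which is contained in Fⁿ⁺¹.
      rcases lt_or_ge m n with h | h
      · rw [hX m h, map_zero]
        exact zero_mem _
      · have hne := Finset.ne_of_mem_erase hm
        exact F.sub_antitone (by omega) (F.coeff_grading_mem w e h1 m _)
    | add x y hx hy =>
      obtain ⟨a, ha⟩ := hx
      obtain ⟨b, hb⟩ := hy
      exact ⟨a + b, by rw [map_add, map_add, ha, hb]⟩

end PAlg.Filtration

namespace PAlg

variable {k : Type u} [Field k] {i : ℕ} {V W : FGModuleCat.{u} k}

/-! ### Divided powers in `Γ(V[i])` -/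

variable (k i) in
/-- The divided power `γₙ(v)` as an element of `Γ(V[i])`. -/
noncomputable def gammaElt (n : ℕ) {V : FGModuleCat.{u} k} (v : V) : (gammaDeg k i).obj V :=
  DividedPowerAlgebra.dp k n (v : (V : Type u))

theorem gammaElt_add (n : ℕ) (v w : V) : gammaElt k i n (v + w) =
    ∑ x ∈ Finset.HasAntidiagonal.antidiagonal n, gammaElt k i x.1 v * gammaElt k i x.2 w :=
  DividedPowerAlgebra.dp_add

theorem gammaElt_smul (n : ℕ) (c : k) (v : V) :
    gammaElt k i n (c • v) = c ^ n • gammaElt k i n v :=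
  DividedPowerAlgebra.dp_smul

theorem gammaElt_null (n : ℕ) (hn : n ≠ 0) : gammaElt k i n (0 : V) = 0 :=
  DividedPowerAlgebra.dp_null_of_ne_zero hn

theorem isDPSeq_gammaElt (v : V) : IsDPSeq fun n => gammaElt k i n v :=
  isDPSeq_dp k (v : (V : Type u))

section

variable {R : Type u} [CommRing R] [Algebra k R]

variable (i) in
/-- The divided powers of an element of `R ⊗ W` in `R ⊗ Γ(W[i])`. -/
noncomputable def dpowDeg (n : ℕ) (y : R ⊗[k] W) : R ⊗[k] (gammaDeg k i).obj W :=
  dpow n y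

theorem dpowDeg_tmul (n : ℕ) (r : R) (w : W) :
    dpowDeg i n (r ⊗ₜ[k] w) = (r ^ n) ⊗ₜ gammaElt k i n w :=
  dpow_tmul n r w

theorem dpowDeg_add (n : ℕ) (x y : R ⊗[k] W) : dpowDeg i n (x + y) =
    ∑ z ∈ Finset.HasAntidiagonal.antidiagonal n, dpowDeg i z.1 x * dpowDeg i z.2 y :=
  dpow_add n x y

theorem dpowDeg_null (n : ℕ) : dpowDeg i n (0 : R ⊗[k] W) = if n = 0 then 1 else 0 :=
  dpow_null n

theorem dpowDeg_zero (y : R ⊗[k] W) : dpowDeg i 0 y = 1 :=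
  dpow_zero y

theorem dpowDeg_smul (n : ℕ) (r : R) (y : R ⊗[k] W) :
    dpowDeg i n (r • y) = r ^ n • dpowDeg i n y :=
  dpow_smul n r y

theorem gammaDeg_mapRes (s : R) (f : R ⊗[k] V →ₗ[R] R ⊗[k] W) (n : ℕ) (v : V) :
    (gammaDeg k i).mapRes s f (gammaElt k i n v) = dpowDeg i n (s ^ i • f (1 ⊗ₜ v)) := by
  exact ((extend_tmul (gammaMap (s ^ i • f)) 1 (DividedPowerAlgebra.dp k n v)).trans
    (one_smul _ _)).trans (gammaMap_dp (s ^ i • f) n v)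

end

theorem gammaElt_mem_comp (n : ℕ) (v : V) : gammaElt k i n v ∈ (gammaDeg k i).comp n (i * n) V := by
  rw [mem_comp_iff]
  intro R _ _ r s
  rw [gammaDeg_mapRes, LinearMap.smul_apply, LinearMap.id_apply, dpowDeg_smul, dpowDeg_smul,
    dpowDeg_tmul, one_pow, TensorProduct.smul_tmul', TensorProduct.smul_tmul', ← pow_mul]
  congr 1
  simp [mul_comm]

variable (i) in
/-- The truncated polynomial algebra on `γ_{p^r}(b)`, for `b` in a basis, is `Γ(V[i])`. -/
noncomputable def gammaDegEquiv (p : ℕ) [Fact p.Prime] [CharP k p] {ι : Type*} [Fintype ι]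
    (b : Module.Basis ι k V) : TruncPoly k p (ι × ℕ) ≃ₐ[k] (gammaDeg k i).obj V :=
  gammaEquiv p b

theorem gammaDegEquiv_gen (p : ℕ) [Fact p.Prime] [CharP k p] {ι : Type*} [Fintype ι]
    (b : Module.Basis ι k V) (j : ι) (r : ℕ) :
    gammaDegEquiv i p b (TruncPoly.gen k p (j, r)) = gammaElt k i (p ^ r) (b j) :=
  gammaEquiv_gen p b j r

/-! ### Filtrations of `Γ(V[i])` by powers of ideals generated by divided powers -/

/-- The ideal of `Γ(V[i])` generated by the divided powers `γₙ(v)` with `n` in `N`. -/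
noncomputable def dpIdeal (k : Type u) [Field k] (i : ℕ) (N : Set ℕ) (V : FGModuleCat.{u} k) :
    Ideal ((gammaDeg k i).obj V) :=
  Ideal.span {x | ∃ n ∈ N, ∃ v : V, x = gammaElt k i n v}

/-- The conditions on a set `N` of exponents for which the powers of the ideal generated by the
divided powers `γₙ(v)`, with `n` in `N`, are considered. -/
structure IsAdmissible (p : ℕ) (N : Set ℕ) : Prop where
  -- Since γ₀ = 1, the ideal would otherwise be the whole algebra.
  zero_notMem : 0 ∉ N
  -- This puts every term γ_m(x) γ_n(y) of the addition formula into the ideal, so that membership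
  -- passes from pure tensors to all of R ⊗ W.
  mem_or_mem : ∀ m n, m + n ∈ N → m ∈ N ∨ n ∈ N
  -- This makes γₙ(b) divisible by some γ_{p^r}(b) of order 1, so that the ideal has order at least
  -- 1.
  exists_digit : ∀ n ∈ N, ∃ r, p ^ r ∈ N ∧ n / p ^ r % p ≠ 0

theorem isAdmissible_one (p : ℕ) [hp : Fact p.Prime] : IsAdmissible p {1} where
  zero_notMem := by simp
  mem_or_mem m n h := by
    simp only [Set.mem_singleton_iff] at *
    omega
  exists_digit n hn := ⟨0, by simp, by
    rw [Set.mem_singleton_iff.1 hn, pow_zero, Nat.div_one, Nat.mod_eq_of_lt hp.out.one_lt]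
    exact one_ne_zero⟩

theorem isAdmissible_pos (p : ℕ) [hp : Fact p.Prime] : IsAdmissible p {n | n ≠ 0} where
  zero_notMem := by simp
  mem_or_mem m n h := by
    simp only [Set.mem_ofPred_eq] at *
    omega
  -- The leading digit of n is nonzero; its place is the logarithm of n in base `p`.
  exists_digit n hn := ⟨Nat.log p n, pow_ne_zero _ hp.out.ne_zero, by
    have h1 := Nat.pow_log_le_self p hn
    have h2 := Nat.lt_pow_succ_log_self hp.out.one_lt n
    have h3 : n / p ^ Nat.log p n < p := by
      rw [Nat.div_lt_iff_lt_mul (pow_pos hp.out.pos _), ← pow_succ']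
      exact h2
    have h4 : 0 < n / p ^ Nat.log p n := Nat.div_pos h1 (pow_pos hp.out.pos _)
    rw [Nat.mod_eq_of_lt h3]
    omega⟩

/-- The exponent of z_r in the product is the r-th digit n / p^r % p. -/
theorem dvd_digitExp (k : Type*) [Field k] (p : ℕ) [Fact p.Prime] [CharP k p] {B : Type*}
    [CommRing B] [Algebra k B] (r : ℕ) (z : ℕ → B) (n : ℕ) (h : n / p ^ r % p ≠ 0) :
    z r ∣ digitExp k p z n := by
  induction r generalizing z n with
  | zero =>
    rw [pow_zero, Nat.div_one] at h
    rw [digitExp_eq]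
    exact Dvd.dvd.trans (dvd_mul_of_dvd_left (dvd_pow_self _ h) _) (dvd_smul_of_dvd _ dvd_rfl)
  | succ r ih =>
    rw [pow_succ', ← Nat.div_div_eq_div_mul] at h
    rw [digitExp_eq]
    exact Dvd.dvd.trans (dvd_mul_of_dvd_right (ih (fun r => z (r + 1)) _ h) _)
      (dvd_smul_of_dvd _ dvd_rfl)

open Classical in
/-- The order of `γ_{p^r}(v)` in the filtration by the powers of the ideal. -/
noncomputable def ordGen (p : ℕ) (N : Set ℕ) (r : ℕ) : ℕ := if p ^ r ∈ N then 1 else 0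

section

variable {N : Set ℕ} {p : ℕ} [hp : Fact p.Prime] [CharP k p] (hN : IsAdmissible p N)

include hN in
-- The ideal is generated by the γₙ(w) with w in W, but f(1 ⊗ v) is a general element of R ⊗ W. The
-- passage to sums rests on `mem_or_mem`.
theorem dpowDeg_mem {R : Type u} [CommRing R] [Algebra k R] {n : ℕ} (hn : n ∈ N) (y : R ⊗[k] W) :
    dpowDeg i n y ∈ (dpIdeal k i N W).map
      (Algebra.TensorProduct.includeRight : _ →ₐ[k] R ⊗[k] (gammaDeg k i).obj W) := by
  induction y generalizing n with
  | zero =>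
    have h0 : n ≠ 0 := fun h => hN.zero_notMem (h ▸ hn)
    rw [dpowDeg_null, if_neg h0]
    exact zero_mem _
  | tmul r w =>
    have h : dpowDeg i n (r ⊗ₜ[k] w) = ((r ^ n) ⊗ₜ[k] 1) *
        (Algebra.TensorProduct.includeRight : _ →ₐ[k] R ⊗[k] (gammaDeg k i).obj W)
          (gammaElt k i n w) := by
      rw [dpowDeg_tmul, Algebra.TensorProduct.includeRight_apply,
        Algebra.TensorProduct.tmul_mul_tmul, mul_one, one_mul]
    rw [h]
    exact Ideal.mul_mem_left _ _ (Ideal.mem_map_of_mem _ (Ideal.subset_span ⟨n, hn, w, rfl⟩))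
  | add x y hx hy =>
    rw [dpowDeg_add]
    refine sum_mem fun z hz => ?_
    rw [Finset.HasAntidiagonal.mem_antidiagonal] at hz
    rcases hN.mem_or_mem z.1 z.2 (hz ▸ hn) with h | h
    · exact Ideal.mul_mem_right _ _ (hx h)
    · exact Ideal.mul_mem_left _ _ (hy h)

include hN in
theorem mapRes_mem_map {R : Type u} [CommRing R] [Algebra k R] (n : ℕ) (s : R)
    (f : R ⊗[k] V →ₗ[R] R ⊗[k] W) {a : (gammaDeg k i).obj V} (ha : a ∈ dpIdeal k i N V ^ n) :
    (gammaDeg k i).mapRes s f a ∈ (dpIdeal k i N W ^ n).map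
      (Algebra.TensorProduct.includeRight : _ →ₐ[k] R ⊗[k] (gammaDeg k i).obj W) := by
  have h : dpIdeal k i N V ≤ ((dpIdeal k i N W).map (Algebra.TensorProduct.includeRight :
      _ →ₐ[k] R ⊗[k] (gammaDeg k i).obj W)).comap ((gammaDeg k i).mapRes s f) := by
    refine Ideal.span_le.2 ?_
    rintro _ ⟨m, hm, v, rfl⟩
    rw [SetLike.mem_coe, Ideal.mem_comap, gammaDeg_mapRes]
    exact dpowDeg_mem hN hm _
  have h2 := (Ideal.pow_right_mono h n).trans (Ideal.le_comap_pow _ n) ha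
  rw [Ideal.map_pow]
  exact h2

/-- The image of R ⊗ I is already closed under multiplication by R ⊗ B, so the extended ideal is no
larger. This turns computations with ideals into the form required by `Filtration.stable`. -/
theorem mem_baseChange_of_mem_map {R : Type u} [CommRing R] [Algebra k R] {B : Type u} [CommRing B]
    [Algebra k B] (I : Ideal B) {x : R ⊗[k] B}
    (hx : x ∈ I.map (Algebra.TensorProduct.includeRight : B →ₐ[k] R ⊗[k] B)) :
    x ∈ (I.restrictScalars k).baseChange R := by
  refine Submodule.span_induction ?_ (zero_mem _) (fun _ _ _ _ => add_mem) ?_ hx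
  · rintro _ ⟨a, ha, rfl⟩
    exact Submodule.tmul_mem_baseChange_of_mem (p := I.restrictScalars k) _ ha
  · rintro c _ - ⟨y, rfl⟩
    induction y with
    | zero => simp
    | tmul r y =>
      induction c with
      | zero => simp
      | tmul r' b =>
        change (r' ⊗ₜ[k] b) * (r ⊗ₜ[k] (y : B)) ∈ _
        rw [Algebra.TensorProduct.tmul_mul_tmul]
        exact Submodule.tmul_mem_baseChange_of_mem (p := I.restrictScalars k) _
          (I.mul_mem_left b y.2)
      | add c c' h h' => rw [add_smul]; exact add_mem h h'
    | add y y' h h' => rw [map_add, smul_add]; exact add_mem h h'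

include hN in
-- The grading depends on the basis `b`, whereas the ideal is generated by the γₙ(v) for all v. On
-- basis elements the coaction of γₙ is divisible by X thanks to `exists_digit`. Sums are handled by
-- `mem_or_mem`, which finds in each term of the addition formula a factor with index in N.
theorem X_pow_dvd_grading {ι : Type*} [Fintype ι] (b : Module.Basis ι k V) (n : ℕ)
    {x : (gammaDeg k i).obj V} (hx : x ∈ dpIdeal k i N V ^ n) :
    Polynomial.X ^ n ∣ TruncPoly.grading k p (fun s : ι × ℕ => ordGen p N s.2)
      ((gammaDegEquiv i p b).symm x) := by
  let c : (gammaDeg k i).obj V →ₐ[k] Polynomial (TruncPoly k p (ι × ℕ)) :=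
    (TruncPoly.grading k p (fun s : ι × ℕ => ordGen p N s.2)).comp
      (gammaDegEquiv i p b).symm.toAlgHom
  have key : ∀ n ∈ N, ∀ v : V, Polynomial.X ∣ c (gammaElt k i n v) := by
    intro n hn v
    have hv : v ∈ Submodule.span k (Set.range b) := by simp [b.span_eq]
    induction hv using Submodule.span_induction generalizing n with
    | mem x hx =>
      obtain ⟨j, rfl⟩ := hx
      rw [(isDPSeq_gammaElt (i := i) (b j)).eq_digitExp k p n, map_digitExp]
      obtain ⟨r, hr, hd⟩ := hN.exists_digit n hn
      refine Dvd.dvd.trans ?_ (dvd_digitExp k p r _ n hd)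
      have h : c (gammaElt k i (p ^ r) (b j)) = Polynomial.C (TruncPoly.gen k p (j, r)) *
          Polynomial.X ^ ordGen p N r := by
        rw [← gammaDegEquiv_gen, AlgHom.comp_apply]
        change TruncPoly.grading _ _ _ ((gammaDegEquiv i p b).symm (gammaDegEquiv i p b _)) = _
        rw [AlgEquiv.symm_apply_apply, TruncPoly.grading_gen]
      rw [h, ordGen, if_pos hr, pow_one]
      exact dvd_mul_left _ _
    | zero =>
      rw [gammaElt_null n fun h => hN.zero_notMem (h ▸ hn), map_zero]
      exact dvd_zero _
    | add x y _ _ hx hy =>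
      rw [gammaElt_add, map_sum]
      refine Finset.dvd_sum fun z hz => ?_
      rw [Finset.HasAntidiagonal.mem_antidiagonal] at hz
      rw [map_mul]
      rcases hN.mem_or_mem z.1 z.2 (hz ▸ hn) with h | h
      · exact dvd_mul_of_dvd_left (hx _ h) _
      · exact dvd_mul_of_dvd_right (hy _ h) _
    | smul a x _ hx =>
      rw [gammaElt_smul, map_smul]
      exact (hx n hn).trans (dvd_smul_of_dvd _ dvd_rfl)
  -- The inverse image of (X) under the coaction is an ideal, so only generators need checking;
  -- powers of the ideal then map into powers of (X).
  have h : dpIdeal k i N V ≤ (Ideal.span {Polynomial.X}).comap c := by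
    refine Ideal.span_le.2 ?_
    rintro _ ⟨m, hm, v, rfl⟩
    rw [SetLike.mem_coe, Ideal.mem_comap, Ideal.mem_span_singleton]
    exact key m hm v
  have h2 := (Ideal.pow_right_mono h n).trans (Ideal.le_comap_pow _ n) hx
  rw [Ideal.mem_comap, Ideal.span_singleton_pow, Ideal.mem_span_singleton] at h2
  exact h2

variable (k i) in
/-- The filtration of `Γ(V[i])` by the powers of the ideal generated by the divided powers `γₙ(v)`
with `n` in `N`. -/
noncomputable def dpFiltration (N : Set ℕ) {p : ℕ} [hp : Fact p.Prime] [CharP k p]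
    (hN : IsAdmissible p N) : Filtration (gammaDeg k i) where
  sub n V := (dpIdeal k i N V ^ n).restrictScalars k
  sub_zero V := by rw [pow_zero, Ideal.one_eq_top]; rfl
  antitone n V := Ideal.pow_le_pow_right n.le_succ
  iInf_eq_bot V := by
    rw [eq_bot_iff]
    intro x hx
    let b := Module.finBasis k V
    rw [Submodule.mem_iInf] at hx
    -- An element of all the powers has a coaction divisible by every Xⁿ, which must be zero.
    have h0 : TruncPoly.grading k p (fun s : Fin _ × ℕ => ordGen p N s.2)
        ((gammaDegEquiv i p b).symm x) = 0 := by
      ext n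
      have := Polynomial.X_pow_dvd_iff.1 (X_pow_dvd_grading hN b (n + 1) (hx (n + 1))) n
        n.lt_succ_self
      rw [this, Polynomial.coeff_zero]
    have h1 := TruncPoly.eval_one_grading (fun s : Fin _ × ℕ => ordGen p N s.2)
      ((gammaDegEquiv i p b).symm x)
    rw [h0, Polynomial.eval_zero] at h1
    rw [Submodule.mem_bot]
    exact (gammaDegEquiv i p b).symm.injective (h1.symm.trans (map_zero _).symm)
  mul_mem {m n V x y} hx hy := by
    rw [Submodule.restrictScalars_mem] at *
    rw [pow_add]
    exact Ideal.mul_mem_mul hx hy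
  stable n s f a ha := mem_baseChange_of_mem_map _ (mapRes_mem_map hN n s f ha)

theorem gammaElt_pow_mem (r : ℕ) (v : V) :
    gammaElt k i (p ^ r) v ∈ (dpFiltration k i N hN).sub (ordGen p N r) V := by
  rw [ordGen]
  split_ifs with h
  · change _ ∈ (dpIdeal k i N V ^ 1).restrictScalars k
    rw [pow_one]
    exact Ideal.subset_span ⟨_, h, v, rfl⟩
  · rw [Filtration.sub_zero]
    trivial

variable (i) in
/-- The class of `γ_{p^r}(v)` in `gr Γ(V[i])`. -/
noncomputable def grElt (r : ℕ) (v : V) : (dpFiltration k i N hN).gr.obj V :=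
  (dpFiltration k i N hN).toGr (ordGen p N r) V ⟨_, gammaElt_pow_mem hN r v⟩

variable (i) in
/-- The algebra `gr Γ(V[i])` is the truncated polynomial algebra on the classes of `γ_{p^r}(b)`,
for `b` in a basis. -/
noncomputable def grEquiv {ι : Type*} [Fintype ι] (b : Module.Basis ι k V) :
    TruncPoly k p (ι × ℕ) ≃ₐ[k] (dpFiltration k i N hN).gr.obj V :=
  have h1 (s : ι × ℕ) : gammaDegEquiv i p b (TruncPoly.gen k p s) ∈
      (dpFiltration k i N hN).sub (ordGen p N s.2) V := by
    rw [gammaDegEquiv_gen]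
    exact gammaElt_pow_mem hN s.2 (b s.1)
  AlgEquiv.ofBijective ((dpFiltration k i N hN).truncToGr _ (gammaDegEquiv i p b) h1)
    ((dpFiltration k i N hN).truncToGr_bijective _ _ h1
      fun n _ hx => X_pow_dvd_grading hN b n hx)

theorem grEquiv_gen {ι : Type*} [Fintype ι] (b : Module.Basis ι k V) (j : ι) (r : ℕ) :
    grEquiv i hN b (TruncPoly.gen k p (j, r)) = grElt i hN r (b j) := by
  rw [grEquiv, AlgEquiv.ofBijective_apply, Filtration.truncToGr_gen]
  exact Filtration.toGr_congr _ rfl _ _ (gammaDegEquiv_gen p b j r)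

end

end PAlg

theorem adjoin_tensor {k : Type*} [CommRing k] {A B : Type*} [CommRing A] [Algebra k A]
    [CommRing B] [Algebra k B] {s : Set A} {t : Set B} (hs : Algebra.adjoin k s = ⊤)
    (ht : Algebra.adjoin k t = ⊤) {C : Subalgebra k (A ⊗[k] B)}
    (h1 : ∀ x ∈ s, x ⊗ₜ 1 ∈ C) (h2 : ∀ x ∈ t, 1 ⊗ₜ x ∈ C) : C = ⊤ := by
  have hs' : ⊤ ≤ C.comap (Algebra.TensorProduct.includeLeft : A →ₐ[k] A ⊗[k] B) :=
    hs ▸ Algebra.adjoin_le h1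
  have ht' : ⊤ ≤ C.comap (Algebra.TensorProduct.includeRight : B →ₐ[k] A ⊗[k] B) :=
    ht ▸ Algebra.adjoin_le h2
  rw [eq_top_iff]
  rintro x -
  induction x with
  | zero => exact zero_mem _
  | tmul a b =>
    rw [← mul_one a, ← one_mul b, ← Algebra.TensorProduct.tmul_mul_tmul]
    exact mul_mem (hs' (x := a) trivial) (ht' (x := b) trivial)
  | add x y hx hy => exact add_mem hx hy

/-! ### Quasi-triviality of the filtrations -/

namespace PAlg

variable {k : Type u} [Field k] {i : ℕ} {V W : FGModuleCat.{u} k} {N : Set ℕ} {p : ℕ}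
  [hp : Fact p.Prime] [CharP k p] (hN : IsAdmissible p N)

/-- For a pure tensor the divided power is explicit and no additivity of classes is needed, so this
covers all admissible N and all r. It is enough for scalars and for linear maps defined over k,
hence for weights, degrees and the exponential property. -/
theorem gr_mapRes_grElt_of_tmul {R : Type u} [CommRing R] [Algebra k R] (s : R)
    (f : R ⊗[k] V →ₗ[R] R ⊗[k] W) (r : ℕ) (v : V) (a : R) (w : W)
    (h : f (1 ⊗ₜ v) = a ⊗ₜ w) : (dpFiltration k i N hN).gr.mapRes s f (grElt i hN r v) =
      ((s ^ i * a) ^ p ^ r) ⊗ₜ grElt i hN r w := by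
  refine ((dpFiltration k i N hN).gr_mapRes_toGr s f _ _
    (((s ^ i * a) ^ p ^ r) ⊗ₜ ⟨_, gammaElt_pow_mem hN r w⟩) ?_).trans ?_
  · refine (gammaDeg_mapRes s f (p ^ r) v).trans ?_
    rw [h, TensorProduct.smul_tmul', smul_eq_mul, dpowDeg_tmul]
    rfl
  · rfl

theorem grElt_mem_comp (r : ℕ) (v : V) :
    grElt i hN r v ∈ (dpFiltration k i N hN).gr.comp (p ^ r) (i * p ^ r) V := by
  rw [mem_comp_iff]
  intro R _ _ a s
  rw [gr_mapRes_grElt_of_tmul hN s (a • LinearMap.id) r v a v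
    (by rw [LinearMap.smul_apply, LinearMap.id_apply, TensorProduct.smul_tmul', smul_eq_mul,
      mul_one]), mul_pow, ← pow_mul, mul_comm]

theorem gr_linMap_grElt (f : V →ₗ[k] W) (r : ℕ) (v : V) :
    (dpFiltration k i N hN).gr.linMap f (grElt i hN r v) = grElt i hN r (f v) := by
  have h := gr_mapRes_grElt_of_tmul (i := i) hN (1 : k) (f.baseChange k) r v 1 (f v) rfl
  rw [linMap, AlgHom.comp_apply, h]
  simp

theorem adjoin_grElt {ι : Type*} [Fintype ι] (b : Module.Basis ι k V) :
    Algebra.adjoin k (Set.range fun s : ι × ℕ => grElt i hN s.2 (b s.1)) = ⊤ := by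
  have h : (Set.range fun s : ι × ℕ => grElt i hN s.2 (b s.1)) =
      (grEquiv i hN b).toAlgHom '' Set.range (TruncPoly.gen k p) := by
    rw [← Set.range_comp]
    exact congrArg Set.range (funext fun s => (grEquiv_gen hN b s.1 s.2).symm)
  rw [h, ← AlgHom.map_adjoin, TruncPoly.adjoin_gen, Algebra.map_top, AlgHom.range_eq_top]
  exact (grEquiv i hN b).surjective

/-- A homomorphism to `gr Γ(V[i])` that takes generators with vanishing `p`-th powers to the classes
of the elements `γ_{p^r}(b)` is bijective. -/
theorem bijective_of_gen {ι : Type*} [Fintype ι] (b : Module.Basis ι k V) {B : Type*} [CommRing B]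
    [Algebra k B] (Φ : B →ₐ[k] (dpFiltration k i N hN).gr.obj V) {y : ι × ℕ → B}
    (hy : ∀ s, y s ^ p = 0) (hgen : Algebra.adjoin k (Set.range y) = ⊤)
    (hΦ : ∀ s, Φ (y s) = grElt i hN s.2 (b s.1)) : Function.Bijective Φ := by
  -- The relations y_s^p = 0 give a surjection from the truncated polynomial algebra onto `B`. Its
  -- composite with `Φ` is an isomorphism, so the surjection is injective and `Φ` is bijective.
  have h : Φ.comp (TruncPoly.lift y hy) = (grEquiv i hN b).toAlgHom := by
    refine TruncPoly.hom_ext fun s => ?_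
    rw [AlgHom.comp_apply, TruncPoly.lift_gen, hΦ]
    exact (grEquiv_gen hN b s.1 s.2).symm
  have h' : Φ ∘ TruncPoly.lift (k := k) y hy = grEquiv i hN b :=
    congrArg (fun g : _ →ₐ[k] _ => (g : _ → _)) h
  have hs := TruncPoly.lift_surjective hy hgen
  have hb : Function.Bijective (Φ ∘ TruncPoly.lift (k := k) y hy) :=
    h' ▸ (grEquiv i hN b).bijective
  refine ⟨fun x x' hx => ?_, hb.2.of_comp⟩
  obtain ⟨t, rfl⟩ := hs x
  obtain ⟨t', rfl⟩ := hs x'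
  exact congrArg _ (hb.1 hx)

/-- The union of bases of V and W is a basis of V ⊕ W. The classes attached to the two bases
generate the tensor product and go to the generators attached to this union. -/
theorem gr_isExponential : (dpFiltration k i N hN).gr.IsExponential := by
  intro V W
  let b := Module.finBasis k V
  let c := Module.finBasis k W
  let bc : Module.Basis _ k (FGModuleCat.of k (V × W)) := b.prod c
  let y : (Fin (Module.finrank k V) ⊕ Fin (Module.finrank k W)) × ℕ →
      (dpFiltration k i N hN).gr.obj V ⊗[k] (dpFiltration k i N hN).gr.obj W := fun s =>
    Sum.elim (fun j => grElt i hN s.2 (b j) ⊗ₜ 1) (fun j => 1 ⊗ₜ grElt i hN s.2 (c j)) s.1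
  have hpow : ∀ {U : FGModuleCat.{u} k} (d : Module.Basis (Fin (Module.finrank k U)) k U) j r,
      grElt i hN r (d j) ^ p = 0 := by
    intro U d j r
    rw [← grEquiv_gen hN d, ← map_pow, TruncPoly.gen_pow, map_zero]
  refine bijective_of_gen hN bc _ (y := y) ?_ ?_ ?_
  · rintro ⟨j | j, r⟩
    · simp only [y, Sum.elim_inl, Algebra.TensorProduct.tmul_pow, hpow, TensorProduct.zero_tmul]
    · simp only [y, Sum.elim_inr, Algebra.TensorProduct.tmul_pow, hpow, TensorProduct.tmul_zero]
  · refine adjoin_tensor (adjoin_grElt hN b) (adjoin_grElt hN c) ?_ ?_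
    · rintro _ ⟨s, rfl⟩
      exact Algebra.subset_adjoin ⟨(Sum.inl s.1, s.2), rfl⟩
    · rintro _ ⟨s, rfl⟩
      exact Algebra.subset_adjoin ⟨(Sum.inr s.1, s.2), rfl⟩
  · rintro ⟨j | j, r⟩
    · simp only [y, Sum.elim_inl, Algebra.TensorProduct.productMap_apply_tmul, map_one, mul_one]
      rw [gr_linMap_grElt]
      exact congrArg _ (Module.Basis.prod_apply b c (Sum.inl j)).symm
    · simp only [y, Sum.elim_inr, Algebra.TensorProduct.productMap_apply_tmul, map_one, one_mul]
      rw [gr_linMap_grElt]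
      exact congrArg _ (Module.Basis.prod_apply b c (Sum.inr j)).symm

/-- Γ(k) and its associated graded algebra are truncated polynomial algebras on generators of the
same weights p^r and degrees i p^r. Matching these generators gives the required isomorphism, which
is obtained from a basis. -/
theorem dpFiltration_isQuasiTrivial : (dpFiltration k i N hN).IsQuasiTrivial := by
  refine ⟨gr_isExponential hN, fun d j V => ?_, ?_⟩
  · let b := Module.finBasis k V
    exact finite_comp _ V hp.out.one_lt (y := fun s => grElt i hN s.2 (b s.1))
      (j := fun s => i * p ^ s.2) (fun s => grElt_mem_comp hN s.2 _) (adjoin_grElt hN b) d j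
  · let b := Module.finBasis k (FGModuleCat.of k k)
    have hb : ∀ s : Fin _ × ℕ, (gammaDegEquiv i p b).symm (gammaElt k i (p ^ s.2) (b s.1)) =
        TruncPoly.gen k p s := fun s => by
      rw [← gammaDegEquiv_gen, AlgEquiv.symm_apply_apply]
    refine ⟨(gammaDegEquiv i p b).symm.trans (grEquiv i hN b), fun d j => ?_⟩
    refine map_comp_of_gen _ _ _ _
      (y := fun s : Fin _ × ℕ => gammaElt k i (p ^ s.2) (b s.1)) (d := fun s => p ^ s.2)
      (j := fun s => i * p ^ s.2) (fun s => gammaElt_mem_comp _ _) (fun s => ?_)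
      (adjoin_dp_basis p b) d j
    rw [AlgEquiv.trans_apply, hb, grEquiv_gen]
    exact grElt_mem_comp hN _ _

variable {k : Type u} [Field k]

/-! ### Construction of morphisms -/

/-- A family of homomorphisms is a morphism if it is natural on generators. -/
noncomputable def Hom.ofGen {A B : PAlg k} (g : ∀ V, A.obj V →ₐ[k] B.obj V)
    (S : ∀ V, Set (A.obj V)) (hS : ∀ V, Algebra.adjoin k (S V) = ⊤)
    (h : ∀ {R : Type u} [CommRing R] [Algebra k R] {V W : FGModuleCat.{u} k} (s : R)
      (f : R ⊗[k] V →ₗ[R] R ⊗[k] W), ∀ a ∈ S V,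
      ext R (g W) (A.mapRes s f a) = B.mapRes s f (g V a)) : Hom A B where
  app := g
  naturality {R _ _ V W} s f x := by
    refine naturality_of_one g s f (fun a => ?_) x
    have e : ((ext R (g W)).restrictScalars k).comp (A.mapRes s f) =
        (B.mapRes s f).comp (g V) :=
      AlgHom.ext_of_adjoin_eq_top (hS V) fun a ha => h s f a ha
    exact DFunLike.congr_fun e a

theorem adjoin_tmul_one_one_tmul (A B : Type*) [CommRing A] [Algebra k A] [CommRing B]
    [Algebra k B] : Algebra.adjoin k
      {x : A ⊗[k] B | (∃ a : A, x = a ⊗ₜ[k] 1) ∨ ∃ b : B, x = 1 ⊗ₜ[k] b} = ⊤ :=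
  adjoin_tensor (s := Set.univ) (t := Set.univ) (Algebra.adjoin_univ k _)
    (Algebra.adjoin_univ k _) (fun x _ => Algebra.subset_adjoin (Or.inl ⟨x, rfl⟩))
    (fun x _ => Algebra.subset_adjoin (Or.inr ⟨x, rfl⟩))

/-- The morphism on a tensor product defined by morphisms on the factors. -/
noncomputable def Hom.tensorLift {A B C : PAlg k} (g : Hom A C) (h : Hom B C) :
    Hom (A.tensor B) C :=
  Hom.ofGen (A := A.tensor B)
    (fun V => Algebra.TensorProduct.productMap (A := A.obj V) (B := B.obj V) (g.app V) (h.app V))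
    (fun V => {x | (∃ a : A.obj V, x = a ⊗ₜ[k] (1 : B.obj V)) ∨
      ∃ b : B.obj V, x = (1 : A.obj V) ⊗ₜ[k] b})
    (fun V => adjoin_tmul_one_one_tmul (A.obj V) (B.obj V))
    (by
      intro R _ _ V W s f a ha
      have e1 : ∀ y : R ⊗[k] A.obj W, ext R (Algebra.TensorProduct.productMap (A := A.obj W)
          (B := B.obj W) (g.app W) (h.app W)) (ext R (Algebra.TensorProduct.includeLeft (R := k)
            (S := k) (A := A.obj W) (B := B.obj W)) y) = ext R (g.app W) y := by
        intro y
        induction y with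
        | zero => simp
        | tmul r y => simp
        | add x y hx hy => simp only [map_add, hx, hy]
      have e2 : ∀ y : R ⊗[k] B.obj W, ext R (Algebra.TensorProduct.productMap (A := A.obj W)
          (B := B.obj W) (g.app W) (h.app W)) (ext R (Algebra.TensorProduct.includeRight (R := k)
            (A := A.obj W) (B := B.obj W)) y) = ext R (h.app W) y := by
        intro y
        induction y with
        | zero => simp
        | tmul r y => simp
        | add x y hx hy => simp only [map_add, hx, hy]
      rcases ha with ⟨a, rfl⟩ | ⟨b, rfl⟩
      · refine (congrArg _ (tensor_mapRes A B s f a 1)).trans ?_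
        rw [map_one, map_one, mul_one]
        refine (e1 _).trans ?_
        rw [← g.mapRes]
        refine congrArg (C.mapRes s f) (Eq.symm ?_)
        refine (Algebra.TensorProduct.productMap_apply_tmul (g.app V) (h.app V) a 1).trans ?_
        rw [map_one, mul_one]
      · refine (congrArg _ (tensor_mapRes A B s f 1 b)).trans ?_
        rw [map_one, map_one, one_mul]
        refine (e2 _).trans ?_
        rw [← h.mapRes]
        refine congrArg (C.mapRes s f) (Eq.symm ?_)
        refine (Algebra.TensorProduct.productMap_apply_tmul (g.app V) (h.app V) 1 b).trans ?_
        rw [map_one, one_mul])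

theorem Hom.tensorLift_tmul {A B C : PAlg k} (g : Hom A C) (h : Hom B C) (V : FGModuleCat.{u} k)
    (a : A.obj V) (b : B.obj V) :
    (g.tensorLift h).app V (a ⊗ₜ[k] b) = g.app V a * h.app V b :=
  Algebra.TensorProduct.productMap_apply_tmul (g.app V) (h.app V) a b

/-- The morphism from the ground field. -/
noncomputable def Hom.unitLift (C : PAlg k) : Hom (unit k) C :=
  Hom.ofGen (A := unit k) (fun V => Algebra.ofId k (C.obj V)) (fun _ => ∅)
    (fun _ => Subsingleton.elim (α := Subalgebra k k) _ _) (by simp)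

/-- The canonical homomorphisms to the colimit. -/
noncomputable def colimOf (T : ℕ → PAlg k) (j : ∀ n, Hom (T n) (T (n + 1)))
    (V : FGModuleCat.{u} k) (n : ℕ) : (T n).obj V →ₐ[k] (colim T j).obj V :=
  DirectLimit.Algebra.of (fun n => (T n).obj V) (transApp T j V) n

theorem colimOf_succ (T : ℕ → PAlg k) (j : ∀ n, Hom (T n) (T (n + 1))) (V : FGModuleCat.{u} k)
    (n : ℕ) (a : (T n).obj V) : colimOf T j V (n + 1) ((j n).app V a) = colimOf T j V n a := by
  have h := DirectLimit.Algebra.of_f (R := k) (G := fun n => (T n).obj V) (f := transApp T j V)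
    n.le_succ a
  have e : trans T j n.le_succ = (j n).comp (Hom.id (T n)) := by
    simp only [trans]
    rw [Nat.leRec_succ _ _ le_rfl, Nat.leRec_self]
  rw [transApp, e] at h
  exact h

theorem colim_exists (T : ℕ → PAlg k) (j : ∀ n, Hom (T n) (T (n + 1))) (V : FGModuleCat.{u} k)
    (x : (colim T j).obj V) : ∃ n, ∃ a : (T n).obj V, x = colimOf T j V n a := by
  induction x using Quotient.inductionOn with
  | h x => exact ⟨x.1, x.2, rfl⟩

theorem colim_mapRes (T : ℕ → PAlg k) (j : ∀ n, Hom (T n) (T (n + 1))) {R : Type u} [CommRing R]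
    [Algebra k R] {V W : FGModuleCat.{u} k} (s : R) (f : R ⊗[k] V →ₗ[R] R ⊗[k] W) (n : ℕ)
    (a : (T n).obj V) : (colim T j).mapRes s f (colimOf T j V n a) =
      ext R (colimOf T j W n) ((T n).mapRes s f a) := by
  refine (extend_tmul _ 1 _).trans ?_
  rw [one_smul]
  exact DirectLimit.Algebra.lift_of _ _ _ _ _

theorem Hom.app_transApp {T : ℕ → PAlg k} {j : ∀ n, Hom (T n) (T (n + 1))} {C : PAlg k}
    (g : ∀ n, Hom (T n) C) (hg : ∀ n V x, (g (n + 1)).app V ((j n).app V x) = (g n).app V x)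
    {V : FGModuleCat.{u} k} {n m : ℕ} (h : n ≤ m) (x : (T n).obj V) :
    (g m).app V (transApp T j V n m h x) = (g n).app V x := by
  induction h with
  | refl =>
    simp only [transApp, trans, Nat.leRec_self]
    rfl
  | step h ih =>
    have e : trans T j (Nat.le.step h) = (j _).comp (trans T j h) := by
      simp only [trans]
      rw [Nat.leRec_succ]
    rw [transApp, e]
    exact (hg _ V _).trans ih

/-- The morphism on a colimit defined by a compatible family of morphisms. -/
noncomputable def Hom.colimLift {T : ℕ → PAlg k} {j : ∀ n, Hom (T n) (T (n + 1))} {C : PAlg k}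
    (g : ∀ n, Hom (T n) C) (hg : ∀ n V x, (g (n + 1)).app V ((j n).app V x) = (g n).app V x) :
    Hom (colim T j) C :=
  Hom.ofGen (A := colim T j)
    (fun V => DirectLimit.Algebra.lift (fun n => (T n).obj V) (transApp T j V) _
      (fun n => (g n).app V) (fun n m h x => Hom.app_transApp g hg h x))
    (fun V => {x | ∃ n, ∃ a : (T n).obj V, x = colimOf T j V n a})
    (fun V => by
      rw [eq_top_iff]
      rintro x -
      obtain ⟨n, a, rfl⟩ := colim_exists T j V x
      exact Algebra.subset_adjoin ⟨n, a, rfl⟩)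
    (by
      rintro R _ _ V W s f _ ⟨n, a, rfl⟩
      have e : ∀ y : R ⊗[k] (T n).obj W, ext R (DirectLimit.Algebra.lift (R := k)
          (fun n => (T n).obj W) (transApp T j W) _ (fun n => (g n).app W) (fun n m h x => Hom.app_transApp g hg h x))
          (ext R (DirectLimit.Algebra.of (fun n => (T n).obj W) (transApp T j W) n) y) =
          ext R ((g n).app W) y := by
        intro y
        induction y with
        | zero => simp
        | tmul r y => simp
        | add x y hx hy => simp only [map_add, hx, hy]
      refine (congrArg _ (colim_mapRes T j s f n a)).trans ((e _).trans ?_)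
      rw [← (g n).mapRes]
      rfl)

/-- The morphism on a finite tensor product defined by morphisms on the factors. -/
noncomputable def Hom.finTensorLift {A : ℕ → PAlg k} {C : PAlg k} (h : ∀ r, Hom (A r) C) :
    ∀ n, Hom (finTensor A n) C
  | 0 => Hom.unitLift C
  | n + 1 => (Hom.finTensorLift h n).tensorLift (h n)

/-- The morphism on the tensor product of a sequence defined by morphisms on the factors. -/
noncomputable def Hom.infTensorLift {A : ℕ → PAlg k} {C : PAlg k} (h : ∀ r, Hom (A r) C) :
    Hom (infTensor A) C :=
  Hom.colimLift (Hom.finTensorLift h) fun n V x =>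
    ((Hom.finTensorLift h n).tensorLift_tmul (h n) V x 1).trans (by rw [map_one, mul_one])

/-- The inclusion of a factor into the tensor product of a sequence. -/
noncomputable def infTensorOf (A : ℕ → PAlg k) (V : FGModuleCat.{u} k) (r : ℕ) :
    (A r).obj V →ₐ[k] (infTensor A).obj V :=
  (colimOf (finTensor A) (fun n => inl (finTensor A n) (A n)) V (r + 1)).comp
    (Algebra.TensorProduct.includeRight :
      (A r).obj V →ₐ[k] (finTensor A r).obj V ⊗[k] (A r).obj V)

theorem Hom.infTensorLift_of {A : ℕ → PAlg k} {C : PAlg k} (h : ∀ r, Hom (A r) C)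
    (V : FGModuleCat.{u} k) (r : ℕ) (a : (A r).obj V) :
    (Hom.infTensorLift h).app V (infTensorOf A V r a) = (h r).app V a :=
  ((Hom.finTensorLift h r).tensorLift_tmul (h r) V 1 a).trans (by rw [map_one, one_mul])

/-- Each element comes from a finite stage. By induction `B` contains the image of every stage, the
next one being generated by the previous stage and the new factor. -/
theorem infTensor_eq_top (A : ℕ → PAlg k) (V : FGModuleCat.{u} k)
    (B : Subalgebra k ((infTensor A).obj V)) (S : ∀ r, Set ((A r).obj V))
    (hS : ∀ r, Algebra.adjoin k (S r) = ⊤) (hB : ∀ r, ∀ x ∈ S r, infTensorOf A V r x ∈ B) :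
    B = ⊤ := by
  have key : ∀ n, B.comap (colimOf (finTensor A) (fun n => inl (finTensor A n) (A n)) V n) = ⊤ := by
    intro n
    induction n with
    | zero => exact Subsingleton.elim (α := Subalgebra k k) _ _
    | succ n ih =>
      refine adjoin_tensor (s := Set.univ) (Algebra.adjoin_univ k _) (hS n) (fun x _ => ?_)
        (fun x hx => hB n x hx)
      have hx : x ∈ B.comap (colimOf (finTensor A) (fun n => inl (finTensor A n) (A n)) V n) := by
        rw [ih]; trivial
      exact Eq.mpr (congrArg (· ∈ B)
        (colimOf_succ (finTensor A) (fun n => inl (finTensor A n) (A n)) V n x)) hx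
  rw [eq_top_iff]
  rintro x -
  obtain ⟨n, a, rfl⟩ := colim_exists _ _ V x
  have ha : a ∈ B.comap (colimOf (finTensor A) (fun n => inl (finTensor A n) (A n)) V n) := by
    rw [key]; trivial
  exact ha

/-- The inverse of a bijective morphism. -/
noncomputable def Iso.ofBijective {A B : PAlg k} (g : Hom B A)
    (hg : ∀ V, Function.Bijective (g.app V)) : Iso A B where
  app V := (AlgEquiv.ofBijective (g.app V) (hg V)).symm
  naturality {R _ _ V W} s f x := by
    -- As R is flat over the field k, `g` stays injective after base change, and naturality of the
    -- inverse can be tested after applying `g`.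
    have inj : Function.Injective (ext R (g.app W)) :=
      Module.Flat.lTensor_preserves_injective_linearMap (M := R) (g.app W).toLinearMap (hg W).1
    have e : ∀ (U : FGModuleCat.{u} k) (y : R ⊗[k] A.obj U), ext R (g.app U)
        (ext R (AlgEquiv.ofBijective (g.app U) (hg U)).symm.toAlgHom y) = y := by
      intro U y
      induction y with
      | zero => simp
      | tmul r y =>
        have : g.app U ((AlgEquiv.ofBijective (g.app U) (hg U)).symm y) = y :=
          (AlgEquiv.ofBijective (g.app U) (hg U)).apply_symm_apply y
        simp [this]
      | add x y hx hy => simp only [map_add, hx, hy]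
    apply inj
    rw [e, g.naturality, e]

/-! ### Classes in the associated graded algebra after base change -/

namespace Filtration

variable {A : PAlg k} (F : Filtration A) {R : Type u} [CommRing R] [Algebra k R]
  {V W : FGModuleCat.{u} k}

/-- `x` lies in `R ⊗ Fⁿ` and has class `c` in `R ⊗ grⁿ A`. -/
def HasClass (n : ℕ) (x : R ⊗[k] A.obj V) (c : R ⊗[k] F.gr.obj V) : Prop :=
  ∃ y : R ⊗[k] F.sub n V, (F.sub n V).subtype.baseChange R y = x ∧ (F.toGr n V).baseChange R y = c

variable {F}

theorem HasClass.add {n : ℕ} {x x' : R ⊗[k] A.obj V} {c c' : R ⊗[k] F.gr.obj V}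
    (h : F.HasClass n x c) (h' : F.HasClass n x' c') : F.HasClass n (x + x') (c + c') := by
  obtain ⟨y, rfl, rfl⟩ := h
  obtain ⟨y', rfl, rfl⟩ := h'
  exact ⟨y + y', map_add _ _ _, map_add _ _ _⟩

variable (F) in
theorem hasClass_tmul {n : ℕ} (r : R) {a : A.obj V} (ha : a ∈ F.sub n V) :
    F.HasClass n (r ⊗ₜ a) (r ⊗ₜ F.toGr n V ⟨a, ha⟩) :=
  ⟨r ⊗ₜ ⟨a, ha⟩, rfl, rfl⟩

theorem hasClass_of_mem {n : ℕ} {x : R ⊗[k] A.obj V} (hx : x ∈ (F.sub (n + 1) V).baseChange R) :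
    F.HasClass n x 0 := by
  obtain ⟨y, rfl⟩ := hx
  induction y with
  | zero => exact ⟨0, by simp, by simp⟩
  | tmul r y =>
    have h := F.hasClass_tmul r (F.antitone n V y.2)
    rw [(F.toGr_eq_zero_iff n V ⟨y, F.antitone n V y.2⟩).2 y.2, TensorProduct.tmul_zero] at h
    exact h
  | add x y hx hy =>
    rw [map_add, ← add_zero 0]
    exact hx.add hy

theorem HasClass.gr_mapRes {n : ℕ} {s : R} {f : R ⊗[k] V →ₗ[R] R ⊗[k] W} {a : F.sub n V}
    {c : R ⊗[k] F.gr.obj W} (h : F.HasClass n (A.mapRes s f a) c) :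
    F.gr.mapRes s f (F.toGr n V a) = c := by
  obtain ⟨y, hy, rfl⟩ := h
  exact F.gr_mapRes_toGr s f n a y hy.symm

end Filtration

end PAlg

/-! ### Frobenius twists after base change -/

section Frob

variable {k : Type u} [Field k] (p : ℕ) [hp : Fact p.Prime] [CharP k p] {R : Type u} [CommRing R]
  [Algebra k R] {V W : FGModuleCat.{u} k}

/-- The Frobenius map `R ⊗ W → R ⊗ W^(r)`. -/
noncomputable def frob (r : ℕ) (y : R ⊗[k] W) : R ⊗[k] twistSub k p r W :=
  (pow_mem_twistSub p r y).choose

/-- This characterizes `frob`, because R ⊗ W^(r) embeds into R ⊗ S(W). The rules for sums, multiples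
and pure tensors are read off there. -/
theorem subtype_frob (r : ℕ) (y : R ⊗[k] W) : (twistSub k p r W).subtype.baseChange R (frob p r y) =
    (SymmetricAlgebra.ι k W).baseChange R y ^ p ^ r :=
  (pow_mem_twistSub p r y).choose_spec

theorem frob_zero (r : ℕ) : frob p r (0 : R ⊗[k] W) = 0 := by
  apply baseChange_subtype_injective (twistSub k p r W) R
  rw [subtype_frob, map_zero, map_zero, zero_pow (pow_ne_zero r hp.out.ne_zero)]

theorem frob_add (r : ℕ) (x y : R ⊗[k] W) : frob p r (x + y) = frob p r x + frob p r y := by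
  apply baseChange_subtype_injective (twistSub k p r W) R
  rw [subtype_frob, map_add, map_add, subtype_frob, subtype_frob, add_pow_prime_pow k p]

theorem frob_tmul (r : ℕ) (a : R) (w : W) :
    frob p r (a ⊗ₜ[k] w) = (a ^ p ^ r) ⊗ₜ twistPow k p r (w : (W : Type u)) := by
  apply baseChange_subtype_injective (twistSub k p r W) R
  rw [subtype_frob, LinearMap.baseChange_tmul, Algebra.TensorProduct.tmul_pow]
  rfl

theorem frob_smul (r : ℕ) (a : R) (y : R ⊗[k] W) : frob p r (a • y) = a ^ p ^ r • frob p r y := by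
  apply baseChange_subtype_injective (twistSub k p r W) R
  rw [subtype_frob, map_smul, map_smul, subtype_frob, smul_pow]

/-- Inside R ⊗ S(W) this says that the algebra homomorphism induced by `f` commutes with p^r-th
powers. -/
theorem twist_map_twistPow (r : ℕ) (f : R ⊗[k] V →ₗ[R] R ⊗[k] W) (v : V) :
    (twist k p r).map f (1 ⊗ₜ twistPow k p r (v : (V : Type u))) = frob p r (f (1 ⊗ₜ v)) := by
  apply baseChange_subtype_injective (twistSub k p r W) R
  rw [subtype_frob]
  refine (subtype_restrLin (twistSub k p r V) (twistSub k p r W) _ (fun a ha => by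
    rw [AlgHom.toLinearMap_apply, extend_tmul, one_smul]
    exact symMap_mem_twistSub p r f ha) _).trans ?_
  refine ((extend_tmul (PAlg.symMap f) 1 (SymmetricAlgebra.ι k V v ^ p ^ r)).trans
    (one_smul _ _)).trans ?_
  exact (map_pow _ _ _).trans (congrArg (· ^ p ^ r) (PAlg.symMap_ι f v))

end Frob

namespace PAlg

/-! ### Generators of truncated polynomial functors -/

section Trunc

variable {k : Type u} [Field k] (p : ℕ) [hp : Fact p.Prime] [CharP k p] (j : ℕ)
  {U U' : FGModuleCat.{u} k}

variable (k U) in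
/-- The inclusion of `U` into `Q(U[j])`. -/
noncomputable def truncLin : (U : Type u) →ₗ[k] (truncDeg k p j).obj U :=
  (Ideal.Quotient.mkₐ k (truncIdeal k p U)).toLinearMap ∘ₗ SymmetricAlgebra.ι k U

theorem truncLin_pow (u : U) : truncLin k p j U u ^ p = 0 := by
  refine (map_pow (Ideal.Quotient.mk (truncIdeal k p U)) (SymmetricAlgebra.ι k U u) p).symm.trans ?_
  refine Ideal.Quotient.eq_zero_iff_mem.2 (Ideal.subset_span (Submodule.subset_span ⟨u, ?_⟩))
  simp

theorem trunc_mapRes {R : Type u} [CommRing R] [Algebra k R] (s : R)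
    (f : R ⊗[k] U →ₗ[R] R ⊗[k] U') (a : SymmetricAlgebra k U) :
    (trunc k p).mapRes s f (Ideal.Quotient.mk (truncIdeal k p U) a) =
      ext R (Ideal.Quotient.mkₐ k (truncIdeal k p U')) (symMap f a) := by
  rw [← sym_mapRes s f a]
  exact quot_mapRes (sym k) (fun V => truncIdeal k p V) _ s f a

theorem truncDeg_mapRes {R : Type u} [CommRing R] [Algebra k R] (s : R)
    (f : R ⊗[k] U →ₗ[R] R ⊗[k] U') (u : U) :
    (truncDeg k p j).mapRes s f (truncLin k p j U u) =
      (truncLin k p j U').baseChange R (s ^ j • f (1 ⊗ₜ u)) := by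
  refine (trunc_mapRes p s (s ^ j • f) (SymmetricAlgebra.ι k U u)).trans ?_
  rw [symMap_ι, LinearMap.smul_apply]
  generalize s ^ j • f (1 ⊗ₜ u) = y
  induction y with
  | zero =>
    simp only [map_zero]
    rfl
  | tmul r y => rfl
  | add x y hx hy =>
    rw [map_add, map_add, map_add, hx, hy]
    rfl

theorem adjoin_truncLin {S : Set U} (hS : Submodule.span k S = ⊤) :
    Algebra.adjoin k (truncLin k p j U '' S) = ⊤ := by
  have h1 : ∀ u, truncLin k p j U u ∈ Algebra.adjoin k (truncLin k p j U '' S) := by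
    intro u
    have hu : u ∈ Submodule.span k S := by rw [hS]; trivial
    induction hu using Submodule.span_induction with
    | mem x hx => exact Algebra.subset_adjoin ⟨x, hx, rfl⟩
    | zero => rw [map_zero]; exact zero_mem _
    | add x y _ _ hx hy => rw [map_add]; exact add_mem hx hy
    | smul c x _ hx => rw [map_smul]; exact Subalgebra.smul_mem _ hx c
  rw [eq_top_iff]
  rintro x -
  obtain ⟨x, rfl⟩ := Ideal.Quotient.mk_surjective (I := truncIdeal k p U) x
  have key : (⊤ : Subalgebra k (SymmetricAlgebra k U)) ≤
      (Algebra.adjoin k (truncLin k p j U '' S)).comap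
        (Ideal.Quotient.mkₐ k (truncIdeal k p U)) := by
    intro x _
    induction x using SymmetricAlgebra.induction with
    | algebraMap r => exact Subalgebra.algebraMap_mem _ r
    | ι u => exact h1 u
    | mul a b ha hb => exact mul_mem (ha trivial) (hb trivial)
    | add a b ha hb => exact add_mem (ha trivial) (hb trivial)
  exact key (x := x) trivial

omit hp [CharP k p] in
theorem symLift_eq_zero {B : Type*} [CommRing B] [Algebra k B] {M : Type u} [AddCommGroup M]
    [Module k M] (L : M →ₗ[k] B) (hL : ∀ u, L u ^ p = 0) {a : SymmetricAlgebra k M}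
    (ha : a ∈ truncIdeal k p M) : SymmetricAlgebra.lift L a = 0 := by
  induction ha using Submodule.span_induction with
  | mem x hx =>
    induction hx using Submodule.span_induction with
    | mem x hx =>
      obtain ⟨u, rfl⟩ := hx
      simp [hL]
    | zero => simp
    | add x y _ _ hx hy => rw [map_add, hx, hy, add_zero]
    | smul c x _ hx => rw [map_smul, hx, smul_zero]
  | zero => simp
  | add x y _ _ hx hy => rw [map_add, hx, hy, add_zero]
  | smul c x _ hx => rw [smul_eq_mul, map_mul, hx, mul_zero]

/-- The homomorphism `Q(U[j]) → B` defined by a linear map whose values have vanishing `p`-th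
powers. -/
noncomputable def truncLift {B : Type*} [CommRing B] [Algebra k B] (L : (U : Type u) →ₗ[k] B)
    (hL : ∀ u, L u ^ p = 0) : (truncDeg k p j).obj U →ₐ[k] B :=
  Ideal.Quotient.liftₐ (truncIdeal k p U) (SymmetricAlgebra.lift L) fun _ ha =>
    symLift_eq_zero p L hL ha

theorem truncLift_truncLin {B : Type*} [CommRing B] [Algebra k B] (L : (U : Type u) →ₗ[k] B)
    (hL : ∀ u, L u ^ p = 0) (u : U) : truncLift p j L hL (truncLin k p j U u) = L u :=
  SymmetricAlgebra.lift_ι_apply L u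

theorem ext_truncLift {R : Type*} [CommRing R] [Algebra k R] {B : Type*} [CommRing B] [Algebra k B]
    (L : (U : Type u) →ₗ[k] B) (hL : ∀ u, L u ^ p = 0) (y : R ⊗[k] U) :
    ext R (truncLift p j L hL) ((truncLin k p j U).baseChange R y) = L.baseChange R y := by
  induction y with
  | zero => simp only [map_zero]
  | tmul a y =>
    rw [LinearMap.baseChange_tmul, LinearMap.baseChange_tmul, Algebra.TensorProduct.map_tmul,
      truncLift_truncLin]
    rfl
  | add x y hx hy => rw [map_add, map_add, map_add, hx, hy]

end Trunc

/-! ### Additivity of the classes of divided powers -/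

/-- The two extreme terms of the addition formula are removed. In each remaining term both indices
are nonzero, hence in N, and the term is a product of two elements of I. -/
theorem sum_antidiagonal_sub_mem {B : Type*} [CommRing B] (I : Ideal B) {N : Set ℕ} {a b : ℕ → B}
    (ha0 : a 0 = 1) (hb0 : b 0 = 1) (ha : ∀ n ∈ N, a n ∈ I) (hb : ∀ n ∈ N, b n ∈ I) {n : ℕ}
    (hn : n ≠ 0) (h : ∀ m m', m + m' = n → m ≠ 0 → m' ≠ 0 → m ∈ N ∧ m' ∈ N) :
    (∑ z ∈ Finset.HasAntidiagonal.antidiagonal n, a z.1 * b z.2) - (a n + b n) ∈ I ^ 2 := by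
  have h1 : (n, 0) ∈ Finset.HasAntidiagonal.antidiagonal n := by simp
  have h2 : (0, n) ∈ (Finset.HasAntidiagonal.antidiagonal n).erase (n, 0) := by
    simp [hn.symm]
  rw [← Finset.add_sum_erase _ _ h1, ← Finset.add_sum_erase _ _ h2, ha0, hb0, one_mul, mul_one,
    ← add_assoc, add_sub_cancel_left]
  refine sum_mem fun z hz => ?_
  simp only [Finset.mem_erase, Finset.HasAntidiagonal.mem_antidiagonal, Ne, Prod.ext_iff] at hz
  obtain ⟨m1, m2⟩ := h z.1 z.2 hz.2.2 (by omega) (by omega)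
  rw [pow_two]
  exact Ideal.mul_mem_mul (ha _ m1) (hb _ m2)

variable {k : Type u} [Field k] {i : ℕ} {V W : FGModuleCat.{u} k} {N : Set ℕ} {p : ℕ}
  [hp : Fact p.Prime] [CharP k p] (hN : IsAdmissible p N)

omit hp in
theorem ordGen_eq_one {r : ℕ} (hr : p ^ r ∈ N) : ordGen p N r = 1 := if_pos hr

theorem grElt_pow (r : ℕ) (v : V) : grElt i hN r v ^ p = 0 := by
  rw [grElt, Filtration.toGr_pow]
  have h0 : (⟨gammaElt k i (p ^ r) v ^ p, Filtration.pow_mem _ (gammaElt_pow_mem hN r v) p⟩ :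
      (dpFiltration k i N hN).sub (p * ordGen p N r) V) = 0 :=
    Subtype.ext ((isDPSeq_gammaElt v).pow_prime k p r)
  rw [h0, map_zero]

theorem grElt_smul (r : ℕ) (c : k) (v : V) :
    grElt i hN r (c • v) = c ^ p ^ r • grElt i hN r v := by
  rw [grElt, grElt, ← map_smul]
  exact Filtration.toGr_congr _ rfl _ _ (gammaElt_smul _ c v)

section

variable {r : ℕ} (hr : p ^ r ∈ N)
  (hmix : ∀ m m', m + m' = p ^ r → m ≠ 0 → m' ≠ 0 → m ∈ N ∧ m' ∈ N)

include hr hmix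

/-- When p^r is in N the class is taken in I/I², where the mixed terms of the addition formula die.
The hypothesis `hmix` holds for every r if N consists of the positive integers, and vacuously for r
= 0. -/
theorem grElt_add (v w : V) : grElt i hN r (v + w) = grElt i hN r v + grElt i hN r w := by
  have h : gammaElt k i (p ^ r) (v + w) - (gammaElt k i (p ^ r) v + gammaElt k i (p ^ r) w) ∈
      dpIdeal k i N V ^ (ordGen p N r + 1) := by
    rw [gammaElt_add, ordGen_eq_one hr]
    exact sum_antidiagonal_sub_mem (N := N) (dpIdeal k i N V) (a := fun n => gammaElt k i n v)
      (b := fun n => gammaElt k i n w) (isDPSeq_gammaElt v).zero (isDPSeq_gammaElt w).zero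
      (fun n hn => Ideal.subset_span ⟨n, hn, v, rfl⟩)
      (fun n hn => Ideal.subset_span ⟨n, hn, w, rfl⟩) (pow_ne_zero r hp.out.ne_zero) hmix
  rw [← sub_eq_zero, grElt, grElt, grElt, ← map_add, ← map_sub, Filtration.toGr_eq_zero_iff]
  exact h

/-- The argument of `grElt_add` over R, for elements of R ⊗ W that need not be pure tensors. -/
theorem dpowDeg_add_sub_mem {R : Type u} [CommRing R] [Algebra k R] (x y : R ⊗[k] W) :
    dpowDeg i (p ^ r) (x + y) - (dpowDeg i (p ^ r) x + dpowDeg i (p ^ r) y) ∈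
      ((dpFiltration k i N hN).sub (ordGen p N r + 1) W).baseChange R := by
  rw [ordGen_eq_one hr]
  refine mem_baseChange_of_mem_map (dpIdeal k i N W ^ 2) ?_
  rw [dpowDeg_add, Ideal.map_pow]
  exact sum_antidiagonal_sub_mem (N := N) _ (dpowDeg_zero x) (dpowDeg_zero y)
    (fun n hn => dpowDeg_mem hN hn x) (fun n hn => dpowDeg_mem hN hn y)
    (pow_ne_zero r hp.out.ne_zero) hmix

/-- An additive map on `R ⊗ W` that agrees with the classes of the divided powers on pure tensors
does so everywhere. -/
theorem hasClass_dpowDeg {R : Type u} [CommRing R] [Algebra k R]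
    (c : R ⊗[k] W → R ⊗[k] (dpFiltration k i N hN).gr.obj W) (hc0 : c 0 = 0)
    (hadd : ∀ x y, c (x + y) = c x + c y)
    (hc : ∀ a w, c (a ⊗ₜ w) = (a ^ p ^ r) ⊗ₜ grElt i hN r w) (y : R ⊗[k] W) :
    (dpFiltration k i N hN).HasClass (ordGen p N r) (dpowDeg i (p ^ r) y) (c y) := by
  induction y with
  | zero =>
    rw [dpowDeg_null, if_neg (pow_ne_zero r hp.out.ne_zero), hc0]
    exact Filtration.hasClass_of_mem (zero_mem _)
  | tmul a w =>
    rw [dpowDeg_tmul, hc]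
    exact Filtration.hasClass_tmul _ _ (gammaElt_pow_mem hN r w)
  | add x y hx hy =>
    have h := (hx.add hy).add (Filtration.hasClass_of_mem (dpowDeg_add_sub_mem hN hr hmix x y))
    rw [add_sub_cancel, add_zero, ← hadd] at h
    exact h

/-- Naturality of the maps into gr Γ(V) reduces to this: `c` will be the candidate map after base
change, composed with the Frobenius in the case of a twist. -/
theorem gr_mapRes_grElt {R : Type u} [CommRing R] [Algebra k R]
    (c : R ⊗[k] W → R ⊗[k] (dpFiltration k i N hN).gr.obj W) (hc0 : c 0 = 0)
    (hadd : ∀ x y, c (x + y) = c x + c y)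
    (hc : ∀ a w, c (a ⊗ₜ w) = (a ^ p ^ r) ⊗ₜ grElt i hN r w) (s : R)
    (f : R ⊗[k] V →ₗ[R] R ⊗[k] W) (v : V) :
    (dpFiltration k i N hN).gr.mapRes s f (grElt i hN r v) = c (s ^ i • f (1 ⊗ₜ v)) := by
  refine Filtration.HasClass.gr_mapRes ?_
  have h := hasClass_dpowDeg hN hr hmix c hc0 hadd hc (s ^ i • f (1 ⊗ₜ v))
  rw [← gammaDeg_mapRes] at h
  exact h

end

/-! ### The filtration by the powers of the augmentation ideal -/

omit hp in
theorem mix_pos (r : ℕ) (m m' : ℕ) (_ : m + m' = p ^ r) (h : m ≠ 0) (h' : m' ≠ 0) :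
    m ∈ {n : ℕ | n ≠ 0} ∧ m' ∈ {n : ℕ | n ≠ 0} :=
  ⟨h, h'⟩

section

variable (p i V)

/-- The map `V^(r) → gr Γ(V[i])`, `v ^ (p ^ r) ↦ γ_{p^r}(v)`. -/
noncomputable def twistToGr (r : ℕ) : twistSub k p r V →ₗ[k]
    (dpFiltration k i _ (isAdmissible_pos p)).gr.obj V :=
  (exists_twistLift p r (fun v : V => grElt i (isAdmissible_pos p) r v)
    (grElt_add _ (pow_ne_zero r hp.out.ne_zero) (mix_pos r))
    (grElt_smul _ r)).choose

theorem twistToGr_twistPow (r : ℕ) (v : V) :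
    twistToGr i V p r (twistPow k p r (v : (V : Type u))) = grElt i (isAdmissible_pos p) r v :=
  (exists_twistLift p r (fun v : V => grElt i (isAdmissible_pos p) r v)
    (grElt_add _ (pow_ne_zero r hp.out.ne_zero) (mix_pos r))
    (grElt_smul _ r)).choose_spec v

theorem twistToGr_pow (r : ℕ) (x : twistSub k p r V) : twistToGr i V p r x ^ p = 0 := by
  have hx : x ∈ Submodule.span k (Set.range (twistPow k p r : V → twistSub k p r V)) := by
    rw [span_twistPow]; trivial
  induction hx using Submodule.span_induction with
  | mem x hx =>
    obtain ⟨v, rfl⟩ := hx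
    rw [twistToGr_twistPow, grElt_pow]
  | zero => rw [map_zero, zero_pow hp.out.ne_zero]
  | add x y _ _ hx hy =>
    have := add_pow_prime_pow k p 1 (twistToGr i V p r x) (twistToGr i V p r y)
    rw [pow_one, hx, hy, add_zero] at this
    rw [map_add, this]
  | smul c x _ hx => rw [map_smul, smul_pow, hx, smul_zero]

end

variable (k i p) in
/-- The morphism `Q(V^(r)[i p ^ r]) → gr Γ(V[i])`. -/
noncomputable def truncTwistToGr (r : ℕ) : Hom (truncTwist k p r (i * p ^ r))
    (dpFiltration k i _ (isAdmissible_pos p)).gr :=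
  Hom.ofGen
    (fun V => truncLift p (i * p ^ r) (U := FGModuleCat.of k ((twist k p r).obj V))
      (twistToGr i V p r) (twistToGr_pow i V p r))
    (fun V => truncLin k p (i * p ^ r) (FGModuleCat.of k ((twist k p r).obj V)) ''
      Set.range (twistPow k p r : V → twistSub k p r V))
    (fun V => adjoin_truncLin p (i * p ^ r) (U := FGModuleCat.of k ((twist k p r).obj V))
      (span_twistPow p r))
    (by
      rintro R _ _ V W s f _ ⟨_, ⟨v, rfl⟩, rfl⟩
      have h1 := truncDeg_mapRes p (i * p ^ r) (U := FGModuleCat.of k ((twist k p r).obj V))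
        (U' := FGModuleCat.of k ((twist k p r).obj W)) s ((twist k p r).map f)
        (twistPow k p r (v : (V : Type u)))
      have e1 : (twist k p r).map f (1 ⊗ₜ twistPow k p r (v : (V : Type u))) =
        frob p r (f (1 ⊗ₜ v)) := twist_map_twistPow p r f v
      have h2 : ∀ y : R ⊗[k] twistSub k p r W,
          ext R (truncLift p (i * p ^ r) (U := FGModuleCat.of k ((twist k p r).obj W))
            (twistToGr i W p r) (twistToGr_pow i W p r))
            ((truncLin k p (i * p ^ r) (FGModuleCat.of k ((twist k p r).obj W))).baseChange R y) =
          (twistToGr i W p r).baseChange R y :=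
        fun y => ext_truncLift p (i * p ^ r) (U := FGModuleCat.of k ((twist k p r).obj W))
          (twistToGr i W p r) (twistToGr_pow i W p r) y
      -- The additive map that computes classes is v ↦ v^{p^r} over R, followed by the base change
      -- of `twistToGr`.
      have h3 := gr_mapRes_grElt (i := i) (isAdmissible_pos p) (pow_ne_zero r hp.out.ne_zero)
        (mix_pos r) (fun y : R ⊗[k] W => (twistToGr i W p r).baseChange R (frob p r y))
        (by simp only [frob_zero, map_zero]) (fun x y => by simp only [frob_add, map_add])
        (fun a w => by
          simp only [frob_tmul, LinearMap.baseChange_tmul, twistToGr_twistPow]) s f v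
      refine (congrArg _ h1).trans ((congrArg _ (congrArg _ (congrArg _ e1))).trans ?_)
      refine (h2 _).trans ?_
      refine Eq.trans ?_ (congrArg _ ((truncLift_truncLin p _ _ _ _).trans
        (twistToGr_twistPow i V p r v)).symm)
      rw [h3]
      -- The Frobenius raises the scalar `s ^ i` to the power p^r; this is why V^(r) is placed in
      -- degree i p^r.
      change (twistToGr i W p r).baseChange R (s ^ (i * p ^ r) • frob p r (f (1 ⊗ₜ v))) = _
      rw [frob_smul, pow_mul])

theorem truncTwistToGr_app (r : ℕ) (V : FGModuleCat.{u} k) (v : V) :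
    (truncTwistToGr k i p r).app V (truncLin k p (i * p ^ r)
      (FGModuleCat.of k ((twist k p r).obj V)) (twistPow k p r (v : (V : Type u)))) =
    grElt i (isAdmissible_pos p) r v :=
  (truncLift_truncLin p _ (U := FGModuleCat.of k ((twist k p r).obj V)) (twistToGr i V p r)
    (twistToGr_pow i V p r) _).trans (twistToGr_twistPow i V p r v)

/-- The elements b_j^{p^r} of the r-th factor generate, have zero p-th powers in Q(V^(r)), and go to
the classes of γ_{p^r}(b_j). So `bijective_of_gen` applies. -/
theorem infTensorLift_bijective (V : FGModuleCat.{u} k) :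
    Function.Bijective ((Hom.infTensorLift (truncTwistToGr k i p)).app V) := by
  let b := Module.finBasis k V
  let y : Fin (Module.finrank k V) × ℕ →
      (infTensor fun r => truncTwist k p r (i * p ^ r)).obj V := fun s =>
    infTensorOf (fun r => truncTwist k p r (i * p ^ r)) V s.2 (truncLin k p (i * p ^ s.2)
      (FGModuleCat.of k ((twist k p s.2).obj V)) (twistPow k p s.2 (b s.1 : (V : Type u))))
  refine bijective_of_gen _ b _ (y := y) (fun s => ?_) ?_ fun s => ?_
  · refine (map_pow _ _ _).symm.trans ((congrArg _ (truncLin_pow p _ _)).trans (map_zero _))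
  · refine infTensor_eq_top (fun r => truncTwist k p r (i * p ^ r)) V _
      (fun r => truncLin k p (i * p ^ r) (FGModuleCat.of k ((twist k p r).obj V)) ''
        Set.range (twistBasis p r b)) (fun r => adjoin_truncLin p (i * p ^ r)
          (U := FGModuleCat.of k ((twist k p r).obj V)) (twistBasis p r b).span_eq) ?_
    rintro r _ ⟨_, ⟨j, rfl⟩, rfl⟩
    refine Algebra.subset_adjoin ⟨(j, r), ?_⟩
    simp only [y]
    rw [twistBasis_apply]
  · exact (Hom.infTensorLift_of _ V s.2 _).trans (truncTwistToGr_app s.2 V (b s.1))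

end PAlg

/-- If `p` divides the first index and the sum, it divides the second index. This compares the
addition formula for γ_{pn} in gr⁰ with the one for γₙ on the twist. -/
theorem sum_antidiagonal_mul {M : Type*} [AddCommMonoid M] {p : ℕ} (hp : p ≠ 0) (n : ℕ)
    (f : ℕ × ℕ → M) (hf : ∀ z, ¬ p ∣ z.1 → f z = 0) :
    ∑ z ∈ Finset.HasAntidiagonal.antidiagonal (p * n), f z =
      ∑ z ∈ Finset.HasAntidiagonal.antidiagonal n, f (p * z.1, p * z.2) := by
  symm
  refine Finset.sum_of_injOn (fun z => (p * z.1, p * z.2)) ?_ ?_ ?_ fun _ _ => rfl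
  · rintro ⟨a, b⟩ _ ⟨c, d⟩ _ h
    simpa [hp] using h
  · rintro ⟨a, b⟩ h
    simp only [Finset.mem_coe, Finset.HasAntidiagonal.mem_antidiagonal] at h ⊢
    rw [← mul_add, h]
  · rintro ⟨a, b⟩ h h'
    refine hf _ fun ⟨c, hc⟩ => h' ?_
    simp only [Finset.HasAntidiagonal.mem_antidiagonal] at h hc
    obtain ⟨d, hd⟩ : p ∣ b := (Nat.dvd_add_right ⟨c, hc⟩).1 ⟨n, h⟩
    subst hc hd
    refine ⟨(c, d), ?_, rfl⟩
    rw [← mul_add] at h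
    simpa using Nat.eq_of_mul_eq_mul_left (Nat.pos_of_ne_zero hp) h

/-! ### The quotient map to gr⁰ -/

namespace PAlg

namespace Filtration

variable {k : Type u} [Field k] {A : PAlg k} (F : Filtration A) (V : FGModuleCat.{u} k)

/-- The homomorphism `A → gr⁰ A`. -/
noncomputable def toGrZero : A.obj V →ₐ[k] F.gr.obj V :=
  AlgHom.ofLinearMap (F.toGr 0 V ∘ₗ LinearMap.id.codRestrict (F.sub 0 V) fun a => by
    rw [F.sub_zero]; trivial) F.toGr_zero_one fun a b =>
      (F.toGr_mul 0 0 V ⟨a, by rw [F.sub_zero]; trivial⟩ ⟨b, by rw [F.sub_zero]; trivial⟩).symm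

variable {V}

theorem toGrZero_apply (a : A.obj V) (ha : a ∈ F.sub 0 V) : F.toGrZero V a = F.toGr 0 V ⟨a, ha⟩ :=
  rfl

theorem toGrZero_eq_zero {a : A.obj V} (ha : a ∈ F.sub 1 V) : F.toGrZero V a = 0 :=
  (F.toGr_eq_zero_iff 0 V _).2 ha

theorem gr_mapRes_toGrZero {R : Type u} [CommRing R] [Algebra k R] {W : FGModuleCat.{u} k} (s : R)
    (f : R ⊗[k] V →ₗ[R] R ⊗[k] W) (a : A.obj V) :
    F.gr.mapRes s f (F.toGrZero V a) = ext R (F.toGrZero W) (A.mapRes s f a) := by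
  have ha : a ∈ F.sub 0 V := by rw [F.sub_zero]; trivial
  obtain ⟨y, hy⟩ := F.exists_mapRes 0 s f ⟨a, ha⟩
  rw [F.toGrZero_apply a ha, F.gr_mapRes_toGr s f 0 _ y hy, hy]
  clear hy
  induction y with
  | zero => simp only [map_zero]
  | tmul r y => rfl
  | add x y hx hy => simp only [map_add, hx, hy]

end Filtration

variable {k : Type u} [Field k] {i : ℕ} {V W : FGModuleCat.{u} k} {p : ℕ} [hp : Fact p.Prime]
  [CharP k p]

/-! ### The filtration by the powers of the ideal generated by `V` -/

theorem principalIdeal_eq (V : FGModuleCat.{u} k) : principalIdeal k i V = dpIdeal k i {1} V := by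
  refine congrArg Ideal.span (Set.ext fun x => ?_)
  constructor
  · rintro ⟨v, rfl⟩
    exact ⟨1, rfl, v, rfl⟩
  · rintro ⟨_, rfl, v, rfl⟩
    exact ⟨v, rfl⟩

omit hp in
-- Vacuous: 1 is not a sum of two nonzero natural numbers.
theorem mix_one (m m' : ℕ) (h : m + m' = p ^ 0) (h1 : m ≠ 0) (h2 : m' ≠ 0) :
    m ∈ ({1} : Set ℕ) ∧ m' ∈ ({1} : Set ℕ) := by
  rw [pow_zero] at h
  omega

omit hp in
theorem pow_zero_mem_one : p ^ 0 ∈ ({1} : Set ℕ) := pow_zero p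

variable (i p V) in
/-- The inclusion of `V` into `gr¹ Γ(V[i])`. -/
noncomputable def linToGr : (V : Type u) →ₗ[k] (dpFiltration k i _ (isAdmissible_one p)).gr.obj V where
  toFun v := grElt i (isAdmissible_one p) 0 v
  map_add' := grElt_add _ pow_zero_mem_one mix_one
  map_smul' c v := by rw [grElt_smul, pow_zero, pow_one]; rfl

theorem linToGr_pow (v : V) : linToGr i V p v ^ p = 0 := grElt_pow _ 0 v

variable (k i p) in
/-- The morphism `Q(V[i]) → gr Γ(V[i])`. -/
noncomputable def truncToGrHom : Hom (truncDeg k p i) (dpFiltration k i _ (isAdmissible_one p)).gr :=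
  Hom.ofGen (fun V => truncLift p i (linToGr i V p) linToGr_pow)
    (fun V => truncLin k p i V '' Set.univ) (fun V => adjoin_truncLin p i Submodule.span_univ)
    (by
      rintro R _ _ V W s f _ ⟨v, -, rfl⟩
      rw [truncDeg_mapRes, ext_truncLift, truncLift_truncLin]
      refine (gr_mapRes_grElt (isAdmissible_one p) pow_zero_mem_one mix_one
        (fun y : R ⊗[k] W => (linToGr i W p).baseChange R y) (map_zero _) (map_add _)
        (fun a w => ?_) s f v).symm
      rw [LinearMap.baseChange_tmul, pow_zero, pow_one]
      rfl)

theorem truncToGrHom_truncLin (v : V) : (truncToGrHom k i p).app V (truncLin k p i V v) =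
    grElt i (isAdmissible_one p) 0 v :=
  truncLift_truncLin p i (linToGr i V p) linToGr_pow v

theorem isDPSeq_dpowDeg {R : Type u} [CommRing R] [Algebra k R] (y : R ⊗[k] W) :
    IsDPSeq fun n => dpowDeg i n y :=
  ⟨dpowDeg_zero y, fun n m => dpow_mul n m y⟩

variable (i p V) in
/-- The projection `Γ(V[i]) → gr⁰ Γ(V[i])`. -/
noncomputable abbrev gammaToGr : (gammaDeg k i).obj V →ₐ[k]
    (dpFiltration k i _ (isAdmissible_one p)).gr.obj V :=
  (dpFiltration k i _ (isAdmissible_one p)).toGrZero V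

/-- By `eq_mul`, γₙ(y) is divisible by γ₁(y)^{n % p}. The exponent is nonzero, and γ₁(y) lies in the
extended ideal, which dies in gr⁰. -/
theorem ext_gammaToGr_eq_zero {R : Type u} [CommRing R] [Algebra k R] (y : R ⊗[k] W) {n : ℕ}
    (hn : ¬ p ∣ n) : ext R (gammaToGr i W p) (dpowDeg i n y) = 0 := by
  have h1 : ext R (gammaToGr i W p) (dpowDeg i 1 y) = 0 := by
    have h2 : (dpIdeal k i {1} W).map (Algebra.TensorProduct.includeRight :
        _ →ₐ[k] R ⊗[k] (gammaDeg k i).obj W) ≤ RingHom.ker (ext R (gammaToGr i W p)) := by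
      refine Ideal.map_le_iff_le_comap.2 fun x hx => ?_
      rw [Ideal.mem_comap, RingHom.mem_ker]
      have h3 : gammaToGr i W p x = 0 :=
        Filtration.toGrZero_eq_zero _ (show x ∈ dpIdeal k i {1} W ^ 1 by rwa [pow_one])
      refine (Algebra.TensorProduct.map_tmul _ _ _ _).trans ?_
      rw [h3, tmul_zero]
    exact h2 (dpowDeg_mem (isAdmissible_one p) rfl y)
  rw [(isDPSeq_dpowDeg y).eq_mul k p n]
  have h4 : n % p ≠ 0 := fun h => hn (Nat.dvd_of_mod_eq_zero h)
  have e : ext R (gammaToGr i W p) (dpowDeg i 1 y ^ (n % p) * dpowDeg i (p * (n / p)) y) = 0 := by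
    rw [map_mul, map_pow, h1, zero_pow h4, zero_mul]
  exact (map_smul ((ext R (gammaToGr i W p)).restrictScalars k) _ _).trans (by
    rw [AlgHom.restrictScalars_apply, e, smul_zero])

theorem gammaToGr_eq_zero (v : V) {n : ℕ} (hn : ¬ p ∣ n) :
    gammaToGr i V p (gammaElt k i n v) = 0 := by
  have h1 : gammaElt k i 1 v ∈ dpIdeal k i {1} V ^ 1 := by
    rw [pow_one]
    exact Ideal.subset_span ⟨1, rfl, v, rfl⟩
  have h2 : gammaToGr i V p (gammaElt k i 1 v) = 0 := Filtration.toGrZero_eq_zero _ h1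
  rw [(isDPSeq_gammaElt v).eq_mul k p n, map_smul, map_mul, map_pow, h2,
    zero_pow fun h => hn (Nat.dvd_of_mod_eq_zero h), zero_mul, smul_zero]

variable (i p V) in
/-- The homomorphism `Γ(V^(1)) → gr⁰ Γ(V[i])`, `γₙ(v ^ p) ↦ γ_{pn}(v)`. -/
noncomputable def gammaTwistLift : (gammaTwist k p 1 (p * i)).obj V →ₐ[k]
    (dpFiltration k i _ (isAdmissible_one p)).gr.obj V :=
  gammaLift (twistBasis p 1 (Module.finBasis k V))
    (fun j n => gammaToGr i V p (gammaElt k i (p * n) (Module.finBasis k V j))) fun j =>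
    ((isDPSeq_gammaElt (i := i) (Module.finBasis k V j)).mul_prime k p).map
      (gammaToGr i V p).toRingHom

variable (k p i) in
/-- The divided powers of the `p`-th power of `v`, in `Γ(V^(1)[pi])`. -/
noncomputable def twistElt (n : ℕ) {V : FGModuleCat.{u} k} (v : V) :
    (gammaTwist k p 1 (p * i)).obj V :=
  gammaElt k (p * i) n (V := FGModuleCat.of k ((twist k p 1).obj V))
    (twistPow k p 1 (v : (V : Type u)))

theorem isDPSeq_twistElt (v : V) : IsDPSeq fun n => twistElt k i p n v :=
  isDPSeq_gammaElt (V := FGModuleCat.of k ((twist k p 1).obj V)) _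

/-- The homomorphism was defined through a basis; this formula for all v shows that it does not
depend on it. For a sum x + y, the terms of γ_{pn}(x + y) whose index is prime to p vanish in gr⁰,
and those left over are the terms γ_{pa}(x) γ_{pb}(y) that correspond to γₙ(x^p + y^p). -/
theorem gammaTwistLift_twistElt (n : ℕ) (v : V) :
    gammaTwistLift i V p (twistElt k i p n v) = gammaToGr i V p (gammaElt k i (p * n) v) := by
  have hv : v ∈ Submodule.span k (Set.range (Module.finBasis k V)) := by
    rw [(Module.finBasis k V).span_eq]; trivial
  induction hv using Submodule.span_induction generalizing n with
  | mem x hx =>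
    obtain ⟨j, rfl⟩ := hx
    have h := gammaLift_dp (twistBasis p 1 (Module.finBasis k V))
      (fun j n => gammaToGr i V p (gammaElt k i (p * n) (Module.finBasis k V j))) (fun j =>
      ((isDPSeq_gammaElt (i := i) (Module.finBasis k V j)).mul_prime k p).map
        (gammaToGr i V p).toRingHom) n j
    rw [twistBasis_apply] at h
    exact h
  | zero =>
    have h1 : twistPow k p 1 (0 : (V : Type u)) = 0 := by
      have := twistPow_smul p 1 (0 : k) (0 : (V : Type u))
      rwa [zero_smul, zero_pow (pow_ne_zero 1 hp.out.ne_zero), zero_smul] at this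
    rcases n with _ | n
    · rw [mul_zero, (isDPSeq_twistElt (0 : V)).zero, (isDPSeq_gammaElt (0 : V)).zero, map_one,
        map_one]
    · rw [gammaElt_null _ (mul_ne_zero hp.out.ne_zero n.succ_ne_zero), map_zero, twistElt, h1]
      refine (congrArg _ (gammaElt_null (V := FGModuleCat.of k ((twist k p 1).obj V)) (n + 1)
        n.succ_ne_zero)).trans (map_zero _)
  | add x y _ _ hx hy =>
    have h : twistElt k i p n (x + y) = ∑ z ∈ Finset.HasAntidiagonal.antidiagonal n,
        twistElt k i p z.1 x * twistElt k i p z.2 y := by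
      rw [twistElt, twistPow_add]
      exact gammaElt_add (V := FGModuleCat.of k ((twist k p 1).obj V)) _ _ _
    rw [h, gammaElt_add, map_sum, map_sum, sum_antidiagonal_mul hp.out.ne_zero]
    · refine Finset.sum_congr rfl fun z _ => ?_
      rw [map_mul, map_mul, hx, hy]
    · intro z hz
      rw [map_mul, gammaToGr_eq_zero _ hz, zero_mul]
  | smul c x _ hx =>
    have h : twistElt k i p n (c • x) = (c ^ p) ^ n • twistElt k i p n x := by
      rw [twistElt, twistPow_smul, pow_one]
      exact gammaElt_smul (V := FGModuleCat.of k ((twist k p 1).obj V)) _ _ _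
    rw [h, gammaElt_smul, map_smul, map_smul, hx, pow_mul]

/-- The same computation for elements of R ⊗ W, as needed for naturality over R. -/
theorem ext_gammaTwistLift {R : Type u} [CommRing R] [Algebra k R] (n : ℕ) (y : R ⊗[k] W) :
    ext R (gammaTwistLift i W p) (dpowDeg (p * i) (W := FGModuleCat.of k ((twist k p 1).obj W)) n
      (frob p 1 y)) = ext R (gammaToGr i W p) (dpowDeg i (p * n) y) := by
  induction y generalizing n with
  | zero =>
    rw [frob_zero, dpowDeg_null]
    refine (congrArg _ (dpowDeg_null (W := FGModuleCat.of k ((twist k p 1).obj W)) n)).trans ?_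
    by_cases hn : n = 0
    · rw [if_pos hn, if_pos (by rw [hn, mul_zero]), map_one]
      exact map_one _
    · rw [if_neg hn, if_neg (mul_ne_zero hp.out.ne_zero hn), map_zero]
      exact map_zero _
  | tmul a w =>
    rw [frob_tmul, pow_one, dpowDeg_tmul]
    refine (congrArg _ (dpowDeg_tmul (W := FGModuleCat.of k ((twist k p 1).obj W)) n (a ^ p)
      (twistPow k p 1 (w : (W : Type u))))).trans ?_
    refine (Algebra.TensorProduct.map_tmul _ _ _ _).trans
      (Eq.trans ?_ (Algebra.TensorProduct.map_tmul _ _ _ _).symm)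
    rw [pow_mul]
    exact congrArg (_ ⊗ₜ[k] ·) (gammaTwistLift_twistElt n w)
  | add x y hx hy =>
    rw [frob_add, dpowDeg_add, map_sum, sum_antidiagonal_mul hp.out.ne_zero]
    · refine (congrArg _ (dpowDeg_add (W := FGModuleCat.of k ((twist k p 1).obj W)) n
        (frob p 1 x) (frob p 1 y))).trans ((map_sum _ _ _).trans ?_)
      refine Finset.sum_congr rfl fun z _ => ?_
      rw [map_mul, ← hx, ← hy]
      exact map_mul _ _ _
    · intro z hz
      rw [map_mul, ext_gammaToGr_eq_zero _ hz, zero_mul]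

theorem adjoin_twistElt_basis {ι : Type*} [Fintype ι] (b : Module.Basis ι k V) :
    Algebra.adjoin k (Set.range fun s : ι × ℕ => twistElt k i p (p ^ s.2) (b s.1)) = ⊤ := by
  have h := adjoin_dp_basis p (twistBasis p 1 b)
  simp only [twistBasis_apply] at h
  exact h

theorem adjoin_twistElt :
    Algebra.adjoin k {x | ∃ n, ∃ v : V, x = twistElt k i p n v} = ⊤ := by
  refine eq_top_iff.2 ((adjoin_twistElt_basis (Module.finBasis k V)).ge.trans
    (Algebra.adjoin_mono ?_))
  rintro _ ⟨s, rfl⟩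
  exact ⟨_, _, rfl⟩

variable (k i p) in
/-- The morphism `Γ(V^(1)[pi]) → gr Γ(V[i])`. -/
noncomputable def gammaTwistToGr : Hom (gammaTwist k p 1 (p * i))
    (dpFiltration k i _ (isAdmissible_one p)).gr :=
  Hom.ofGen (fun V => gammaTwistLift i V p) (fun V => {x | ∃ n, ∃ v : V, x = twistElt k i p n v})
    (fun V => adjoin_twistElt) (by
      rintro R _ _ V W s f _ ⟨n, v, rfl⟩
      rw [gammaTwistLift_twistElt, Filtration.gr_mapRes_toGrZero, gammaDeg_mapRes,
        ← ext_gammaTwistLift]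
      refine congrArg _ ((gammaDeg_mapRes (V := FGModuleCat.of k ((twist k p 1).obj V))
        (W := FGModuleCat.of k ((twist k p 1).obj W)) s ((twist k p 1).map f) n _).trans ?_)
      refine congrArg _ ((congrArg (s ^ (p * i) • ·) (twist_map_twistPow p 1 f v)).trans ?_)
      -- The Frobenius turns `s ^ i` into its p-th power, whence the degree pi of V^(1).
      rw [frob_smul, pow_one, ← pow_mul, mul_comm]
      rfl)

theorem gammaTwistToGr_twistElt (n : ℕ) (v : V) :
    (gammaTwistToGr k i p).app V (twistElt k i p n v) =
      gammaToGr i V p (gammaElt k i (p * n) v) :=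
  gammaTwistLift_twistElt n v

variable (k i p) in
/-- The morphism `Q(V[i]) ⊗ Γ(V^(1)[pi]) → gr Γ(V[i])`. -/
noncomputable def tensorToGr : Hom ((truncDeg k p i).tensor (gammaTwist k p 1 (p * i)))
    (dpFiltration k i _ (isAdmissible_one p)).gr :=
  (truncToGrHom k i p).tensorLift (gammaTwistToGr k i p)

theorem tensorToGr_tmul (a : (truncDeg k p i).obj V) (c : (gammaTwist k p 1 (p * i)).obj V) :
    (tensorToGr k i p).app V (a ⊗ₜ[k] c) =
      (truncToGrHom k i p).app V a * (gammaTwistToGr k i p).app V c :=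
  Hom.tensorLift_tmul _ _ V a c

/-- Since p^{r+1} is not 1, these generators have order 0 and their classes lie in gr⁰. -/
theorem grElt_succ (r : ℕ) (v : V) : grElt i (isAdmissible_one p) (r + 1) v =
    gammaToGr i V p (gammaElt k i (p ^ (r + 1)) v) := by
  refine Filtration.toGr_congr _ (if_neg fun h => ?_) _ _ rfl
  exact r.succ_ne_zero ((Nat.pow_eq_one.1 h).resolve_left hp.out.ne_one)

/-- The generators are divided between the factors: γ₁(b_j) comes from b_j in Q(V), and
γ_{p^{r+1}}(b_j) from γ_{p^r}(b_j^p) in Γ(V^(1)). All have zero p-th powers. -/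
theorem tensorToGr_bijective (V : FGModuleCat.{u} k) :
    Function.Bijective ((tensorToGr k i p).app V) := by
  let b := Module.finBasis k V
  let y : Fin (Module.finrank k V) × ℕ →
      ((truncDeg k p i).tensor (gammaTwist k p 1 (p * i))).obj V := fun s =>
    match s with
    | (j, 0) => truncLin k p i V (b j) ⊗ₜ[k] (1 : (gammaTwist k p 1 (p * i)).obj V)
    | (j, r + 1) => (1 : (truncDeg k p i).obj V) ⊗ₜ[k] twistElt k i p (p ^ r) (b j)
  refine bijective_of_gen _ b ((tensorToGr k i p).app V) (y := y) ?_ ?_ ?_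
  · rintro ⟨j, _ | r⟩
    · refine (Algebra.TensorProduct.tmul_pow _ _ _).trans ?_
      rw [truncLin_pow, zero_tmul]
      rfl
    · refine (Algebra.TensorProduct.tmul_pow _ _ _).trans ?_
      rw [(isDPSeq_twistElt (b j)).pow_prime k p r, tmul_zero]
      rfl
  · refine adjoin_tensor (A := (truncDeg k p i).obj V) (B := (gammaTwist k p 1 (p * i)).obj V)
      (C := Algebra.adjoin k (Set.range y)) (adjoin_truncLin p i b.span_eq)
      (adjoin_twistElt_basis b) ?_ ?_
    · rintro _ ⟨_, ⟨j, rfl⟩, rfl⟩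
      exact Algebra.subset_adjoin
        (A := ((truncDeg k p i).tensor (gammaTwist k p 1 (p * i))).obj V) ⟨(j, 0), rfl⟩
    · rintro _ ⟨⟨j, r⟩, rfl⟩
      exact Algebra.subset_adjoin
        (A := ((truncDeg k p i).tensor (gammaTwist k p 1 (p * i))).obj V) ⟨(j, r + 1), rfl⟩
  · rintro ⟨j, _ | r⟩
    · refine (tensorToGr_tmul _ _).trans ?_
      rw [truncToGrHom_truncLin, map_one, mul_one]
    · refine (tensorToGr_tmul _ _).trans ?_
      rw [map_one, one_mul, gammaTwistToGr_twistElt, grElt_succ, pow_succ']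

/-! ### Compatibility with the grading of `gr Γ(V[i])` -/

/-- The image of P n together with the Q m for m ≠ n spans everything, while Q n meets the span of
these Q m trivially. By the modular law the image of P n fills Q n, so one inclusion for each index
suffices. -/
theorem _root_.Submodule.map_eq_of_iSupIndep {K M M' ι : Type*} [Ring K] [AddCommGroup M]
    [Module K M] [AddCommGroup M'] [Module K M'] {P : ι → Submodule K M} {Q : ι → Submodule K M'}
    {g : M →ₗ[K] M'} (hg : Function.Surjective g) (hP : ⨆ n, P n = ⊤) (hQ : iSupIndep Q)
    (h : ∀ n, (P n).map g ≤ Q n) (n : ι) : (P n).map g = Q n := by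
  refine eq_of_le_of_inf_le_of_sup_le (z := ⨆ (m) (_ : m ≠ n), Q m) (h n) ?_ ?_
  · rw [(hQ n).eq_bot]
    exact bot_le
  · refine le_top.trans ?_
    rw [← LinearMap.range_eq_top.2 hg, ← Submodule.map_top, ← hP, Submodule.map_iSup]
    refine iSup_le fun m => ?_
    by_cases hm : m = n
    · subst hm
      exact le_sup_left
    · exact le_sup_of_le_right ((h m).trans (le_iSup₂_of_le m hm le_rfl))

theorem truncLin_mem_comp (v : V) : truncLin k p i V v ∈ (truncDeg k p i).comp 1 i V := by
  rw [mem_comp_iff]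
  intro R _ _ r s
  rw [truncDeg_mapRes, LinearMap.smul_apply, LinearMap.id_apply, smul_tmul', smul_tmul',
    LinearMap.baseChange_tmul]
  congr 1
  rw [smul_eq_mul, smul_eq_mul, mul_one, pow_one, mul_comm]

/-- An element of weight n is a combination of products of n elements of V, each of which has its
class in gr¹. -/
theorem truncToGrHom_mem_piece {n j : ℕ} {a : (truncDeg k p i).obj V}
    (ha : a ∈ (truncDeg k p i).comp n j V) : (truncToGrHom k i p).app V a ∈
      (dpFiltration k i _ (isAdmissible_one p)).piece n V := by
  let b := Module.finBasis k V
  have hb : Algebra.adjoin k (Set.range fun s => truncLin k p i V (b s)) = ⊤ := by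
    have h := adjoin_truncLin p i b.span_eq
    rwa [← Set.range_comp] at h
  have h := comp_le_span _ V (fun s => truncLin_mem_comp (p := p) (i := i) (b s)) hb n j ha
  clear ha
  induction h using Submodule.span_induction with
  | mem x hx =>
    obtain ⟨a, ha, rfl⟩ := hx
    have h1 : (truncToGrHom k i p).app V (a.prod fun s n => truncLin k p i V (b s) ^ n) =
        a.prod fun s n => grElt i (isAdmissible_one p) 0 (b s) ^ n := by
      simp only [Finsupp.prod, map_prod, map_pow, truncToGrHom_truncLin]
    have h2 := Filtration.toGr_prod (dpFiltration k i _ (isAdmissible_one p))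
      (fun s => gammaElt_pow_mem (isAdmissible_one p) 0 (b s)) a
    have h3 : (a.sum fun _ n => n * ordGen p {1} 0) = n := by
      rw [ordGen_eq_one pow_zero_mem_one]
      exact ha
    refine Eq.mpr (congrArg (· ∈ _) (h1.trans h2)) ?_
    exact h3 ▸ ⟨_, rfl⟩
  | zero => rw [map_zero]; exact zero_mem _
  | add x y _ _ hx hy => rw [map_add]; exact add_mem hx hy
  | smul c x _ hx => rw [map_smul]; exact Submodule.smul_mem _ _ hx

/-- The second factor lands in gr⁰ and so does not change the index of a piece under multiplication.
-/
theorem exists_gammaTwistToGr_eq (c : (gammaTwist k p 1 (p * i)).obj V) :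
    ∃ a, (gammaTwistToGr k i p).app V c = gammaToGr i V p a := by
  have h : (gammaToGr i V p).range.comap ((gammaTwistToGr k i p).app V) = ⊤ := by
    refine eq_top_iff.2 (adjoin_twistElt.ge.trans (Algebra.adjoin_le ?_))
    rintro _ ⟨n, v, rfl⟩
    exact ⟨_, (gammaTwistToGr_twistElt n v).symm⟩
  have hc : c ∈ (gammaToGr i V p).range.comap ((gammaTwistToGr k i p).app V) := by
    rw [h]; trivial
  obtain ⟨a, ha⟩ := hc
  exact ⟨a, ha.symm⟩

theorem map_tensorLeft_le (n : ℕ) (V : FGModuleCat.{u} k) :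
    (tensorLeft (truncDeg k p i) (gammaTwist k p 1 (p * i))
      ((truncDeg k p i).comp n (i * n) V)).map ((tensorToGr k i p).app V).toLinearMap ≤
      (dpFiltration k i _ (isAdmissible_one p)).piece n V := by
  rintro _ ⟨_, ⟨z, rfl⟩, rfl⟩
  induction z with
  | zero =>
    refine Eq.mpr (congrArg (· ∈ _) ((congrArg _ (map_zero _)).trans (map_zero _))) (zero_mem _)
  | tmul a c =>
    refine Eq.mpr (congrArg (· ∈ _) (tensorToGr_tmul (a : (truncDeg k p i).obj V) c)) ?_
    obtain ⟨x, hx⟩ := truncToGrHom_mem_piece a.2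
    obtain ⟨y, hy⟩ := exists_gammaTwistToGr_eq c
    rw [← hx, hy, Filtration.toGrZero_apply _ y (by rw [Filtration.sub_zero]; trivial),
      Filtration.toGr_mul]
    exact ⟨_, rfl⟩
  | add x y hx hy =>
    refine Eq.mpr (congrArg (· ∈ _) ((congrArg _ (map_add _ x y)).trans (map_add _ _ _))) ?_
    exact add_mem hx hy

/-- Q(V[i]) is generated in weight 1 and degree i, so a monomial of weight n has degree in and no
other components are needed. -/
theorem iSup_tensorLeft (V : FGModuleCat.{u} k) :
    ⨆ n, tensorLeft (truncDeg k p i) (gammaTwist k p 1 (p * i))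
      ((truncDeg k p i).comp n (i * n) V) = ⊤ := by
  let b := Module.finBasis k V
  have hb : Algebra.adjoin k (Set.range fun s => truncLin k p i V (b s)) = ⊤ := by
    have h := adjoin_truncLin p i b.span_eq
    rwa [← Set.range_comp] at h
  have key : ∀ (a : (truncDeg k p i).obj V) (c : (gammaTwist k p 1 (p * i)).obj V),
      (a ⊗ₜ[k] c : ((truncDeg k p i).tensor (gammaTwist k p 1 (p * i))).obj V) ∈
      ⨆ n, tensorLeft (truncDeg k p i) (gammaTwist k p 1 (p * i))
        ((truncDeg k p i).comp n (i * n) V) := by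
    intro a c
    have ha : a ∈ Submodule.span k (Set.range fun a : Fin (Module.finrank k V) →₀ ℕ =>
        a.prod fun s n => truncLin k p i V (b s) ^ n) := by
      rw [span_monomials hb]; trivial
    induction ha using Submodule.span_induction with
    | mem x hx =>
      obtain ⟨a, rfl⟩ := hx
      have h := monomial_mem_comp _ V (fun s => truncLin_mem_comp (p := p) (i := i) (b s)) a
      have e : (a.sum fun _ n => n * i) = i * a.sum fun _ n => n * 1 := by
        rw [Finsupp.mul_sum]
        exact Finsupp.sum_congr fun s _ => by rw [mul_one, mul_comm]
      rw [e] at h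
      exact Submodule.mem_iSup_of_mem
        (M := ((truncDeg k p i).tensor (gammaTwist k p 1 (p * i))).obj V) _ ⟨⟨_, h⟩ ⊗ₜ c, rfl⟩
    | zero => exact Eq.mpr (congrArg (· ∈ _) (zero_tmul _ c)) (zero_mem _)
    | add x y _ _ hx hy => exact Eq.mpr (congrArg (· ∈ _) (add_tmul x y c)) (add_mem hx hy)
    | smul r x _ hx =>
      refine Eq.mpr (congrArg (· ∈ _) ?_) (Submodule.smul_mem _ r hx)
      rfl
  refine eq_top_iff.2 fun x _ => ?_
  induction x using TensorProduct.induction_on with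
  | zero =>
    exact zero_mem (M := ((truncDeg k p i).tensor (gammaTwist k p 1 (p * i))).obj V) _
  | tmul a c => exact key a c
  | add x y hx hy =>
    exact add_mem (M := ((truncDeg k p i).tensor (gammaTwist k p 1 (p * i))).obj V) (hx trivial)
      (hy trivial)

theorem map_tensorLeft (n : ℕ) (V : FGModuleCat.{u} k) :
    (tensorLeft (truncDeg k p i) (gammaTwist k p 1 (p * i))
      ((truncDeg k p i).comp n (i * n) V)).map ((tensorToGr k i p).app V).toLinearMap =
      (dpFiltration k i _ (isAdmissible_one p)).piece n V :=
  Submodule.map_eq_of_iSupIndep (g := ((tensorToGr k i p).app V).toLinearMap)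
    (tensorToGr_bijective V).2 (iSup_tensorLeft V)
    ((dpFiltration k i _ (isAdmissible_one p)).isInternal_piece V).submodule_iSupIndep
    (fun n => map_tensorLeft_le n V) n

theorem map_piece (n : ℕ) (V : FGModuleCat.{u} k) :
    ((dpFiltration k i _ (isAdmissible_one p)).piece n V).map
      ((Iso.ofBijective (tensorToGr k i p) tensorToGr_bijective).app V).toLinearMap =
    tensorLeft (truncDeg k p i) (gammaTwist k p 1 (p * i))
      ((truncDeg k p i).comp n (i * n) V) := by
  rw [← map_tensorLeft, ← Submodule.map_comp]
  have e : ((Iso.ofBijective (tensorToGr k i p) tensorToGr_bijective).app V).toLinearMap ∘ₗ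
      ((tensorToGr k i p).app V).toLinearMap = LinearMap.id :=
    LinearMap.ext fun x =>
      (AlgEquiv.ofBijective ((tensorToGr k i p).app V) (tensorToGr_bijective V)).symm_apply_apply x
  rw [e, Submodule.map_id]

end PAlg

end StrictPoly

/-! ### The two quasi-trivial filtrations -/

theorem mainTheorem12 (k : Type u) [Field k] (p : ℕ) [Fact p.Prime] [CharP k p] (i : ℕ) :
    (∃ F : StrictPoly.PAlg.Filtration (StrictPoly.PAlg.gammaDeg k i),
      (∀ n V, F.sub n V = (StrictPoly.PAlg.principalIdeal k i V ^ n).restrictScalars k) ∧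
      F.IsQuasiTrivial ∧
      ∃ e : StrictPoly.PAlg.Iso F.gr
          ((StrictPoly.PAlg.truncDeg k p i).tensor (StrictPoly.PAlg.gammaTwist k p 1 (p * i))),
        ∀ n V, (F.piece n V).map (e.app V).toLinearMap =
          StrictPoly.PAlg.tensorLeft (StrictPoly.PAlg.truncDeg k p i)
            (StrictPoly.PAlg.gammaTwist k p 1 (p * i))
            ((StrictPoly.PAlg.truncDeg k p i).comp n (i * n) V)) ∧
    (∃ F : StrictPoly.PAlg.Filtration (StrictPoly.PAlg.gammaDeg k i), F.IsQuasiTrivial ∧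
      Nonempty (StrictPoly.PAlg.Iso F.gr
        (StrictPoly.PAlg.infTensor fun r => StrictPoly.PAlg.truncTwist k p r (i * p ^ r)))) := by
  -- The exponent set {1} gives the powers of the ideal generated by V, and the set of nonzero
  -- exponents the powers of the augmentation ideal.
  refine ⟨⟨StrictPoly.PAlg.dpFiltration k i _ (StrictPoly.PAlg.isAdmissible_one p), fun n V => ?_,
    StrictPoly.PAlg.dpFiltration_isQuasiTrivial _,
    StrictPoly.PAlg.Iso.ofBijective _ StrictPoly.PAlg.tensorToGr_bijective,
    StrictPoly.PAlg.map_piece⟩,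
    ⟨StrictPoly.PAlg.dpFiltration k i _ (StrictPoly.PAlg.isAdmissible_pos p),
      StrictPoly.PAlg.dpFiltration_isQuasiTrivial _,
      ⟨StrictPoly.PAlg.Iso.ofBijective _ StrictPoly.PAlg.infTensorLift_bijective⟩⟩⟩
  rw [StrictPoly.PAlg.principalIdeal_eq]
  rfl
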